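/- Let $d\ge 1$. For $\mathbf m=(m_1,\dots,m_d)\in\mathbb N^d$ (with $\mathbb N=\{1,2,\dots\}$) let $\langle\mathbf m\rangle=\{1,\dots,m_1\}\times\cdots\times\{1,\dots,m_d\}\subset\mathbb Z^d$ and $|\mathbf m|=m_1\cdots m_d$; $\mathbf m\to\infty$ means that $m_1,\dots,m_d\to\infty$. A dimer is a pair $\{\mathbf i,\mathbf i+\mathbf e_k\}\subset\mathbb Z^d$ of neighboring points, and a monomer is a single point. Encode monomers and dimers by $2d+1$ colors: the dimer $\{\mathbf i,\mathbf i+\mathbf e_k\}$ gives color $k$ to $\mathbf i$ and color $k+d$ to $\mathbf i+\mathbf e_k$, and a monomer gets color $2d+1$. A coloring is admissible if, for all $k$ and all neighbors $\mathbf i,\mathbf i+\mathbf e_k$ in its domain, $\mathbf i$ has color $k$ if and only if $\mathbf i+\mathbf e_k$ has color $k+d$. Let $W(\mathbf m)$ be the set of admissible colorings of $\langle\mathbf m\rangle$ with the $2d+1$ colors (monomer-dimer covers of $\langle\mathbf m\rangle$ in which dimers may protrude from the box), and let $\widetilde W(\mathbf m)$ be the set of those that do not use color $2d+1$ (dimer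 covers). Let $\widetilde W_{\rm per}(\mathbf m)\subseteq\widetilde W(\mathbf m)$ be the set of those that extend to admissible colorings of $\mathbb Z^d$ without color $2d+1$ and with period $m_k$ in each direction $\mathbf e_k$. Let $W_0(\mathbf m)\subseteq W(\mathbf m)$ and $\widetilde W_0(\mathbf m)\subseteq\widetilde W(\mathbf m)$ be the subsets of tilings, in which every dimer lies inside $\langle\mathbf m\rangle$, and let $W_0(\mathbf m,s)\subseteq W_0(\mathbf m)$ be the set of tilings with exactly $s$ dimers. The following limits exist: $$h_d:=\lim_{\mathbf m\to\infty}\frac{\log\#W(\mathbf m)}{|\mathbf m|},\qquad \tilde h_d:=\lim_{\mathbf m\to\infty}\frac{\log\#\widetilde W(\mathbf m)}{|\mathbf m|},$$ and for each $p\in[0,1]$ there is a number $\lambda_d(p)$ (Hammersley's monomer-dimer entropy with dimer density $p$) such that $$\lim_{q\to\infty}\frac{\log\#W_0(\mathbf m_q,s_q)}{|\mathbf m_q|}=\lambda_d(p)$$ for all sequences $\mathbf m_q\in\mathbb N^d$ and integers $0\le s_q\le|\mathbf m_q|/2$ with $\mathbf m_q\to\infty$ and $2s_q/|\mathbf m_q|\to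 p$. Theorem. The dimer entropy satisfies $$\tilde h_d=\lim_{\mathbf m\to\infty,\ |\mathbf m|\text{ even}}\frac{\log\#\widetilde W_{\rm per}(\mathbf m)}{|\mathbf m|}=\lim_{\mathbf m\to\infty,\ |\mathbf m|\text{ even}}\frac{\log\#\widetilde W_0(\mathbf m)}{|\mathbf m|},$$ and $$\lambda_d(0)=0,\qquad \lambda_d(1)=\tilde h_d,\qquad \max_{p\in[0,1]}\lambda_d(p)=h_d .$$ -/

import Mathlib

open Filter Topology

namespace MonomerDimer

/-- The box with side lengths `m 0, …, m (d-1)`; coordinates start at `0`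
(a translate of the box `{1, …, m 0} × ⋯ × {1, …, m (d-1)}`). -/
abbrev Box {d : ℕ} (m : Fin d → ℕ) : Type := (k : Fin d) → Fin (m k)

/-- The number of points of the box. -/
def vol {d : ℕ} (m : Fin d → ℕ) : ℕ := ∏ k, m k

/-- A point of the box, seen in the grid `ℤ^d`. -/
def Box.toGrid {d : ℕ} {m : Fin d → ℕ} (i : Box m) : Fin d → ℤ := fun k => ((i k : ℕ) : ℤ)

/-- The unit vector in direction `k`. -/
def unit {d : ℕ} (k : Fin d) : Fin d → ℤ := Pi.single k 1

section NearestNeighbor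

/-- The colorings of the box allowed by the nearest neighbor digraph `Γ = (Γ_1, …, Γ_d)`:
only pairs of neighbors that both lie in the box are constrained. -/
def boxCovers {d : ℕ} {α : Type} (Γ : Fin d → α → α → Prop) (m : Fin d → ℕ) :
    Set (Box m → α) :=
  {ψ | ∀ (k : Fin d) (i j : Box m), j.toGrid = i.toGrid + unit k → Γ k (ψ i) (ψ j)}

/-- The colorings of the whole grid `ℤ^d` allowed by `Γ`. -/
def gridCovers {d : ℕ} {α : Type} (Γ : Fin d → α → α → Prop) : Set ((Fin d → ℤ) → α) :=
  {φ | ∀ (k : Fin d) (i : Fin d → ℤ), Γ k (φ i) (φ (i + unit k))}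

/-- The colorings of the box that extend to an allowed coloring of `ℤ^d` with period `m`. -/
def periodicCovers {d : ℕ} {α : Type} (Γ : Fin d → α → α → Prop) (m : Fin d → ℕ) :
    Set (Box m → α) :=
  {ψ | ∃ φ ∈ gridCovers Γ,
    (∀ (k : Fin d) (i : Fin d → ℤ), φ (i + (m k : ℤ) • unit k) = φ i) ∧
    ∀ i : Box m, φ i.toGrid = ψ i}

end NearestNeighbor

/-- The `2d` colors for dimer halves. A dimer on `i` and `i + e_k` gives `i` the color `Sum.inl k`
and `i + e_k` the color `Sum.inr k`. -/
abbrev DimerColor (d : ℕ) : Type := Fin d ⊕ Fin d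

/-- The `2d + 1` colors for monomer-dimer covers; `none` is the color of a monomer. -/
abbrev Color (d : ℕ) : Type := Option (DimerColor d)

/-- The digraph of monomer-dimer covers: the color `Sum.inl k` at `i` is allowed exactly together
with the color `Sum.inr k` at `i + e_k`. -/
def monomerDimerDigraph (d : ℕ) (k : Fin d) (a b : Color d) : Prop :=
  a = some (Sum.inl k) ↔ b = some (Sum.inr k)

/-- The digraph of dimer covers: the monomer color is removed. -/
def dimerDigraph (d : ℕ) (k : Fin d) (a b : DimerColor d) : Prop :=
  monomerDimerDigraph d k (some a) (some b)

/-- No dimer protrudes from the box: the other half of each dimer half lies in the box. -/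
def NoProtrusion {d : ℕ} {m : Fin d → ℕ} (ψ : Box m → Color d) : Prop :=
  ∀ (i : Box m) (k : Fin d),
    (ψ i = some (Sum.inl k) → ∃ j : Box m, j.toGrid = i.toGrid + unit k) ∧
    (ψ i = some (Sum.inr k) → ∃ j : Box m, i.toGrid = j.toGrid + unit k)

/-- Monomer-dimer covers of the box; dimers may protrude. -/
def mdCovers {d : ℕ} (m : Fin d → ℕ) : Set (Box m → Color d) :=
  boxCovers (monomerDimerDigraph d) m

/-- Monomer-dimer tilings of the box, in which no dimer protrudes. -/
def mdTilings {d : ℕ} (m : Fin d → ℕ) : Set (Box m → Color d) :=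
  {ψ ∈ mdCovers m | NoProtrusion ψ}

/-- Number of dimers of a monomer-dimer tiling, counted by their lower halves. -/
noncomputable def dimerCount {d : ℕ} {m : Fin d → ℕ} (ψ : Box m → Color d) : ℕ :=
  {i : Box m | ∃ k : Fin d, ψ i = some (Sum.inl k)}.ncard

/-- Monomer-dimer tilings of the box with exactly `s` dimers. -/
def mdTilingsWith {d : ℕ} (m : Fin d → ℕ) (s : ℕ) : Set (Box m → Color d) :=
  {ψ ∈ mdTilings m | dimerCount ψ = s}

/-- Dimer covers of the box; dimers may protrude. -/
def dimerCovers {d : ℕ} (m : Fin d → ℕ) : Set (Box m → DimerColor d) :=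
  boxCovers (dimerDigraph d) m

/-- Periodic dimer covers of the box, i.e. dimer covers of the torus. -/
def dimerPeriodicCovers {d : ℕ} (m : Fin d → ℕ) : Set (Box m → DimerColor d) :=
  periodicCovers (dimerDigraph d) m

/-- Dimer tilings of the box, in which no dimer protrudes. -/
def dimerTilings {d : ℕ} (m : Fin d → ℕ) : Set (Box m → DimerColor d) :=
  {ψ ∈ dimerCovers m | NoProtrusion (fun i => some (ψ i))}

/-- `log n / vol m`, the normalized logarithm of a count `n` of configurations of the box. -/
noncomputable def normLog {d : ℕ} (m : Fin d → ℕ) (n : ℕ) : ℝ := Real.log n / vol m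

/-- The monomer-dimer entropy `h_d`. The filter `atTop` on `Fin d → ℕ` is the filter of
all side lengths tending to infinity. -/
noncomputable def mdEntropy (d : ℕ) : ℝ :=
  limUnder atTop fun m : Fin d → ℕ => normLog m (mdCovers m).ncard

/-- The dimer entropy. -/
noncomputable def dimerEntropy (d : ℕ) : ℝ :=
  limUnder atTop fun m : Fin d → ℕ => normLog m (dimerCovers m).ncard

/-- The filter of all `m → ∞` of even volume. -/
def evenVolume (d : ℕ) : Filter (Fin d → ℕ) := atTop ⊓ 𝓟 {m | Even (vol m)}

/-- The filter on pairs `(m, s)` that expresses `m → ∞`, `s ≤ vol m / 2` and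
`2 s / vol m → p`. -/
noncomputable def densityFilter (d : ℕ) (p : ℝ) : Filter ((Fin d → ℕ) × ℕ) :=
  comap Prod.fst atTop ⊓ 𝓟 {x | 2 * x.2 ≤ vol x.1} ⊓
    comap (fun x => 2 * (x.2 : ℝ) / (vol x.1 : ℝ)) (𝓝 p)

/-- The monomer-dimer entropy `λ_d(p)` with dimer density `p`: the limit of the normalized
logarithms of the numbers of monomer-dimer tilings with `s` dimers, as
`m → ∞` and `2 s / vol m → p`. -/
noncomputable def densityEntropy (d : ℕ) (p : ℝ) : ℝ :=
  limUnder (densityFilter d p) fun x => normLog x.1 (mdTilingsWith x.1 x.2).ncard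

end MonomerDimer

namespace MonomerDimer

/-! ### The grid graph and its matchings -/

section Grid

variable {d : ℕ}

/-! A tiling is treated as a matching of grid points, that is, an involution that moves each point
to itself or to a neighbor (`bijOn_partnerMap`). A cover is determined by its colors on the boundary
of the box together with the dimers inside. The boundary has o(|m|) points, so boundary colors never
affect an entropy.

Upper bounds come from cutting a large box into translates of a fixed box b. If all but o(|n|)
blocks carry a coloring from a set K, the rate is at most that of K, up to log 2 / |b| and o(1)
(`eventually_normLog_le_of_blocks`). This gives the limits h and h̃ by a Fekete-type argument
(`exists_tendsto_of_blocks`), λ(0) = 0 since few dimers leave most blocks empty, and λ(1) ≤ h̃ since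
few monomers leave most blocks dimer covers.

Lower bounds come from filling part of a large box with well-tiled even blocks and placing the
missing dimers in an almost perfect matching of the rest (`pow_le_numMatchings_box`). For 0 < p < 1,
a single box with rate near the limsup then forces the liminf up to the limsup.

The hard inequality is λ(1) ≥ h̃, because dimers of a cover may protrude. Fix a most frequent
boundary coloring of a box with sides M. The points Ω whose dimers stay inside then have about
exp(h̃|M|) perfect matchings (`exists_ncard_dimerCovers_le`), and the other points D lie on the
boundary. Reflecting the box repeatedly in its walls fills an unfolded box with copies of Ω, and
each point of D can be matched with its mirror image across a wall. On the outer faces these images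
are missing. There the pattern of points matched outward has period 2M, and a reflection within the
face exchanges its two chessboard colors (this needs d ≥ 2). So each period is balanced, and a
collar whose thickness depends only on M, not on the size of the unfolded box, closes it up
(`exists_tileable_slab`, `tileable_outerBox`). The result is even boxes with nearly exp(h̃|n|)
perfect matchings. For d = 1 there are at most two dimer covers of a box and h̃ ≤ 0.

Tilings, periodic covers and covers are nested, which gives the even-volume limits. For the maximum,
a most frequent dimer count loses only a factor |m| + 1, and compactness of [0,1] yields a limiting
density. -/

@[simp] lemma unit_same (k : Fin d) : unit k k = 1 := by simp [unit]

lemma unit_of_ne {j k : Fin d} (h : j ≠ k) : unit k j = 0 := by simp [unit, h]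

lemma unit_apply (j k : Fin d) : unit k j = if j = k then 1 else 0 := by
  simp [unit, Pi.single_apply]

/-- Adjacency in the grid. -/
def GridAdj (x y : Fin d → ℤ) : Prop := ∃ k, y = x + unit k ∨ x = y + unit k

lemma GridAdj.symm {x y : Fin d → ℤ} (h : GridAdj x y) : GridAdj y x := by
  obtain ⟨k, h | h⟩ := h
  · exact ⟨k, Or.inr h⟩
  · exact ⟨k, Or.inl h⟩

lemma gridAdj_add_unit (x : Fin d → ℤ) (k : Fin d) : GridAdj x (x + unit k) := ⟨k, Or.inl rfl⟩

lemma gridAdj_sub_unit (x : Fin d → ℤ) (k : Fin d) : GridAdj x (x - unit k) :=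
  ⟨k, Or.inr (by abel)⟩

lemma GridAdj.ne {x y : Fin d → ℤ} (h : GridAdj x y) : y ≠ x := by
  rintro rfl
  obtain ⟨k, h | h⟩ := h <;> simpa using congrFun h k

lemma GridAdj.add_right {x y : Fin d → ℤ} (h : GridAdj x y) (v : Fin d → ℤ) :
    GridAdj (x + v) (y + v) := by
  obtain ⟨k, h | h⟩ := h
  · exact ⟨k, Or.inl (by rw [h]; abel)⟩
  · exact ⟨k, Or.inr (by rw [h]; abel)⟩

/-- A partial matching of the grid graph, as an involution that moves each point to itself or to a
neighbor. -/
def IsMatching (f : (Fin d → ℤ) → (Fin d → ℤ)) : Prop :=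
  (∀ x, f (f x) = x) ∧ ∀ x, f x = x ∨ GridAdj x (f x)

/-- The matchings inside `A` that cover exactly `t` points. -/
def matchings (A : Finset (Fin d → ℤ)) (t : ℕ) : Set ((Fin d → ℤ) → (Fin d → ℤ)) :=
  {f | IsMatching f ∧ (∀ x, x ∉ A → f x = x) ∧ {x | f x ≠ x}.ncard = t}

/-- The number of matchings inside `A` that cover exactly `t` points. -/
noncomputable def numMatchings (A : Finset (Fin d → ℤ)) (t : ℕ) : ℕ := (matchings A t).ncard

lemma IsMatching.apply_mem {f : (Fin d → ℤ) → (Fin d → ℤ)} (hf : IsMatching f)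
    {A : Finset (Fin d → ℤ)} (hA : ∀ x, x ∉ A → f x = x) {x : Fin d → ℤ} (hx : x ∈ A) :
    f x ∈ A := by
  by_contra h
  have h1 := hA _ h
  rw [hf.1] at h1
  exact h (h1 ▸ hx)

lemma moved_subset {f : (Fin d → ℤ) → (Fin d → ℤ)} {A : Finset (Fin d → ℤ)}
    (hA : ∀ x, x ∉ A → f x = x) : {x | f x ≠ x} ⊆ (A : Set (Fin d → ℤ)) := by
  intro x hx
  by_contra h
  exact hx (hA x h)

lemma finite_matchings_all (A : Finset (Fin d → ℤ)) :
    {f : (Fin d → ℤ) → (Fin d → ℤ) | IsMatching f ∧ ∀ x, x ∉ A → f x = x}.Finite := by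
  rw [← Set.finite_coe_iff]
  refine Finite.of_injective
    (β := A → A) (fun f x => ⟨f.1 x.1, f.2.1.apply_mem f.2.2 x.2⟩) ?_
  intro f g h
  ext x : 2
  by_cases hx : x ∈ A
  · exact congrArg Subtype.val (congrFun h ⟨x, hx⟩)
  · rw [f.2.2 x hx, g.2.2 x hx]

lemma finite_matchings (A : Finset (Fin d → ℤ)) (t : ℕ) : (matchings A t).Finite :=
  (finite_matchings_all A).subset fun _ h => ⟨h.1, h.2.1⟩

lemma moved_finite {f : (Fin d → ℤ) → (Fin d → ℤ)} {A : Finset (Fin d → ℤ)}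
    (hA : ∀ x, x ∉ A → f x = x) : {x | f x ≠ x}.Finite :=
  A.finite_toSet.subset (moved_subset hA)

lemma one_le_numMatchings {A : Finset (Fin d → ℤ)} {t : ℕ} :
    1 ≤ numMatchings A t ↔ (matchings A t).Nonempty := by
  rw [numMatchings, Nat.one_le_iff_ne_zero, Ne, Set.ncard_eq_zero (finite_matchings A t),
    Set.nonempty_iff_ne_empty]

open Classical in
-- Matchings of disjoint sets act independently, so they glue to one matching, from which both can
-- be recovered.
lemma numMatchings_union {A B : Finset (Fin d → ℤ)} (h : Disjoint A B) (s t : ℕ) :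
    numMatchings A s * numMatchings B t ≤ numMatchings (A ∪ B) (s + t) := by
  unfold numMatchings
  rw [← Set.ncard_prod]
  refine Set.ncard_le_ncard_of_injOn (fun p x => if x ∈ A then p.1 x else p.2 x) ?_ ?_
    (finite_matchings _ _)
  · rintro ⟨f, g⟩ ⟨⟨hf, hfA, hfs⟩, hg, hgB, hgt⟩
    dsimp only at *
    have hdis : ∀ x, x ∈ A → x ∉ B := fun x hx hx' => Finset.disjoint_left.1 h hx hx'
    refine ⟨⟨fun x => ?_, fun x => ?_⟩, fun x hx => ?_, ?_⟩
    · dsimp only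
      by_cases hx : x ∈ A
      · rw [if_pos hx, if_pos (hf.apply_mem hfA hx), hf.1]
      · rw [if_neg hx]
        by_cases hx' : g x ∈ A
        · have h1 := hgB _ (hdis _ hx')
          rw [hg.1] at h1
          exact absurd (h1 ▸ hx') hx
        · rw [if_neg hx', hg.1]
    · dsimp only
      split_ifs
      · exact hf.2 x
      · exact hg.2 x
    · dsimp only
      rw [Finset.mem_union, not_or] at hx
      rw [if_neg hx.1, hgB x hx.2]
    · have : {x | (if x ∈ A then f x else g x) ≠ x} = {x | f x ≠ x} ∪ {x | g x ≠ x} := by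
        ext x
        simp only [Set.mem_ofPred_eq, Set.mem_union]
        by_cases hx : x ∈ A
        · rw [if_pos hx]
          simp [hgB x (hdis x hx)]
        · rw [if_neg hx]
          simp [hfA x hx]
      rw [this, Set.ncard_union_eq _ (moved_finite hfA) (moved_finite hgB), hfs, hgt]
      refine Set.disjoint_left.2 fun x hx hx' => ?_
      exact hdis x (moved_subset hfA hx) (moved_subset hgB hx')
  · rintro ⟨f, g⟩ ⟨⟨hf, hfA, hfs⟩, hg, hgB, hgt⟩ ⟨f', g'⟩ ⟨⟨hf', hfA', hfs'⟩, hg', hgB', hgt'⟩ he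
    dsimp only at *
    refine Prod.ext (funext fun x => ?_) (funext fun x => ?_) <;> have h1 := congrFun he x <;>
      dsimp only at h1 ⊢ <;> by_cases hx : x ∈ A
    · rwa [if_pos hx, if_pos hx] at h1
    · rw [hfA x hx, hfA' x hx]
    · have := Finset.disjoint_left.1 h hx
      rw [hgB x this, hgB' x this]
    · rwa [if_neg hx, if_neg hx] at h1

lemma numMatchings_map {g : (Fin d → ℤ) ≃ (Fin d → ℤ)}
    (hg : ∀ x y, GridAdj x y → GridAdj (g x) (g y)) (A : Finset (Fin d → ℤ)) (t : ℕ) :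
    numMatchings A t ≤ numMatchings (A.map g.toEmbedding) t := by
  refine Set.ncard_le_ncard_of_injOn (fun f x => g (f (g.symm x))) ?_ ?_ (finite_matchings _ _)
  · rintro f ⟨hf, hfA, hft⟩
    refine ⟨⟨fun x => by simp [hf.1], fun x => ?_⟩, fun x hx => ?_, ?_⟩
    · rcases hf.2 (g.symm x) with h | h
      · left; simp [h]
      · right; simpa using hg _ _ h
    · have : g.symm x ∉ A := fun h => hx (Finset.mem_map.2 ⟨_, h, by simp⟩)
      simp [hfA _ this]
    · have : {x | g (f (g.symm x)) ≠ x} = g '' {x | f x ≠ x} := by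
        ext x
        simp only [Set.mem_ofPred_eq, Set.mem_image_equiv, ne_eq, Equiv.eq_symm_apply]
      rw [this, Set.ncard_image_of_injective _ g.injective, hft]
  · intro f _ f' _ h
    funext x
    simpa using congrFun h (g x)

lemma matchings_zero_nonempty (A : Finset (Fin d → ℤ)) : (matchings A 0).Nonempty :=
  ⟨id, ⟨fun _ => rfl, fun _ => Or.inl rfl⟩, fun _ _ => rfl, by simp⟩

lemma numMatchings_biUnion {ι : Type*} [DecidableEq ι] (J : Finset ι)
    (A : ι → Finset (Fin d → ℤ)) (hA : ∀ i ∈ J, ∀ j ∈ J, i ≠ j → Disjoint (A i) (A j)) {n t : ℕ}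
    (h : ∀ i ∈ J, n ≤ numMatchings (A i) t) :
    n ^ J.card ≤ numMatchings (J.biUnion A) (J.card * t) := by
  induction J using Finset.induction_on with
  | empty => simpa using one_le_numMatchings.2 (matchings_zero_nonempty ∅)
  | insert i J hi ih =>
    rw [Finset.biUnion_insert, Finset.card_insert_of_notMem hi, pow_succ', add_mul, one_mul,
      add_comm]
    refine le_trans ?_ (numMatchings_union ?_ _ _)
    · refine Nat.mul_le_mul (h i (Finset.mem_insert_self _ _)) (ih ?_ ?_)
      · exact fun a ha b hb => hA a (Finset.mem_insert_of_mem ha) b (Finset.mem_insert_of_mem hb)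
      · exact fun a ha => h a (Finset.mem_insert_of_mem ha)
    · rw [Finset.disjoint_biUnion_right]
      intro j hj
      exact hA i (Finset.mem_insert_self _ _) j (Finset.mem_insert_of_mem hj)
        (by rintro rfl; exact hi hj)

open Classical in
-- Deleting one edge {a, f a} frees exactly two points.
lemma matchings_remove {A : Finset (Fin d → ℤ)} {t : ℕ} (h : (matchings A (t + 2)).Nonempty) :
    (matchings A t).Nonempty := by
  obtain ⟨f, hf, hfA, hft⟩ := h
  have hne : {x | f x ≠ x}.Nonempty := by
    rw [Set.nonempty_iff_ne_empty]
    intro h0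
    rw [h0, Set.ncard_empty] at hft
    omega
  obtain ⟨a, ha⟩ := hne
  have ha' : f (f a) ≠ f a := by rw [hf.1]; exact Ne.symm ha
  refine ⟨fun x => if x = a ∨ x = f a then x else f x, ⟨fun x => ?_, fun x => ?_⟩,
    fun x hx => ?_, ?_⟩
  · dsimp only
    by_cases hx : x = a ∨ x = f a
    · simp only [hx, if_true]
    · have : ¬ (f x = a ∨ f x = f a) := by
        rintro (h | h)
        · exact hx (Or.inr (by rw [← h, hf.1]))
        · refine hx (Or.inl ?_)
          rw [← hf.1 x, h, hf.1]
      simp only [hx, this, if_false, hf.1]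
  · dsimp only
    split_ifs
    · exact Or.inl rfl
    · exact hf.2 x
  · dsimp only
    split_ifs
    · rfl
    · exact hfA x hx
  · have h1 : {x | (if x = a ∨ x = f a then x else f x) ≠ x} = {x | f x ≠ x} \ {a, f a} := by
      ext x
      simp only [Set.mem_ofPred_eq, Set.mem_sdiff, Set.mem_insert_iff, Set.mem_singleton_iff]
      by_cases hx : x = a ∨ x = f a <;> simp [hx]
    rw [h1, Set.ncard_sdiff, Set.ncard_pair (Ne.symm ha), hft]
    · rfl
    · rintro x (rfl | rfl)
      · exact ha
      · exact ha'

/-! ### Tileable sets -/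

/-- A set of grid points that has a perfect matching. -/
def Tileable (A : Set (Fin d → ℤ)) : Prop :=
  ∃ f : (Fin d → ℤ) → (Fin d → ℤ), ∀ x ∈ A, f x ∈ A ∧ f (f x) = x ∧ GridAdj x (f x)

/-- Perfect matchings of the classes of a partition combine into one. Applied below to label a
region by position and tile each piece separately. -/
lemma Tileable.of_fibers {ι : Type*} {A : Set (Fin d → ℤ)} (c : (Fin d → ℤ) → ι)
    (h : ∀ i, Tileable {x ∈ A | c x = i}) : Tileable A := by
  choose f hf using h
  refine ⟨fun x => f (c x) x, fun x hx => ?_⟩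
  obtain ⟨h1, h2, h3⟩ := hf (c x) x ⟨hx, rfl⟩
  refine ⟨h1.1, ?_, h3⟩
  dsimp only
  rw [h1.2, h2]

lemma tileable_empty : Tileable (∅ : Set (Fin d → ℤ)) := ⟨id, by simp⟩

open Classical in
lemma Tileable.union {A B : Set (Fin d → ℤ)} (hA : Tileable A) (hB : Tileable B)
    (h : Disjoint A B) : Tileable (A ∪ B) := by
  obtain ⟨f, hf⟩ := hA
  obtain ⟨g, hg⟩ := hB
  refine ⟨fun x => if x ∈ A then f x else g x, fun x hx => ?_⟩
  dsimp only
  by_cases hxA : x ∈ A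
  · obtain ⟨h1, h2, h3⟩ := hf x hxA
    rw [if_pos hxA, if_pos h1]
    exact ⟨Or.inl h1, h2, h3⟩
  · obtain ⟨h1, h2, h3⟩ := hg x (hx.resolve_left hxA)
    rw [if_neg hxA, if_neg fun h' => Set.disjoint_left.1 h h' h1]
    exact ⟨Or.inr h1, h2, h3⟩

lemma tileable_pair {a b : Fin d → ℤ} (h : GridAdj a b) : Tileable ({a, b} : Set (Fin d → ℤ)) := by
  classical
  refine ⟨fun x => if x = a then b else a, ?_⟩
  rintro x (rfl | rfl)
  · simp [h, h.ne]
  · simp [h.ne, h.symm]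

lemma Tileable.preimage {A : Set (Fin d → ℤ)} (hA : Tileable A)
    {g g' : (Fin d → ℤ) → (Fin d → ℤ)} (h1 : ∀ x, g' (g x) = x) (h2 : ∀ x, g (g' x) = x)
    (h : ∀ x y, GridAdj x y → GridAdj (g' x) (g' y)) : Tileable {x | g x ∈ A} := by
  obtain ⟨f, hf⟩ := hA
  refine ⟨fun x => g' (f (g x)), fun x hx => ?_⟩
  obtain ⟨h3, h4, h5⟩ := hf _ hx
  refine ⟨?_, ?_, ?_⟩
  · simpa [h2] using h3
  · simp [h2, h4, h1]
  · simpa [h1] using h _ _ h5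

lemma Tileable.translate {A : Set (Fin d → ℤ)} (hA : Tileable A) (v : Fin d → ℤ) :
    Tileable {x | x + v ∈ A} :=
  hA.preimage (g := fun x => x + v) (g' := fun x => x - v) (by simp) (by simp)
    (fun x y h => by simpa [sub_eq_add_neg] using h.add_right (-v))

/-- The partner of `x` in direction `k` when the `k`-th coordinates are paired as `2a, 2a + 1`. -/
def toggle (k : Fin d) (x : Fin d → ℤ) : Fin d → ℤ :=
  if Even (x k) then x + unit k else x - unit k

lemma toggle_same (k : Fin d) (x : Fin d → ℤ) :
    toggle k x k = if Even (x k) then x k + 1 else x k - 1 := by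
  unfold toggle; split_ifs <;> simp

lemma toggle_of_ne {j k : Fin d} (h : j ≠ k) (x : Fin d → ℤ) : toggle k x j = x j := by
  unfold toggle; split_ifs <;> simp [unit_of_ne h]

lemma toggle_toggle (k : Fin d) (x : Fin d → ℤ) : toggle k (toggle k x) = x := by
  funext j
  by_cases h : j = k
  · subst h
    rw [toggle_same, toggle_same]
    by_cases hx : Even (x j)
    · have : ¬ Even (x j + 1) := by rw [Int.even_add_one]; exact not_not.2 hx
      simp [hx, this]
    · have : Even (x j - 1) := by rw [Int.even_sub_one]; exact hx
      simp [hx, this]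
  · rw [toggle_of_ne h, toggle_of_ne h]

lemma gridAdj_toggle (k : Fin d) (x : Fin d → ℤ) : GridAdj x (toggle k x) := by
  unfold toggle
  split_ifs
  · exact gridAdj_add_unit x k
  · exact gridAdj_sub_unit x k

/-- An even bound never separates 2a from 2a + 1. Hence toggling preserves every region cut out by
even bounds. -/
lemma toggle_lt_iff (k j : Fin d) (x : Fin d → ℤ) {c : ℤ} (hc : Even c) :
    toggle k x j < c ↔ x j < c := by
  by_cases h : j = k
  · subst h
    rw [toggle_same]
    split_ifs with hx <;> grind
  · rw [toggle_of_ne h]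

lemma le_toggle_iff (k j : Fin d) (x : Fin d → ℤ) {c : ℤ} (hc : Even c) :
    c ≤ toggle k x j ↔ c ≤ x j := by
  rw [← not_lt, toggle_lt_iff k j x hc, not_lt]

/-- The direction may vary from point to point, as long as both ends of a pair agree on it. -/
lemma tileable_of_toggle {A : Set (Fin d → ℤ)} (κ : (Fin d → ℤ) → Fin d)
    (h : ∀ x ∈ A, toggle (κ x) x ∈ A ∧ κ (toggle (κ x) x) = κ x) : Tileable A := by
  refine ⟨fun x => toggle (κ x) x, fun x hx => ⟨(h x hx).1, ?_, gridAdj_toggle _ _⟩⟩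
  dsimp only
  rw [(h x hx).2, toggle_toggle]

lemma Tileable.even_card {A : Finset (Fin d → ℤ)} (h : Tileable (A : Set (Fin d → ℤ))) :
    Even A.card := by
  obtain ⟨f, hf⟩ := h
  have h0 : ∑ _x ∈ A, (1 : ZMod 2) = 0 :=
    Finset.sum_involution (fun x _ => f x) (fun _ _ => by decide)
      (fun x hx _ => (hf x hx).2.2.ne) (fun x hx => (hf x hx).1) (fun x hx => (hf x hx).2.1)
  rw [Finset.sum_const, nsmul_eq_mul, mul_one, ZMod.natCast_eq_zero_iff] at h0
  exact even_iff_two_dvd.2 h0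

open Classical in
lemma Tileable.matchings_card_nonempty {A : Finset (Fin d → ℤ)}
    (h : Tileable (A : Set (Fin d → ℤ))) : (matchings A A.card).Nonempty := by
  obtain ⟨f, hf⟩ := h
  refine ⟨fun x => if x ∈ A then f x else x, ⟨fun x => ?_, fun x => ?_⟩, fun x hx => ?_, ?_⟩
  · by_cases hx : x ∈ A
    · have : f x ∈ A := (hf x hx).1
      simp [hx, this, (hf x hx).2.1]
    · simp [hx]
  · by_cases hx : x ∈ A
    · simp [hx, (hf x hx).2.2]
    · simp [hx]
  · simp [hx]
  · rw [← Set.ncard_coe_finset]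
    congr 1
    ext x
    by_cases hx : x ∈ A
    · simp [hx, (hf x hx).2.2.ne]
    · simp [hx]

/-- A perfect matching can be thinned one edge at a time down to any smaller number of edges. -/
lemma Tileable.one_le_numMatchings {A : Finset (Fin d → ℤ)}
    (h : Tileable (A : Set (Fin d → ℤ))) {s : ℕ} (hs : 2 * s ≤ A.card) :
    1 ≤ numMatchings A (2 * s) := by
  rw [MonomerDimer.one_le_numMatchings]
  obtain ⟨c, hc⟩ := h.even_card
  obtain ⟨e, rfl⟩ : ∃ e, c = s + e := ⟨c - s, by omega⟩
  have h1 := h.matchings_card_nonempty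
  rw [hc] at h1
  clear hc hs
  induction e with
  | zero => convert h1 using 2; ring
  | succ e ih => exact ih (matchings_remove (by convert h1 using 2; ring))

end Grid

/-! ### Tileability of a slab with a balanced set removed from one face -/

section Slab

variable {d : ℕ}

/-- The color of a point in the chessboard coloring of the grid. -/
def sgn (x : Fin d → ℤ) : ℤ := if Even (∑ i, x i) then 1 else -1

lemma sgn_add_unit (x : Fin d → ℤ) (k : Fin d) : sgn (x + unit k) = - sgn x := by
  have : ∑ i, (x + unit k) i = ∑ i, x i + 1 := by
    simp [Finset.sum_add_distrib, unit]
  unfold sgn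
  simp only [this, Int.even_add_one]
  split_ifs <;> simp_all

lemma GridAdj.sgn_eq {x y : Fin d → ℤ} (h : GridAdj x y) : sgn y = - sgn x := by
  obtain ⟨k, rfl | rfl⟩ := h
  · exact sgn_add_unit x k
  · rw [sgn_add_unit, neg_neg]

lemma sgn_eq_or (x : Fin d → ℤ) : sgn x = 1 ∨ sgn x = -1 := by
  unfold sgn; split_ifs <;> simp

/-- The projection to the hyperplane `x k = 0`. -/
def base (k : Fin d) (x : Fin d → ℤ) : Fin d → ℤ := Function.update x k 0

@[simp] lemma base_same (k : Fin d) (x : Fin d → ℤ) : base k x k = 0 := by simp [base]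

lemma base_of_ne {j k : Fin d} (h : j ≠ k) (x : Fin d → ℤ) : base k x j = x j := by
  simp [base, h]

lemma base_add_unit (k : Fin d) (x : Fin d → ℤ) : base k (x + unit k) = base k x := by
  funext j
  by_cases h : j = k
  · subst h; simp
  · simp [base_of_ne h, unit_of_ne h]

lemma base_sub_unit (k : Fin d) (x : Fin d → ℤ) : base k (x - unit k) = base k x := by
  rw [← base_add_unit k (x - unit k), sub_add_cancel]

lemma eq_of_base_eq {k : Fin d} {x y : Fin d → ℤ} (h : base k x = base k y) (hk : x k = y k) :
    x = y := by
  funext j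
  by_cases hj : j = k
  · subst hj; exact hk
  · simpa [base_of_ne hj] using congrFun h j

/-- Each column over `Q` receives one dimer in direction `k`, across the layers `h` and `h + 1`. -/
lemma tileable_vertical (k : Fin d) (Q : Set (Fin d → ℤ)) (h : ℤ) :
    Tileable {x | base k x ∈ Q ∧ (x k = h ∨ x k = h + 1)} := by
  refine ⟨fun x => if x k = h then x + unit k else x - unit k, ?_⟩
  rintro x ⟨hQ, hx | hx⟩
  · simp [hx, base_add_unit, hQ, gridAdj_add_unit]
  · simp [hx, base_sub_unit, hQ, gridAdj_sub_unit]

lemma tileable_horizontal {k : Fin d} {a b : Fin d → ℤ} (hab : GridAdj a b) (ha : a k = 0)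
    (hb : b k = 0) (h : ℤ) : Tileable {x | (base k x = a ∨ base k x = b) ∧ x k = h} := by
  have hbase : ∀ y : Fin d → ℤ, y k = 0 → ∀ x, base k x = y ∧ x k = h ↔ x = y + h • unit k := by
    intro y hy x
    constructor
    · rintro ⟨h1, h2⟩
      refine eq_of_base_eq (k := k) ?_ (by simp [hy, h2])
      rw [h1]
      funext j
      by_cases hj : j = k
      · subst hj; simp [hy]
      · simp [base_of_ne hj, unit_of_ne hj]
    · rintro rfl
      refine ⟨?_, by simp [hy]⟩
      funext j
      by_cases hj : j = k
      · subst hj; simp [hy]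
      · simp [base_of_ne hj, unit_of_ne hj]
  have h1 := tileable_pair (hab.add_right (h • unit k))
  convert h1 using 1
  ext x
  simp only [Set.mem_ofPred_eq, Set.mem_insert_iff, Set.mem_singleton_iff, or_and_right,
    hbase a ha, hbase b hb]

/-- The face `x k = 0` of a box. -/
def face (c : Fin d → ℤ) (k : Fin d) : Set (Fin d → ℤ) :=
  {x | x k = 0 ∧ ∀ j, j ≠ k → 0 ≤ x j ∧ x j < c j}

/-- The slab of thickness `L` over a face, with the points of `P` removed from the face. -/
def slab (c : Fin d → ℤ) (k : Fin d) (P : Set (Fin d → ℤ)) (L : ℤ) : Set (Fin d → ℤ) :=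
  {x | base k x ∈ face c k ∧ 0 ≤ x k ∧ x k < L ∧ ¬ (base k x ∈ P ∧ x k = 0)}

/-- The two lowest layers serve to change the hole pattern: if they can be tiled together with the
points of `P'` in layer 2, what remains is a slab with holes `P'`, two layers higher. -/
lemma tileable_slab_step {c : Fin d → ℤ} {k : Fin d} {P P' : Set (Fin d → ℤ)} {L : ℤ}
    (hL : 2 ≤ L) (hP' : P' ⊆ face c k) (h : Tileable (slab c k P' L))
    (hs : Tileable {x | (base k x ∈ face c k ∧ (x k = 0 ∨ x k = 1) ∧
      ¬ (base k x ∈ P ∧ x k = 0)) ∨ (base k x ∈ P' ∧ x k = 2)}) :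
    Tileable (slab c k P (L + 2)) := by
  have hb : ∀ x, base k (x + (-(2 : ℤ)) • unit k) = base k x := by
    intro x
    have : x + (-(2 : ℤ)) • unit k = x - unit k - unit k := by
      rw [neg_smul, two_smul]; abel
    rw [this, base_sub_unit, base_sub_unit]
  have hk : ∀ x : Fin d → ℤ, (x + (-(2 : ℤ)) • unit k) k = x k - 2 := by
    intro x; simp [sub_eq_add_neg]
  have h2 := h.translate ((-(2 : ℤ)) • unit k)
  convert hs.union h2 ?_ using 1
  · ext x
    have := @hP' (base k x)
    simp only [slab, Set.mem_ofPred_eq, Set.mem_union, hb, hk]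
    constructor
    · rintro ⟨h3, h4, h5, h6⟩
      by_cases h7 : x k = 0 ∨ x k = 1
      · exact Or.inl (Or.inl ⟨h3, h7, h6⟩)
      · by_cases h8 : base k x ∈ P' ∧ x k = 2
        · exact Or.inl (Or.inr h8)
        · refine Or.inr ⟨h3, by omega, by omega, fun h9 => h8 ⟨h9.1, by omega⟩⟩
    · rintro ((⟨h3, h4, h5⟩ | ⟨h3, h4⟩) | ⟨h3, h4, h5, h6⟩)
      · exact ⟨h3, by omega, by omega, h5⟩
      · exact ⟨this h3, by omega, by omega, fun h => by omega⟩
      · exact ⟨h3, by omega, by omega, fun h => by omega⟩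
  · refine Set.disjoint_left.2 fun x h3 h4 => ?_
    simp only [slab, Set.mem_ofPred_eq, hb, hk] at h3 h4
    obtain ⟨h5, h6, h7, h8⟩ := h4
    rcases h3 with ⟨_, h9, _⟩ | ⟨h9, h10⟩
    · omega
    · exact h8 ⟨h9, by omega⟩

/-- Columns without a hole carry a dimer on layers 0 and 1. Columns of other holes carry one on
layers 1 and 2, which carries the hole up to layer 2. The columns of `a` and `b` are joined by a
horizontal dimer in layer 1, so these two holes disappear. -/
lemma tileable_slab_remove_pair {c : Fin d → ℤ} {k : Fin d} {P : Set (Fin d → ℤ)} {L : ℤ}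
    (hL : 2 ≤ L) (hP : P ⊆ face c k) {a b : Fin d → ℤ} (ha : a ∈ P) (hb : b ∈ P)
    (hab : GridAdj a b) (h : Tileable (slab c k (P \ {a, b}) L)) :
    Tileable (slab c k P (L + 2)) := by
  refine tileable_slab_step hL (Set.sdiff_subset.trans hP) h ?_
  have h1 := tileable_vertical k (face c k \ P) 0
  have h2 := tileable_vertical k (P \ {a, b}) 1
  have h3 := tileable_horizontal hab (hP ha).1 (hP hb).1 1
  convert (h1.union h2 ?_).union h3 ?_ using 1
  · ext x
    have h4 := @hP (base k x)
    simp only [Set.mem_ofPred_eq, Set.mem_union, Set.mem_sdiff, Set.mem_insert_iff,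
      Set.mem_singleton_iff]
    by_cases h5 : base k x = a
    · rw [h5] at h4 ⊢; grind
    · by_cases h6 : base k x = b
      · rw [h6] at h4 ⊢; grind
      · grind
  · refine Set.disjoint_left.2 fun x h5 h6 => ?_
    exact h5.1.2 h6.1.1
  · refine Set.disjoint_left.2 fun x h5 h6 => ?_
    simp only [Set.mem_ofPred_eq, Set.mem_union, Set.mem_sdiff, Set.mem_insert_iff,
      Set.mem_singleton_iff] at h5 h6
    grind

/-- The hole at `a` moves to `z`: a horizontal dimer joins `a` and `y` in layer 1, another joins `y`
and `z` in layer 0, and the column of `z` then needs a dimer on layers 1 and 2, like that of any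
other hole. Two steps are needed because a hole keeps its chessboard color. -/
lemma tileable_slab_move {c : Fin d → ℤ} {k : Fin d} {P : Set (Fin d → ℤ)} {L : ℤ}
    (hL : 2 ≤ L) (hP : P ⊆ face c k) {a y z : Fin d → ℤ} (ha : a ∈ P) (hy : y ∈ face c k)
    (hz : z ∈ face c k) (hy' : y ∉ P) (hz' : z ∉ P)
    (hay : GridAdj a y) (hyz : GridAdj y z) (h : Tileable (slab c k (insert z (P \ {a})) L)) :
    Tileable (slab c k P (L + 2)) := by
  refine tileable_slab_step hL ?_ h ?_
  · rw [Set.insert_subset_iff]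
    exact ⟨hz, Set.sdiff_subset.trans hP⟩
  have hzy := hyz.ne
  have hya : y ≠ a := hay.ne
  have hza : z ≠ a := by rintro rfl; exact hz' ha
  have haf := hP ha
  have h1 := tileable_vertical k (face c k \ (P ∪ {y, z})) 0
  have h2 := tileable_vertical k (P \ {a}) 1
  have h3 := tileable_horizontal hay (hP ha).1 hy.1 1
  have h4 := tileable_horizontal hyz hy.1 hz.1 0
  have h5 := tileable_vertical k {z} 1
  convert (((h1.union h2 ?_).union h3 ?_).union h4 ?_).union h5 ?_ using 1
  · ext x
    have h6 := @hP (base k x)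
    clear h h1 h2 h3 h4 h5 hP hay hyz
    simp only [Set.mem_ofPred_eq, Set.mem_union, Set.mem_sdiff, Set.mem_insert_iff,
      Set.mem_singleton_iff]
    by_cases h7 : base k x = a
    · rw [h7] at h6 ⊢; grind
    · by_cases h8 : base k x = y
      · rw [h8] at h6 ⊢; grind
      · by_cases h9 : base k x = z
        · rw [h9] at h6 ⊢; grind
        · grind
  all_goals
    clear h h1 h2 h3 h4 h5 hP hay hyz
    refine Set.disjoint_left.2 fun x h7 h8 => ?_
    simp only [Set.mem_ofPred_eq, Set.mem_union, Set.mem_sdiff, Set.mem_insert_iff,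
      Set.mem_singleton_iff] at h7 h8
    grind

/-- The `ℓ¹` distance in the grid. -/
def gridDist (a b : Fin d → ℤ) : ℕ := ∑ j, (a j - b j).natAbs

/-- Changing a coordinate in which `a` and `b` differ by one unit toward `b` stays in the face,
because its coordinate ranges are intervals. -/
lemma exists_step {c : Fin d → ℤ} {k : Fin d} {a b : Fin d → ℤ} (ha : a ∈ face c k)
    (hb : b ∈ face c k) (hab : a ≠ b) :
    ∃ y ∈ face c k, GridAdj a y ∧ gridDist y b + 1 = gridDist a b := by
  obtain ⟨j, hj⟩ := Function.ne_iff.1 hab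
  have hjk : j ≠ k := by rintro rfl; exact hj (ha.1.trans hb.1.symm)
  have hdist : ∀ y : Fin d → ℤ, (∀ i, i ≠ j → y i = a i) →
      (y j - b j).natAbs + 1 = (a j - b j).natAbs → gridDist y b + 1 = gridDist a b := by
    intro y h1 h2
    unfold gridDist
    rw [← Finset.add_sum_erase _ _ (Finset.mem_univ j),
      ← Finset.add_sum_erase _ (fun i => (a i - b i).natAbs) (Finset.mem_univ j),
      Finset.sum_congr rfl fun i hi => by rw [h1 i (Finset.ne_of_mem_erase hi)]]
    omega
  have ha2 := ha.2 j hjk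
  have hb2 := hb.2 j hjk
  rcases lt_or_gt_of_ne hj with h | h
  · refine ⟨a + unit j, ⟨by simp [ha.1, unit_of_ne hjk.symm], fun i hi => ?_⟩,
      gridAdj_add_unit a j, hdist _ (fun i hi => by simp [unit_of_ne hi]) ?_⟩
    · by_cases hij : i = j
      · subst hij; simp only [Pi.add_apply, unit_same]; omega
      · simpa [unit_of_ne hij] using ha.2 i hi
    · simp only [Pi.add_apply, unit_same]; omega
  · refine ⟨a - unit j, ⟨by simp [ha.1, unit_of_ne hjk.symm], fun i hi => ?_⟩,
      gridAdj_sub_unit a j, hdist _ (fun i hi => by simp [unit_of_ne hi]) ?_⟩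
    · by_cases hij : i = j
      · subst hij; simp only [Pi.sub_apply, unit_same]; omega
      · simpa [unit_of_ne hij] using ha.2 i hi
    · simp only [Pi.sub_apply, unit_same]; omega

lemma exists_opposite {P : Finset (Fin d → ℤ)} (hP : P.Nonempty) (h : ∑ x ∈ P, sgn x = 0) :
    ∃ a ∈ P, ∃ b ∈ P, sgn b = - sgn a := by
  obtain ⟨a, ha⟩ := hP
  refine ⟨a, ha, ?_⟩
  by_contra! hb
  have h1 : ∀ x ∈ P, sgn x = sgn a := by
    intro x hx
    have := hb x hx
    rcases sgn_eq_or x with h1 | h1 <;> rcases sgn_eq_or a with h2 | h2 <;> simp_all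
  rw [Finset.sum_congr rfl h1, Finset.sum_const, nsmul_eq_mul] at h
  have hc : (P.card : ℤ) ≠ 0 := by
    have := Finset.card_pos.2 ⟨a, ha⟩
    omega
  rcases sgn_eq_or a with h2 | h2 <;> rw [h2] at h <;> omega

open Classical in
-- A balanced set of holes contains two of opposite chessboard color. Two layers at a time, one is
-- moved toward the other until two holes are adjacent and can be removed together. The outer
-- induction is on the number of holes, the inner one on the distance `r` of an opposite pair.
lemma exists_tileable_slab (c : Fin d → ℤ) (k : Fin d) (n : ℕ) :
    ∀ P : Finset (Fin d → ℤ), (P : Set (Fin d → ℤ)) ⊆ face c k → ∑ x ∈ P, sgn x = 0 →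
      P.card = n → ∃ L : ℤ, 2 ≤ L ∧ Even L ∧ Tileable (slab c k P L) := by
  induction n using Nat.strong_induction_on with
  | _ n ihn =>
  have key : ∀ r : ℕ, ∀ P : Finset (Fin d → ℤ), (P : Set (Fin d → ℤ)) ⊆ face c k →
      ∑ x ∈ P, sgn x = 0 → P.card = n → (∃ a ∈ P, ∃ b ∈ P, sgn b = - sgn a ∧ gridDist a b = r) →
      ∃ L : ℤ, 2 ≤ L ∧ Even L ∧ Tileable (slab c k P L) := by
    intro r
    induction r using Nat.strong_induction_on with
    | _ r ihr =>
    rintro P hP hsum hcard ⟨a, ha, b, hb, hsgn, hr⟩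
    have remove : ∀ a ∈ P, ∀ b ∈ P, GridAdj a b →
        ∃ L : ℤ, 2 ≤ L ∧ Even L ∧ Tileable (slab c k P L) := by
      intro a ha b hb hab
      have hb' : b ∈ P.erase a := Finset.mem_erase.2 ⟨hab.ne, hb⟩
      have h1 := Finset.card_erase_add_one ha
      have h2 := Finset.card_erase_add_one hb'
      have h3 := Finset.add_sum_erase P sgn ha
      have h4 := Finset.add_sum_erase _ sgn hb'
      have h5 := hab.sgn_eq
      obtain ⟨L, hL, hL', hT⟩ := ihn ((P.erase a).erase b).card (by omega)
        ((P.erase a).erase b) (fun x hx => hP (Finset.mem_of_mem_erase (Finset.mem_of_mem_erase hx)))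
        (by linarith) rfl
      refine ⟨L + 2, by omega, hL'.add even_two, tileable_slab_remove_pair hL hP ha hb hab ?_⟩
      convert hT using 2
      ext x
      simp only [Set.mem_sdiff, Set.mem_insert_iff, Set.mem_singleton_iff, Finset.coe_erase,
        Finset.mem_coe]
      tauto
    have hab : a ≠ b := by
      rintro rfl
      rcases sgn_eq_or a with h | h <;> rw [h] at hsgn <;> norm_num at hsgn
    obtain ⟨y, hy, hay, hdy⟩ := exists_step (hP ha) (hP hb) hab
    by_cases hyP : y ∈ P
    · exact remove a ha y hyP hay
    have hyb : y ≠ b := by rintro rfl; exact hyP hb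
    obtain ⟨z, hz, hyz, hdz⟩ := exists_step hy (hP hb) hyb
    have hza : sgn z = sgn a := by rw [hyz.sgn_eq, hay.sgn_eq, neg_neg]
    -- A hole at `z` has the color of `a` and is nearer to `b`, so the same `P` is treated with a
    -- smaller distance and no layer is used. Otherwise the hole at `a` moves to `z`.
    by_cases hzP : z ∈ P
    · exact ihr (gridDist z b) (by omega) P hP hsum hcard ⟨z, hzP, b, hb, by rw [hza, hsgn], rfl⟩
    have hzP' : z ∉ P.erase a := fun h => hzP (Finset.mem_of_mem_erase h)
    have h1 := Finset.card_erase_add_one ha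
    have h3 := Finset.add_sum_erase P sgn ha
    obtain ⟨L, hL, hL', hT⟩ := ihr (gridDist z b) (by omega) (insert z (P.erase a))
      (by
        rw [Finset.coe_insert, Set.insert_subset_iff]
        exact ⟨hz, fun x hx => hP (Finset.mem_of_mem_erase hx)⟩)
      (by rw [Finset.sum_insert hzP', hza, h3, hsum])
      (by rw [Finset.card_insert_of_notMem hzP', h1, hcard])
      ⟨z, Finset.mem_insert_self _ _, b,
        Finset.mem_insert_of_mem (Finset.mem_erase.2 ⟨hab.symm, hb⟩), by rw [hza, hsgn], rfl⟩
    refine ⟨L + 2, by omega, hL'.add even_two,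
      tileable_slab_move hL hP ha hy hz hyP hzP hay hyz ?_⟩
    convert hT using 2
    rw [Finset.coe_insert, Finset.coe_erase]
  intro P hP hsum hcard
  by_cases hne : P.Nonempty
  · obtain ⟨a, ha, b, hb, hsgn⟩ := exists_opposite hne hsum
    exact key _ P hP hsum hcard ⟨a, ha, b, hb, hsgn, rfl⟩
  · rw [Finset.not_nonempty_iff_eq_empty] at hne
    refine ⟨2, le_rfl, even_two, ?_⟩
    convert tileable_vertical k (face c k) 0 using 1
    ext x
    simp only [slab, hne, Set.mem_ofPred_eq, Finset.coe_empty, Set.mem_empty_iff_false, false_and,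
      not_false_eq_true, and_true]
    refine and_congr_right fun _ => ?_
    omega

end Slab

/-! ### Reflections -/

section Reflection

variable {d : ℕ}

/-- The box with side lengths `m` as a set of grid points. -/
noncomputable def boxF (m : Fin d → ℕ) : Finset (Fin d → ℤ) :=
  Fintype.piFinset fun k => Finset.Ico 0 (m k : ℤ)

lemma mem_boxF {m : Fin d → ℕ} {x : Fin d → ℤ} : x ∈ boxF m ↔ ∀ k, 0 ≤ x k ∧ x k < m k := by
  simp [boxF, Fintype.mem_piFinset]

lemma card_boxF (m : Fin d → ℕ) : (boxF m).card = vol m := by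
  simp [boxF, vol]

/-- The isometry of the grid that acts on the `k`-th coordinate by `t ↦ a k + s k * t`. -/
def signedShift (a : Fin d → ℤ) (s : Fin d → ℤˣ) : (Fin d → ℤ) ≃ (Fin d → ℤ) where
  toFun x k := a k + s k * x k
  invFun y k := s k * (y k - a k)
  left_inv x := by
    funext k
    dsimp only
    rw [add_sub_cancel_left, ← mul_assoc, Int.units_coe_mul_self, one_mul]
  right_inv y := by
    funext k
    dsimp only
    rw [← mul_assoc, Int.units_coe_mul_self, one_mul, add_sub_cancel]

@[simp] lemma signedShift_apply (a : Fin d → ℤ) (s : Fin d → ℤˣ) (x : Fin d → ℤ) (k : Fin d) :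
    signedShift a s x k = a k + s k * x k := rfl

@[simp] lemma signedShift_symm_apply (a : Fin d → ℤ) (s : Fin d → ℤˣ) (x : Fin d → ℤ)
    (k : Fin d) : (signedShift a s).symm x k = s k * (x k - a k) := rfl

lemma gridAdj_signedShift (a : Fin d → ℤ) (s : Fin d → ℤˣ) {x y : Fin d → ℤ} (h : GridAdj x y) :
    GridAdj (signedShift a s x) (signedShift a s y) := by
  wlog hxy : ∃ k, y = x + unit k generalizing x y
  · obtain ⟨k, h1 | h1⟩ := h
    · exact absurd ⟨k, h1⟩ hxy
    · exact (this (GridAdj.symm ⟨k, Or.inr h1⟩) ⟨k, h1⟩).symm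
  obtain ⟨k, rfl⟩ := hxy
  refine ⟨k, ?_⟩
  rcases Int.units_eq_one_or (s k) with hk | hk
  · left
    funext j
    by_cases hj : j = k
    · subst hj; simp [hk]; ring
    · simp [unit_of_ne hj]
  · right
    funext j
    by_cases hj : j = k
    · subst hj; simp [hk]; ring
    · simp [unit_of_ne hj]

lemma gridAdj_signedShift_symm (a : Fin d → ℤ) (s : Fin d → ℤˣ) {x y : Fin d → ℤ}
    (h : GridAdj x y) : GridAdj ((signedShift a s).symm x) ((signedShift a s).symm y) := by
  have h1 : ∀ x, (signedShift a s).symm x = signedShift (fun k => - (s k * a k)) s x := by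
    intro x
    funext k
    simp; ring
  rw [h1, h1]
  exact gridAdj_signedShift _ _ h

lemma Tileable.signedShift {A : Set (Fin d → ℤ)} (hA : Tileable A) (a : Fin d → ℤ)
    (s : Fin d → ℤˣ) : Tileable {x | signedShift a s x ∈ A} :=
  hA.preimage (g' := (MonomerDimer.signedShift a s).symm) (by simp) (by simp)
    fun _ _ => gridAdj_signedShift_symm a s

/-- The folding of the line to the interval `[0, M)`. -/
def fold1 (M x : ℤ) : ℤ := if Even (x / M) then x % M else M - 1 - x % M

lemma fold1_mul_add {M r : ℤ} (z : ℤ) (h0 : 0 ≤ r) (h1 : r < M) :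
    fold1 M (M * z + r) = if Even z then r else M - 1 - r := by
  have h2 : (M * z + r) / M = z := by
    rw [Int.mul_add_ediv_left _ _ (by omega), Int.ediv_eq_zero_of_lt h0 h1, add_zero]
  have h3 : (M * z + r) % M = r := by
    rw [Int.mul_add_emod_self_left, Int.emod_eq_of_lt h0 h1]
  simp only [fold1, h2, h3]

lemma exists_mul_add {M : ℤ} (hM : 0 < M) (x : ℤ) : ∃ z r, 0 ≤ r ∧ r < M ∧ x = M * z + r :=
  ⟨x / M, x % M, Int.emod_nonneg _ hM.ne', Int.emod_lt_of_pos _ hM, (Int.mul_ediv_add_emod x M).symm⟩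

lemma fold1_nonneg {M : ℤ} (hM : 0 < M) (x : ℤ) : 0 ≤ fold1 M x ∧ fold1 M x < M := by
  obtain ⟨z, r, h0, h1, rfl⟩ := exists_mul_add hM x
  rw [fold1_mul_add z h0 h1]
  split_ifs <;> omega

/-- Two consecutive cells are mirror images, so the folding has period `2 * M`. -/
lemma fold1_sub_period {M : ℤ} (hM : 0 < M) (x z : ℤ) : fold1 M (x - 2 * M * z) = fold1 M x := by
  obtain ⟨y, r, h0, h1, rfl⟩ := exists_mul_add hM x
  have : M * y + r - 2 * M * z = M * (y - 2 * z) + r := by ring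
  rw [this, fold1_mul_add _ h0 h1, fold1_mul_add _ h0 h1]
  have : Even (y - 2 * z) ↔ Even y := by rw [Int.even_sub]; simp
  simp only [this]

lemma fold1_neg {M : ℤ} (hM : 0 < M) (x : ℤ) : fold1 M (-1 - x) = fold1 M x := by
  obtain ⟨y, r, h0, h1, rfl⟩ := exists_mul_add hM x
  have : -1 - (M * y + r) = M * (-1 - y) + (M - 1 - r) := by ring
  rw [this, fold1_mul_add _ (by omega) (by omega), fold1_mul_add _ h0 h1]
  have : Even (-1 - y) ↔ ¬ Even y := by rw [Int.even_sub]; simp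
  simp only [this]
  split_ifs <;> omega

/-- The mirror image of a point next to a multiple of `M`. -/
def mirror1 (M x : ℤ) : ℤ := if M ∣ x then x - 1 else x + 1

/-- Points that fold to an end of `[0, M)` lie next to a wall between two cells, and divisibility by
`M` tells on which side. For `M ≥ 2` no point touches two walls, so the mirror image is its own
inverse. -/
lemma mirror1_spec {M x : ℤ} (hM : 2 ≤ M) (h : fold1 M x = 0 ∨ fold1 M x = M - 1) :
    fold1 M (mirror1 M x) = fold1 M x ∧ mirror1 M (mirror1 M x) = x := by
  obtain ⟨z, r, h0, h1, rfl⟩ := exists_mul_add (by omega : 0 < M) x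
  have hr : r = 0 ∨ r = M - 1 := by
    rw [fold1_mul_add z h0 h1] at h
    split_ifs at h <;> omega
  rcases hr with rfl | rfl
  · have e1 : mirror1 M (M * z + 0) = M * (z - 1) + (M - 1) := by
      rw [mirror1, if_pos (by simp)]; ring
    have e2 : ¬ M ∣ M * (z - 1) + (M - 1) := by
      rw [dvd_add_right (Dvd.intro _ rfl)]
      intro h
      have := Int.le_of_dvd (by omega) h
      omega
    rw [e1, fold1_mul_add _ (by omega) (by omega), fold1_mul_add _ h0 h1, mirror1, if_neg e2]
    have : Even (z - 1) ↔ ¬ Even z := Int.even_sub_one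
    simp only [this]
    refine ⟨by split_ifs <;> omega, by ring⟩
  · have e2 : ¬ M ∣ M * z + (M - 1) := by
      rw [dvd_add_right (Dvd.intro _ rfl)]
      intro h
      have := Int.le_of_dvd (by omega) h
      omega
    have e1 : mirror1 M (M * z + (M - 1)) = M * (z + 1) + 0 := by
      rw [mirror1, if_neg e2]; ring
    rw [e1, fold1_mul_add _ (by omega) (by omega), fold1_mul_add _ h0 h1, mirror1,
      if_pos (show M ∣ M * (z + 1) + 0 by simp)]
    have h3 : Even (z + 1) ↔ ¬ Even z := Int.even_add_one
    refine ⟨?_, by ring⟩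
    by_cases hz : Even z
    · rw [if_neg (by rw [h3]; exact not_not.2 hz), if_pos hz]; omega
    · rw [if_pos (h3.2 hz), if_neg hz]; omega

/-- The folding of the grid to the box with side lengths `M`. -/
def fold (M x : Fin d → ℤ) : Fin d → ℤ := fun k => fold1 (M k) (x k)

/-- The mirror image in direction `k`. -/
def mirror (M : Fin d → ℤ) (k : Fin d) (x : Fin d → ℤ) : Fin d → ℤ :=
  if M k ∣ x k then x - unit k else x + unit k

lemma mirror_same (M : Fin d → ℤ) (k : Fin d) (x : Fin d → ℤ) :
    mirror M k x k = mirror1 (M k) (x k) := by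
  unfold mirror mirror1; split_ifs <;> simp

lemma mirror_of_ne {M : Fin d → ℤ} {j k : Fin d} (h : j ≠ k) (x : Fin d → ℤ) :
    mirror M k x j = x j := by
  unfold mirror; split_ifs <;> simp [unit_of_ne h]

lemma gridAdj_mirror (M : Fin d → ℤ) (k : Fin d) (x : Fin d → ℤ) : GridAdj x (mirror M k x) := by
  unfold mirror
  split_ifs
  · exact gridAdj_sub_unit x k
  · exact gridAdj_add_unit x k

lemma fold_mirror {M : Fin d → ℤ} {k : Fin d} {x : Fin d → ℤ} (hM : 2 ≤ M k)
    (h : fold M x k = 0 ∨ fold M x k = M k - 1) : fold M (mirror M k x) = fold M x := by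
  funext j
  by_cases hj : j = k
  · subst hj
    simp only [fold, mirror_same]
    exact (mirror1_spec hM h).1
  · simp only [fold, mirror_of_ne hj]

lemma mirror_mirror {M : Fin d → ℤ} {k : Fin d} {x : Fin d → ℤ} (hM : 2 ≤ M k)
    (h : fold M x k = 0 ∨ fold M x k = M k - 1) : mirror M k (mirror M k x) = x := by
  funext j
  by_cases hj : j = k
  · subst hj
    rw [mirror_same, mirror_same]
    exact (mirror1_spec hM h).2
  · rw [mirror_of_ne hj, mirror_of_ne hj]

/-- The points of the unfolded set `D` in or next to the region `I`, each to be matched with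
its mirror image in the direction given by `κ`. -/
def mirrorRegion (M : Fin d → ℤ) (D : Set (Fin d → ℤ)) (κ : (Fin d → ℤ) → Fin d)
    (I : Set (Fin d → ℤ)) : Set (Fin d → ℤ) :=
  {x | fold M x ∈ D ∧ (x ∈ I ∨ mirror M (κ (fold M x)) x ∈ I)}

/-- A point and its mirror image fold to the same point of `D`, so `κ` assigns them the same
direction and the reflection is an involution. -/
lemma tileable_mirrorRegion {M : Fin d → ℤ} (hM : ∀ k, 2 ≤ M k) {D : Set (Fin d → ℤ)}
    {κ : (Fin d → ℤ) → Fin d} (hD : ∀ x ∈ D, x (κ x) = 0 ∨ x (κ x) = M (κ x) - 1)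
    (I : Set (Fin d → ℤ)) : Tileable (mirrorRegion M D κ I) := by
  refine ⟨fun x => mirror M (κ (fold M x)) x, fun x hx => ?_⟩
  have h1 := hD _ hx.1
  have h2 := fold_mirror (hM _) h1
  have h3 := mirror_mirror (hM _) h1
  refine ⟨⟨?_, ?_⟩, ?_, gridAdj_mirror _ _ _⟩
  · rw [h2]; exact hx.1
  · rw [h2, h3]; exact hx.2.symm
  · dsimp only; rw [h2, h3]

open Classical in
/-- The points of the unfolded `D` in the face of the box with side lengths `2 * M`. -/
noncomputable def facePattern (M : Fin d → ℤ) (D : Set (Fin d → ℤ)) (κ : (Fin d → ℤ) → Fin d)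
    (k : Fin d) : Finset (Fin d → ℤ) :=
  {x ∈ Fintype.piFinset fun j => Finset.Ico 0 (2 * M j) |
    x k = 0 ∧ fold M x ∈ D ∧ κ (fold M x) = k}

lemma mem_facePattern {M : Fin d → ℤ} (hM : ∀ k, 2 ≤ M k) {D : Set (Fin d → ℤ)}
    {κ : (Fin d → ℤ) → Fin d} {k : Fin d} {x : Fin d → ℤ} :
    x ∈ facePattern M D κ k ↔
      x ∈ face (fun j => 2 * M j) k ∧ fold M x ∈ D ∧ κ (fold M x) = k := by
  simp only [facePattern, Finset.mem_filter, Fintype.mem_piFinset, Finset.mem_Ico, face,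
    Set.mem_ofPred_eq]
  constructor
  · rintro ⟨h1, h2, h3⟩
    exact ⟨⟨h2, fun j _ => h1 j⟩, h3⟩
  · rintro ⟨⟨h1, h2⟩, h3⟩
    refine ⟨fun j => ?_, h1, h3⟩
    by_cases hj : j = k
    · subst hj
      have := hM j
      omega
    · exact h2 j hj

/-- The reflection of coordinate `l` in the middle of `[0, 2 * M l)` preserves the pattern. It
changes that coordinate by an odd number, so it reverses the chessboard color. A second direction
`l` within the face is essential. -/
lemma sum_sgn_facePattern {M : Fin d → ℤ} (hM : ∀ k, 2 ≤ M k) (D : Set (Fin d → ℤ))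
    (κ : (Fin d → ℤ) → Fin d) {k l : Fin d} (hl : l ≠ k) :
    ∑ x ∈ facePattern M D κ k, sgn x = 0 := by
  have hM0 : 0 < M l := by have := hM l; omega
  have hfold : ∀ x, fold M (Function.update x l (2 * M l - 1 - x l)) = fold M x := by
    intro x
    funext j
    by_cases hj : j = l
    · subst hj
      simp only [fold, Function.update_self]
      rw [← fold1_sub_period hM0 _ 1, ← fold1_neg hM0 (x j)]
      congr 1; ring
    · simp only [fold, Function.update_of_ne hj]
  refine Finset.sum_involution (fun x _ => Function.update x l (2 * M l - 1 - x l)) ?_ ?_ ?_ ?_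
  · intro x _
    have h1 : ∑ i, Function.update x l (2 * M l - 1 - x l) i
        = ∑ i, x i + (2 * (M l - x l) - 1) := by
      rw [← Finset.add_sum_erase _ _ (Finset.mem_univ l),
        ← Finset.add_sum_erase _ x (Finset.mem_univ l),
        Finset.sum_congr rfl fun i hi => by
          rw [Function.update_of_ne (Finset.ne_of_mem_erase hi)], Function.update_self]
      ring
    have h2 : ¬ Even (2 * (M l - x l) - 1) := by
      rw [Int.even_sub_one]; simp
    unfold sgn
    simp only [h1, Int.even_add, h2, iff_false]
    split_ifs <;> simp
  · intro x _ _ h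
    have := congrFun h l
    rw [Function.update_self] at this
    omega
  · intro x hx
    rw [mem_facePattern hM] at hx ⊢
    rw [hfold]
    refine ⟨⟨by rw [Function.update_of_ne hl.symm]; exact hx.1.1, fun j hj => ?_⟩, hx.2⟩
    have := hx.1.2 j hj
    by_cases hjl : j = l
    · subst hjl
      rw [Function.update_self]
      dsimp only at this ⊢
      omega
    · rw [Function.update_of_ne hjl]; exact this
  · intro x _
    simp

end Reflection

/-! ### Closing up an unfolded box -/

section Unfold

variable {d : ℕ}

/-- The union of the cells of an unfolded box, `2 * q` in each direction. -/
def innerBox (M : Fin d → ℤ) (q : ℤ) : Set (Fin d → ℤ) :=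
  {x | ∀ k, 0 ≤ x k ∧ x k < 2 * M k * q}

/-- The unfolded box with a collar of thickness `L`. -/
def outerBox (M : Fin d → ℤ) (q : ℤ) (L : Fin d → ℤ) : Set (Fin d → ℤ) :=
  {x | ∀ k, - L k ≤ x k ∧ x k < 2 * M k * q + L k}

/-- Here `b` describes the strip of the collar on one side of the box and `a + s * t` the depth in
the strip, counted from the box. The strip splits into columns over the `2 * M`-periods of the face.
Up to an isometry each is the slab of `hS`, because the points already matched across the wall are
the face pattern at depth 0. Both sides of the box are covered by the two choices of `s`. -/
lemma tileable_side {M : Fin d → ℤ} (hM : ∀ k, 2 ≤ M k) {q : ℤ}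
    {D : Set (Fin d → ℤ)} {κ : (Fin d → ℤ) → Fin d} {k : Fin d} {L : ℤ}
    (hS : Tileable (slab (fun j => 2 * M j) k (facePattern M D κ k) L))
    (b : ℤ → Prop) (a : ℤ) (s : ℤˣ) (hb : ∀ t, b t ↔ 0 ≤ a + s * t ∧ a + s * t < L)
    (hout : ∀ t, b t → ¬ (0 ≤ t ∧ t < 2 * M k * q))
    (hfold : ∀ t, fold1 (M k) (a + s * t) = fold1 (M k) t)
    (hmir : ∀ t, b t → (0 ≤ mirror1 (M k) t ∧ mirror1 (M k) t < 2 * M k * q ↔ a + s * t = 0)) :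
    Tileable {x | b (x k) ∧ (∀ j, j ≠ k → 0 ≤ x j ∧ x j < 2 * M j * q) ∧
      x ∉ mirrorRegion M D κ (innerBox M q)} := by
  -- The label is the index of the period; the strip is not divided in direction `k`, hence the
  -- constant 0.
  refine Tileable.of_fibers (fun x j => if j = k then 0 else x j / (2 * M j)) fun z => ?_
  rcases Set.eq_empty_or_nonempty {x | x ∈ {x | b (x k) ∧
      (∀ j, j ≠ k → 0 ≤ x j ∧ x j < 2 * M j * q) ∧ x ∉ mirrorRegion M D κ (innerBox M q)} ∧
      (fun j => if j = k then 0 else x j / (2 * M j)) = z} with h | ⟨w, hw, hwz⟩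
  · rw [h]; exact tileable_empty
  have hM2 : ∀ j, 0 < 2 * M j := fun j => by have := hM j; omega
  have hz : ∀ j, j ≠ k → 0 ≤ z j ∧ z j < q := by
    intro j hj
    rw [← hwz]
    simp only [if_neg hj]
    have := hw.2.1 j hj
    exact ⟨Int.ediv_nonneg this.1 (hM2 j).le,
      Int.ediv_lt_of_lt_mul (hM2 j) (by rw [mul_comm]; exact this.2)⟩
  have hzk : z k = 0 := by rw [← hwz]; simp
  set A : Fin d → ℤ := fun j => if j = k then a else - (2 * M j * z j) with hA
  set S : Fin d → ℤˣ := fun j => if j = k then s else 1 with hSdef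
  have e1 : ∀ x : Fin d → ℤ, signedShift A S x k = a + s * x k := by
    intro x; simp [hA, hSdef]
  have e2 : ∀ x : Fin d → ℤ, ∀ j, j ≠ k → signedShift A S x j = x j - 2 * M j * z j := by
    intro x j hj
    simp only [signedShift_apply, hA, hSdef, if_neg hj, Units.val_one]
    ring
  have e3 : ∀ x, fold M (signedShift A S x) = fold M x := by
    intro x
    funext j
    by_cases hj : j = k
    · subst hj
      simp only [fold, e1]
      exact hfold _
    · simp only [fold, e2 x j hj]
      exact fold1_sub_period (by have := hM j; omega) _ _
  have e4 : ∀ x, base k (signedShift A S x) ∈ face (fun j => 2 * M j) k ↔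
      ∀ j, j ≠ k → x j / (2 * M j) = z j := by
    intro x
    simp only [face, Set.mem_ofPred_eq, base_same, true_and]
    refine forall₂_congr fun j hj => ?_
    rw [base_of_ne hj, e2 x j hj, Int.ediv_eq_iff_of_pos (hM2 j)]
    constructor
    · rintro ⟨h1, h2⟩
      constructor <;> linarith
    · rintro ⟨h1, h2⟩
      constructor <;> linarith
  -- A strip point is outside the inner box, so it belongs to the region only through its mirror
  -- image. A mirror in another direction keeps the `k`-th coordinate in the strip, so the direction
  -- is `k` and the depth is 0.
  have e5 : ∀ x : Fin d → ℤ, b (x k) → (∀ j, j ≠ k → 0 ≤ x j ∧ x j < 2 * M j * q) →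
      (∀ j, j ≠ k → x j / (2 * M j) = z j) →
      (x ∈ mirrorRegion M D κ (innerBox M q) ↔
        base k (signedShift A S x) ∈ (facePattern M D κ k : Set (Fin d → ℤ)) ∧
          signedShift A S x k = 0) := by
    intro x hx1 hx2 hx3
    have h1 : x ∉ innerBox M q := fun h => hout _ hx1 (h k)
    have h2 : mirror M (κ (fold M x)) x ∈ innerBox M q ↔
        κ (fold M x) = k ∧ a + s * x k = 0 := by
      constructor
      · intro h
        have h3 : κ (fold M x) = k := by
          by_contra h3
          have := h k
          rw [mirror_of_ne (Ne.symm h3)] at this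
          exact hout _ hx1 this
        refine ⟨h3, (hmir _ hx1).1 ?_⟩
        have := h k
        rwa [h3, mirror_same] at this
      · rintro ⟨h3, h4⟩ j
        rw [h3]
        by_cases hj : j = k
        · subst hj
          rw [mirror_same]
          exact (hmir _ hx1).2 h4
        · rw [mirror_of_ne hj]
          exact hx2 j hj
    have h5 : signedShift A S x k = 0 → base k (signedShift A S x) = signedShift A S x := by
      intro h
      refine eq_of_base_eq (k := k) ?_ (by simp [h])
      funext j
      by_cases hj : j = k
      · subst hj; simp
      · simp [base_of_ne hj]
    simp only [mirrorRegion, Set.mem_ofPred_eq, h1, false_or, h2]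
    rw [Finset.mem_coe, mem_facePattern hM, e1]
    constructor
    · rintro ⟨h6, h7, h8⟩
      refine ⟨⟨(e4 x).2 hx3, ?_⟩, h8⟩
      rw [h5 (by rw [e1]; exact h8), e3]
      exact ⟨h6, h7⟩
    · rintro ⟨⟨_, h6⟩, h8⟩
      rw [h5 (by rw [e1]; exact h8), e3] at h6
      exact ⟨h6.1, h6.2, h8⟩
  convert hS.signedShift A S using 1
  ext x
  simp only [slab, Set.mem_ofPred_eq, e4]
  have hlabel : ((fun j => if j = k then 0 else x j / (2 * M j)) = z) ↔
      ∀ j, j ≠ k → x j / (2 * M j) = z j := by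
    rw [funext_iff]
    refine forall_congr' fun j => ?_
    by_cases hj : j = k
    · subst hj; simp [hzk]
    · simp [hj]
  rw [hlabel]
  constructor
  · rintro ⟨⟨h1, h2, h3⟩, h4⟩
    rw [e5 x h1 h2 h4] at h3
    have := (hb _).1 h1
    rw [← e1] at this
    exact ⟨h4, this.1, this.2, h3⟩
  · rintro ⟨h4, h5, h6, h3⟩
    have h1 : b (x k) := (hb _).2 (by rw [← e1]; exact ⟨h5, h6⟩)
    have h2 : ∀ j, j ≠ k → 0 ≤ x j ∧ x j < 2 * M j * q := by
      intro j hj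
      have h7 := (Int.ediv_eq_iff_of_pos (hM2 j)).1 (h4 j hj)
      have h8 := hz j hj
      have h9 := hM2 j
      constructor <;> nlinarith
    refine ⟨⟨h1, h2, ?_⟩, h4⟩
    rw [e5 x h1 h2 h4]
    exact h3

/-- The set consists of everything outside the copies of Ω: the unfolded `D` and the collar. The
points of `D` are matched across the walls; what is left of the collar is tiled according to the
directions in which a point leaves the inner box. With two or more such directions it is a corner
region with even bounds, with one it is a side. -/
lemma tileable_outerBox {M : Fin d → ℤ} (hM : ∀ k, 2 ≤ M k) {q : ℤ} (hq : 1 ≤ q)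
    {D : Set (Fin d → ℤ)} {κ : (Fin d → ℤ) → Fin d}
    (hD : ∀ x ∈ D, x (κ x) = 0 ∨ x (κ x) = M (κ x) - 1) {L : Fin d → ℤ}
    (hL : ∀ k, 2 ≤ L k ∧ Even (L k))
    (hS : ∀ k, Tileable (slab (fun j => 2 * M j) k (facePattern M D κ k) (L k))) :
    Tileable {x | x ∈ outerBox M q L ∧ (x ∈ innerBox M q → fold M x ∈ D)} := by
  set R := mirrorRegion M D κ (innerBox M q) with hR
  have hW : ∀ k, 2 ≤ 2 * M k * q ∧ Even (2 * M k * q) := by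
    intro k
    have := hM k
    exact ⟨by nlinarith, by rw [mul_assoc]; exact even_two_mul _⟩
  have hio : innerBox M q ⊆ outerBox M q L := by
    intro x hx k
    have h1 := hx k
    have h2 := hL k
    constructor <;> linarith
  have hmir : ∀ k x, mirror M k x ∈ innerBox M q → x ∈ outerBox M q L := by
    intro k x hx j
    have h1 := hx j
    have h2 := hL j
    by_cases hj : j = k
    · subst hj
      rw [mirror_same, mirror1] at h1
      split_ifs at h1 <;> constructor <;> omega
    · rw [mirror_of_ne hj] at h1
      constructor <;> omega
  have hT : {x | x ∈ outerBox M q L ∧ (x ∈ innerBox M q → fold M x ∈ D)} =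
      R ∪ {x | x ∈ outerBox M q L ∧ x ∉ innerBox M q ∧ x ∉ R} := by
    ext x
    simp only [Set.mem_ofPred_eq, Set.mem_union]
    constructor
    · rintro ⟨h1, h2⟩
      by_cases hx : x ∈ R
      · exact Or.inl hx
      · exact Or.inr ⟨h1, fun h => hx ⟨h2 h, Or.inl h⟩, hx⟩
    · rintro (⟨h1, h2 | h2⟩ | ⟨h1, h2, h3⟩)
      · exact ⟨hio h2, fun _ => h1⟩
      · exact ⟨hmir _ _ h2, fun _ => h1⟩
      · exact ⟨h1, fun h => absurd h h2⟩
  rw [hT]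
  refine (tileable_mirrorRegion hM hD _).union ?_
    (Set.disjoint_left.2 fun x h1 h2 => h2.2.2 h1)
  refine Tileable.of_fibers (fun x => {k | ¬ (0 ≤ x k ∧ x k < 2 * M k * q)}) fun S => ?_
  by_cases hS2 : ∃ k ∈ S, ∃ l ∈ S, k ≠ l
  · obtain ⟨k, hk, l, hl, hkl⟩ := hS2
    -- Mirror images change one coordinate only, so no point outside in two directions was matched
    -- across a wall, and pairing along `k` is free of conflicts.
    refine tileable_of_toggle (fun _ => k) ?_
    rintro x ⟨⟨hx1, hx2, hx3⟩, hxS⟩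
    have hS' : {j | ¬ (0 ≤ toggle k x j ∧ toggle k x j < 2 * M j * q)} = S := by
      rw [← hxS]
      ext j
      simp only [Set.mem_ofPred_eq, le_toggle_iff k j x (Even.zero : Even (0 : ℤ)), toggle_lt_iff k j x (hW j).2]
    have hk' : ¬ (0 ≤ toggle k x k ∧ toggle k x k < 2 * M k * q) := by rw [← hS'] at hk; exact hk
    have hl' : ¬ (0 ≤ toggle k x l ∧ toggle k x l < 2 * M l * q) := by rw [← hS'] at hl; exact hl
    refine ⟨⟨⟨fun j => ?_, fun h => hk' (h k), ?_⟩, hS'⟩, rfl⟩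
    · rw [le_toggle_iff k j x (hL j).2.neg, toggle_lt_iff k j x ((hW j).2.add (hL j).2)]
      exact hx1 j
    · rintro ⟨_, h | h⟩
      · exact hk' (h k)
      · by_cases hj : k = κ (fold M (toggle k x))
        · have := h l
          rw [mirror_of_ne (by rw [← hj]; exact hkl.symm)] at this
          exact hl' this
        · have := h k
          rw [mirror_of_ne hj] at this
          exact hk' this
  · push Not at hS2
    rcases Set.eq_empty_or_nonempty S with rfl | ⟨k, hk⟩
    · convert tileable_empty using 1
      refine Set.eq_empty_of_forall_notMem ?_
      rintro x ⟨⟨_, hx2, _⟩, hxS⟩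
      refine hx2 fun k => ?_
      by_contra hk
      have : k ∈ (∅ : Set (Fin d)) := by rw [← hxS]; exact hk
      exact this
    have hM0 : 0 < M k := by have := hM k; omega
    have hMk := hM k
    have hLk := hL k
    have hWk := hW k
    have hSk : S = {k} := by
      ext l
      exact ⟨fun hl => (hS2 k hk l hl).symm, fun hl => by rw [Set.mem_singleton_iff.1 hl]; exact hk⟩
    -- Lower side, with depth -1 - t; the upper side below has depth t - 2 * M k * q.
    have h1 := tileable_side hM (q := q) (hS k) (fun t => - L k ≤ t ∧ t < 0) (-1) (-1)
      (fun t => by simp only [Units.val_neg, Units.val_one]; constructor <;> intro h <;> omega)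
      (fun t ht => by omega)
      (fun t => by rw [← fold1_neg hM0 t]; congr 1; simp; ring)
      (fun t ht => by
        simp only [Units.val_neg, Units.val_one, mirror1]
        split_ifs with hdiv
        · constructor
          · intro h; omega
          · intro h
            have : t = -1 := by omega
            rw [this, dvd_neg] at hdiv
            have := Int.le_of_dvd one_pos hdiv
            omega
        · constructor <;> intro h <;> omega)
    have h2 := tileable_side hM (q := q) (hS k)
      (fun t => 2 * M k * q ≤ t ∧ t < 2 * M k * q + L k) (- (2 * M k * q)) 1
      (fun t => by simp only [Units.val_one]; constructor <;> intro h <;> omega)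
      (fun t ht => by omega)
      (fun t => by rw [← fold1_sub_period hM0 t q]; congr 1; simp; ring)
      (fun t ht => by
        simp only [Units.val_one, mirror1]
        split_ifs with hdiv
        · constructor <;> intro h <;> omega
        · constructor
          · intro h; omega
          · intro h
            exfalso
            have : t = M k * (2 * q) := by linarith
            rw [this] at hdiv
            exact hdiv (Dvd.intro _ rfl))
    convert h1.union h2 ?_ using 1
    · ext x
      simp only [Set.mem_ofPred_eq, Set.mem_union, hSk]
      constructor
      · rintro ⟨⟨hx1, hx2, hx3⟩, hxS⟩
        have h3 : ∀ j, j ≠ k → 0 ≤ x j ∧ x j < 2 * M j * q := by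
          intro j hj
          by_contra h
          have : j ∈ ({k} : Set (Fin d)) := by rw [← hxS]; exact h
          exact hj this
        have h4 : ¬ (0 ≤ x k ∧ x k < 2 * M k * q) := by
          have : k ∈ ({k} : Set (Fin d)) := rfl
          rw [← hxS] at this
          exact this
        have h5 := hx1 k
        by_cases h6 : x k < 0
        · exact Or.inl ⟨⟨h5.1, h6⟩, h3, hx3⟩
        · exact Or.inr ⟨⟨by omega, h5.2⟩, h3, hx3⟩
      · have key : ∀ x : Fin d → ℤ, - L k ≤ x k → x k < 2 * M k * q + L k →
            ¬ (0 ≤ x k ∧ x k < 2 * M k * q) →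
            (∀ j, j ≠ k → 0 ≤ x j ∧ x j < 2 * M j * q) → x ∉ R →
            (x ∈ outerBox M q L ∧ x ∉ innerBox M q ∧ x ∉ R) ∧
              {k | ¬ (0 ≤ x k ∧ x k < 2 * M k * q)} = {k} := by
          intro x h3 h4 h5 h6 h7
          refine ⟨⟨fun j => ?_, fun h => h5 (h k), h7⟩, ?_⟩
          · by_cases hj : j = k
            · subst hj; exact ⟨h3, h4⟩
            · have := h6 j hj
              have := hL j
              constructor <;> omega
          · ext j
            simp only [Set.mem_ofPred_eq, Set.mem_singleton_iff]
            constructor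
            · intro h
              by_contra hj
              exact h (h6 j hj)
            · rintro rfl; exact h5
        rintro (⟨h3, h4, h5⟩ | ⟨h3, h4, h5⟩)
        · exact key x h3.1 (by omega) (by omega) h4 h5
        · exact key x (by omega) h3.2 (by omega) h4 h5
    · refine Set.disjoint_left.2 fun x h3 h4 => ?_
      have h5 := h3.1
      have h6 := h4.1
      omega

end Unfold

/-! ### Many perfect matchings of a large box -/

section GoodBox

variable {d : ℕ}

/-- The reflections that take the box with side lengths `M` to the cells of an unfolded box. -/
def cellMap (M z : Fin d → ℤ) : (Fin d → ℤ) ≃ (Fin d → ℤ) :=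
  signedShift (fun k => if Even (z k) then M k * z k else M k * z k + (M k - 1))
    fun k => if Even (z k) then 1 else -1

lemma cellMap_eq {M z x : Fin d → ℤ} {k : Fin d} (hx : 0 ≤ x k ∧ x k < M k) :
    cellMap M z x k / M k = z k ∧ fold1 (M k) (cellMap M z x k) = x k := by
  have h : ∃ r, 0 ≤ r ∧ r < M k ∧ cellMap M z x k = M k * z k + r ∧
      (if Even (z k) then r else M k - 1 - r) = x k := by
    by_cases hz : Even (z k)
    · exact ⟨x k, hx.1, hx.2, by simp [cellMap, hz], by simp [hz]⟩
    · refine ⟨M k - 1 - x k, by omega, by omega, ?_, by simp [hz]⟩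
      simp [cellMap, hz]; ring
  obtain ⟨r, h0, h1, h2, h3⟩ := h
  rw [h2, fold1_mul_add _ h0 h1]
  refine ⟨?_, h3⟩
  rw [Int.mul_add_ediv_left _ _ (by omega), Int.ediv_eq_zero_of_lt h0 h1, add_zero]

lemma cellMap_fold {M : Fin d → ℤ} (hM : ∀ k, 0 < M k) (x : Fin d → ℤ) :
    cellMap M (fun k => x k / M k) (fold M x) = x := by
  funext k
  obtain ⟨z, r, h0, h1, h2⟩ := exists_mul_add (hM k) (x k)
  have h3 : x k / M k = z := by
    rw [h2, Int.mul_add_ediv_left _ _ (hM k).ne', Int.ediv_eq_zero_of_lt h0 h1, add_zero]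
  simp only [cellMap, signedShift_apply, fold, h3]
  rw [h2, fold1_mul_add _ h0 h1]
  by_cases hz : Even z
  · simp [hz]
  · simp [hz]

open Classical in
/-- Every set `Ω` that contains the interior of a box can be packed efficiently into larger
boxes so that the rest has a perfect matching. -/
theorem exists_pow_le_numMatchings (hd : 2 ≤ d) {m : Fin d → ℕ} (hm : ∀ k, 2 ≤ m k)
    {Ω : Finset (Fin d → ℤ)} (hΩ : Ω ⊆ boxF m)
    (hD : ∀ x ∈ boxF m, x ∉ Ω → ∃ k, x k = 0 ∨ x k = (m k : ℤ) - 1) :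
    ∃ L : Fin d → ℕ, ∀ q : ℕ, 1 ≤ q →
      numMatchings Ω Ω.card ^ vol (fun _ : Fin d => 2 * q) ≤
        numMatchings (boxF fun k => 2 * m k * q + 2 * L k) (vol fun k => 2 * m k * q + 2 * L k) := by
  set M : Fin d → ℤ := fun k => m k with hMdef
  have hM : ∀ k, 2 ≤ M k := fun k => by have := hm k; simp only [hMdef]; omega
  have hM0 : ∀ k, 0 < M k := fun k => by have := hM k; omega
  set D : Set (Fin d → ℤ) := {x | x ∈ boxF m ∧ x ∉ Ω} with hDdef
  obtain ⟨κ, hκ⟩ : ∃ κ : (Fin d → ℤ) → Fin d, ∀ x ∈ D, x (κ x) = 0 ∨ x (κ x) = M (κ x) - 1 := by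
    have : ∀ x : Fin d → ℤ, ∃ k, x ∈ D → (x k = 0 ∨ x k = M k - 1) := by
      intro x
      by_cases hx : x ∈ D
      · obtain ⟨k, hk⟩ := hD x hx.1 hx.2
        exact ⟨k, fun _ => hk⟩
      · exact ⟨⟨0, by omega⟩, fun h => absurd h hx⟩
    choose κ hκ using this
    exact ⟨κ, hκ⟩
  have hslab : ∀ k, ∃ L : ℤ, 2 ≤ L ∧ Even L ∧
      Tileable (slab (fun j => 2 * M j) k (facePattern M D κ k) L) := by
    intro k
    obtain ⟨l, hl⟩ : ∃ l : Fin d, l ≠ k := by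
      by_cases hk : k.1 = 0
      · exact ⟨⟨1, by omega⟩, fun h => by rw [← h] at hk; simp at hk⟩
      · exact ⟨⟨0, by omega⟩, fun h => hk (by rw [← h])⟩
    exact exists_tileable_slab _ k _ _ (fun x hx => ((mem_facePattern hM).1 hx).1)
      (sum_sgn_facePattern hM D κ hl) rfl
  choose L hL2 hLe hT using hslab
  -- The thickness is fixed before `q`, so the collar becomes negligible as `q` grows.
  refine ⟨fun k => (L k).toNat, fun q hq => ?_⟩
  have hL : ∀ k, ((L k).toNat : ℤ) = L k := fun k => Int.toNat_of_nonneg (by have := hL2 k; omega)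
  set n : Fin d → ℕ := fun k => 2 * m k * q + 2 * (L k).toNat with hn
  have hnk : ∀ k, (n k : ℤ) = 2 * M k * q + 2 * L k := fun k => by
    simp only [hn, hMdef]; push_cast; rw [hL]
  have houter := tileable_outerBox hM (q := q) (by exact_mod_cast hq) hκ
    (fun k => ⟨hL2 k, hLe k⟩) hT
  set O : Finset (Fin d → ℤ) :=
    Fintype.piFinset fun k => Finset.Ico (- L k) (2 * M k * q + L k) with hO
  have hOmem : ∀ x, x ∈ O ↔ x ∈ outerBox M q L := by
    intro x
    simp [hO, outerBox, Fintype.mem_piFinset]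
  -- The complement of the cells in the outer box: the collar and the unfolded `D`.
  set T : Finset (Fin d → ℤ) := {x ∈ O | x ∈ innerBox M q → fold M x ∈ D} with hTdef
  have hTtile : Tileable (T : Set (Fin d → ℤ)) := by
    convert houter using 1
    ext x
    simp [hTdef, hOmem]
  set Z := boxF fun _ : Fin d => 2 * q with hZ
  set cell : (Fin d → ℤ) → Finset (Fin d → ℤ) := fun z => Ω.map (cellMap M z).toEmbedding
    with hcell
  have hcellmem : ∀ z x, x ∈ cell z ↔ (∀ k, x k / M k = z k) ∧ fold M x ∈ Ω := by
    intro z x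
    simp only [hcell, Finset.mem_map, Equiv.coe_toEmbedding]
    constructor
    · rintro ⟨w, hw, rfl⟩
      have hw' := mem_boxF.1 (hΩ hw)
      refine ⟨fun k => (cellMap_eq (hw' k)).1, ?_⟩
      have : fold M (cellMap M z w) = w := funext fun k => (cellMap_eq (hw' k)).2
      rwa [this]
    · rintro ⟨h1, h2⟩
      refine ⟨_, h2, ?_⟩
      have : z = fun k => x k / M k := funext fun k => (h1 k).symm
      rw [this, cellMap_fold hM0]
  have hcells : Z.biUnion cell = {x ∈ O | x ∈ innerBox M q ∧ fold M x ∈ Ω} := by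
    ext x
    simp only [Finset.mem_biUnion, Finset.mem_filter, hcellmem, hZ, mem_boxF, hOmem]
    constructor
    · rintro ⟨z, hz, h1, h2⟩
      have h3 : x ∈ innerBox M q := by
        intro k
        have h4 := (Int.ediv_eq_iff_of_pos (hM0 k)).1 (h1 k)
        have h5 := hz k
        push_cast at h5
        have h6 := hM0 k
        constructor <;> nlinarith
      refine ⟨fun k => ?_, h3, h2⟩
      have h4 := h3 k
      have h5 := hL2 k
      constructor <;> linarith
    · rintro ⟨_, h1, h2⟩
      refine ⟨fun k => x k / M k, fun k => ⟨Int.ediv_nonneg (h1 k).1 (hM0 k).le, ?_⟩,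
        fun _ => rfl, h2⟩
      refine Int.ediv_lt_of_lt_mul (hM0 k) ?_
      have := (h1 k).2
      push_cast
      linarith
  have hdisj : ∀ i ∈ Z, ∀ j ∈ Z, i ≠ j → Disjoint (cell i) (cell j) := by
    intro i _ j _ hij
    refine Finset.disjoint_left.2 fun x h1 h2 => hij ?_
    funext k
    rw [← ((hcellmem i x).1 h1).1 k, ← ((hcellmem j x).1 h2).1 k]
  have h1 : numMatchings Ω Ω.card ^ Z.card ≤ numMatchings (Z.biUnion cell) (Z.card * Ω.card) :=
    numMatchings_biUnion Z cell hdisj fun z _ =>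
      numMatchings_map (fun _ _ => gridAdj_signedShift _ _) Ω Ω.card
  have h2 : (Z.biUnion cell).card = Z.card * Ω.card := by
    rw [Finset.card_biUnion hdisj, Finset.sum_congr rfl fun z _ => Finset.card_map _,
      Finset.sum_const, smul_eq_mul]
  have hdisjT : Disjoint (Z.biUnion cell) T := by
    rw [hcells]
    refine Finset.disjoint_left.2 fun x h1 h2 => ?_
    rw [Finset.mem_filter] at h1 h2
    exact (h2.2 h1.2.1).2 h1.2.2
  have hunion : Z.biUnion cell ∪ T = O := by
    rw [hcells]
    ext x
    simp only [hTdef, Finset.mem_union, Finset.mem_filter]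
    have h3 : fold M x ∈ boxF m := mem_boxF.2 fun k => fold1_nonneg (hM0 k) (x k)
    have h4 : fold M x ∈ D ↔ fold M x ∉ Ω := ⟨fun h => h.2, fun h => ⟨h3, h⟩⟩
    rw [h4]
    tauto
  have h3 : numMatchings Ω Ω.card ^ Z.card ≤ numMatchings O O.card := by
    calc numMatchings Ω Ω.card ^ Z.card
        ≤ numMatchings (Z.biUnion cell) (Z.biUnion cell).card * 1 := by rw [h2, mul_one]; exact h1
      _ ≤ numMatchings (Z.biUnion cell) (Z.biUnion cell).card * numMatchings T T.card :=
          Nat.mul_le_mul_left _ (MonomerDimer.one_le_numMatchings.2 hTtile.matchings_card_nonempty)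
      _ ≤ numMatchings (Z.biUnion cell ∪ T) ((Z.biUnion cell).card + T.card) :=
          numMatchings_union hdisjT _ _
      _ = numMatchings O O.card := by rw [← Finset.card_union_of_disjoint hdisjT, hunion]
  have h4 : O.map (signedShift L fun _ => 1).toEmbedding = boxF n := by
    ext x
    simp only [Finset.mem_map, Equiv.coe_toEmbedding, mem_boxF, hOmem, outerBox, Set.mem_ofPred_eq]
    constructor
    · rintro ⟨y, hy, rfl⟩ k
      have h5 := hy k
      rw [hnk]
      simp only [signedShift_apply, Units.val_one, one_mul]
      constructor <;> linarith
    · intro hx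
      refine ⟨fun k => x k - L k, fun k => ?_, by funext k; simp⟩
      have h5 := hx k
      rw [hnk] at h5
      constructor <;> linarith
  have h5 : O.card = vol n := by rw [← card_boxF, ← h4, Finset.card_map]
  have h6 : Z.card = vol fun _ : Fin d => 2 * q := card_boxF _
  rw [← h6, ← h4, ← h5]
  exact h3.trans (numMatchings_map (fun _ _ => gridAdj_signedShift _ _) _ _)

end GoodBox

/-! ### Colorings and matchings -/

section Coloring

variable {d : ℕ}

lemma Box.toGrid_injective {m : Fin d → ℕ} : Function.Injective (Box.toGrid (m := m)) := by
  intro i j h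
  funext k
  have := congrFun h k
  simp only [Box.toGrid] at this
  exact Fin.ext (by exact_mod_cast this)

lemma Box.toGrid_mem {m : Fin d → ℕ} (i : Box m) : i.toGrid ∈ boxF m :=
  mem_boxF.2 fun k => ⟨by simp [Box.toGrid], by simp [Box.toGrid]⟩

lemma exists_toGrid_eq {m : Fin d → ℕ} {x : Fin d → ℤ} (hx : x ∈ boxF m) :
    ∃ i : Box m, i.toGrid = x := by
  rw [mem_boxF] at hx
  refine ⟨fun k => ⟨(x k).toNat, by have := hx k; omega⟩, ?_⟩
  funext k
  have := hx k
  simp only [Box.toGrid]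
  omega

lemma card_box (m : Fin d → ℕ) : Fintype.card (Box m) = vol m := by
  simp [Box, vol]

/-- The other end of the dimer that gives `x` the color `c`. -/
def step (c : Color d) (x : Fin d → ℤ) : Fin d → ℤ :=
  match c with
  | none => x
  | some (Sum.inl k) => x + unit k
  | some (Sum.inr k) => x - unit k

lemma unit_injective : Function.Injective (unit : Fin d → Fin d → ℤ) := by
  intro k l h
  by_contra hkl
  have := congrFun h k
  rw [unit_same, unit_of_ne hkl] at this
  omega

/-- The `2 * d + 1` colors are the distinct displacements to the point itself or to a neighbor, so a
color and a partner determine each other. -/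
lemma step_injective (x : Fin d → ℤ) : Function.Injective fun c : Color d => step c x := by
  intro a b h
  have h1 : ∀ k l : Fin d, x + unit k ≠ x - unit l := by
    intro k l h
    have := congrFun h k
    simp only [Pi.add_apply, Pi.sub_apply, unit_same, unit_apply] at this
    split_ifs at this <;> omega
  have h2 : ∀ k, x ≠ x + unit k := fun k => (gridAdj_add_unit x k).ne.symm
  have h3 : ∀ k, x ≠ x - unit k := fun k => (gridAdj_sub_unit x k).ne.symm
  rcases a with _ | k | k <;> rcases b with _ | l | l <;> simp only [step] at h
  · rfl
  · exact absurd h (h2 l)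
  · exact absurd h (h3 l)
  · exact absurd h.symm (h2 k)
  · rw [unit_injective (add_left_cancel h)]
  · exact absurd h (h1 k l)
  · exact absurd h.symm (h3 k)
  · exact absurd h.symm (h1 l k)
  · rw [unit_injective (sub_right_injective h)]

lemma step_eq_self_iff {c : Color d} {x : Fin d → ℤ} : step c x = x ↔ c = none :=
  ⟨fun h => step_injective x h, fun h => by rw [h]; rfl⟩

lemma gridAdj_iff_exists_step {x y : Fin d → ℤ} : y = x ∨ GridAdj x y ↔ ∃ c : Color d, step c x = y := by
  constructor
  · rintro (rfl | ⟨k, rfl | rfl⟩)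
    · exact ⟨none, rfl⟩
    · exact ⟨some (Sum.inl k), rfl⟩
    · exact ⟨some (Sum.inr k), by simp [step]⟩
  · rintro ⟨_ | k | k, rfl⟩
    · exact Or.inl rfl
    · exact Or.inr (gridAdj_add_unit x k)
    · exact Or.inr (gridAdj_sub_unit x k)

open Classical in
/-- The involution that exchanges the ends of the dimers that lie inside the box. -/
noncomputable def partnerMap {m : Fin d → ℕ} (ψ : Box m → Color d) (x : Fin d → ℤ) : Fin d → ℤ :=
  if h : ∃ i : Box m, i.toGrid = x ∧ step (ψ i) x ∈ boxF m then step (ψ h.choose) x else x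

open Classical in
lemma partnerMap_toGrid {m : Fin d → ℕ} (ψ : Box m → Color d) (i : Box m) :
    partnerMap ψ i.toGrid =
      if step (ψ i) i.toGrid ∈ boxF m then step (ψ i) i.toGrid else i.toGrid := by
  unfold partnerMap
  split_ifs with h h' h'
  · rw [Box.toGrid_injective h.choose_spec.1]
  · have := h.choose_spec.2
    rw [Box.toGrid_injective h.choose_spec.1] at this
    exact absurd this h'
  · exact absurd ⟨i, rfl, h'⟩ h
  · rfl

lemma partnerMap_of_notMem {m : Fin d → ℕ} (ψ : Box m → Color d) {x : Fin d → ℤ}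
    (hx : x ∉ boxF m) : partnerMap ψ x = x := by
  unfold partnerMap
  rw [dif_neg]
  rintro ⟨i, rfl, -⟩
  exact hx i.toGrid_mem

lemma step_step_of_mem_mdCovers {m : Fin d → ℕ} {ψ : Box m → Color d} (hψ : ψ ∈ mdCovers m)
    {i j : Box m} (h : j.toGrid = step (ψ i) i.toGrid) : step (ψ j) j.toGrid = i.toGrid := by
  rcases hi : ψ i with _ | k | k
  · rw [hi] at h
    rw [Box.toGrid_injective h, hi]
    rfl
  · rw [hi] at h
    rw [(hψ k i j h).1 hi, h]
    simp [step]
  · rw [hi] at h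
    have h1 : i.toGrid = j.toGrid + unit k := by rw [h]; simp [step]
    rw [(hψ k j i h1).2 hi, h1]
    rfl

lemma isMatching_partnerMap {m : Fin d → ℕ} {ψ : Box m → Color d} (hψ : ψ ∈ mdCovers m) :
    IsMatching (partnerMap ψ) := by
  refine ⟨fun x => ?_, fun x => ?_⟩ <;> by_cases hx : x ∈ boxF m
  · obtain ⟨i, rfl⟩ := exists_toGrid_eq hx
    by_cases h : step (ψ i) i.toGrid ∈ boxF m
    · obtain ⟨j, hj⟩ := exists_toGrid_eq h
      have h1 := step_step_of_mem_mdCovers hψ hj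
      rw [partnerMap_toGrid, if_pos h, ← hj, partnerMap_toGrid, h1, if_pos i.toGrid_mem]
    · rw [partnerMap_toGrid, if_neg h, partnerMap_toGrid, if_neg h]
  · rw [partnerMap_of_notMem ψ hx, partnerMap_of_notMem ψ hx]
  · obtain ⟨i, rfl⟩ := exists_toGrid_eq hx
    rw [partnerMap_toGrid]
    split_ifs
    · exact gridAdj_iff_exists_step.2 ⟨_, rfl⟩
    · exact Or.inl rfl
  · exact Or.inl (partnerMap_of_notMem ψ hx)

lemma eq_of_partnerMap_eq {m : Fin d → ℕ} {ψ ψ' : Box m → Color d}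
    (h : partnerMap ψ = partnerMap ψ') {i : Box m} (hi : step (ψ i) i.toGrid ∈ boxF m)
    (hi' : step (ψ' i) i.toGrid ∈ boxF m) : ψ i = ψ' i := by
  have h1 := congrFun h i.toGrid
  rw [partnerMap_toGrid, partnerMap_toGrid, if_pos hi, if_pos hi'] at h1
  exact step_injective _ h1

lemma noProtrusion_iff {m : Fin d → ℕ} {ψ : Box m → Color d} :
    NoProtrusion ψ ↔ ∀ i, step (ψ i) i.toGrid ∈ boxF m := by
  constructor
  · intro h i
    rcases hi : ψ i with _ | k | k
    · exact i.toGrid_mem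
    · obtain ⟨j, hj⟩ := (h i k).1 hi
      simp only [step]
      rw [← hj]
      exact j.toGrid_mem
    · obtain ⟨j, hj⟩ := (h i k).2 hi
      simp only [step]
      rw [hj, add_sub_cancel_right]
      exact j.toGrid_mem
  · intro h i k
    constructor
    · intro hi
      have := h i
      rw [hi] at this
      exact exists_toGrid_eq this
    · intro hi
      have := h i
      rw [hi] at this
      obtain ⟨j, hj⟩ := exists_toGrid_eq this
      exact ⟨j, by rw [hj]; simp [step]⟩

lemma bijOn_partnerMap (m : Fin d → ℕ) : Set.BijOn partnerMap (mdTilings m)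
    {f | IsMatching f ∧ ∀ x, x ∉ boxF m → f x = x} := by
  refine ⟨fun ψ hψ => ⟨isMatching_partnerMap hψ.1, fun x => partnerMap_of_notMem ψ⟩,
    fun ψ hψ ψ' hψ' h => funext fun i => eq_of_partnerMap_eq h (noProtrusion_iff.1 hψ.2 i)
      (noProtrusion_iff.1 hψ'.2 i), ?_⟩
  rintro f ⟨hf, hfm⟩
  have : ∀ i : Box m, ∃ c : Color d, step c i.toGrid = f i.toGrid :=
    fun i => gridAdj_iff_exists_step.1 (hf.2 _)
  choose ψ hψ using this
  have hmem : ∀ i, step (ψ i) i.toGrid ∈ boxF m := by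
    intro i
    rw [hψ]
    exact hf.apply_mem hfm i.toGrid_mem
  refine ⟨ψ, ⟨fun k i j hij => ?_, noProtrusion_iff.2 hmem⟩, ?_⟩
  · have h1 : ψ i = some (Sum.inl k) ↔ f i.toGrid = j.toGrid := by
      rw [← hψ, hij]
      exact ⟨fun h => by rw [h]; rfl, fun h => step_injective _ h⟩
    have h2 : ψ j = some (Sum.inr k) ↔ f j.toGrid = i.toGrid := by
      have : i.toGrid = step (some (Sum.inr k)) j.toGrid := by simp [step, hij]
      rw [← hψ, this]
      exact ⟨fun h => by rw [h], fun h => step_injective _ h⟩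
    unfold monomerDimerDigraph
    rw [h1, h2]
    constructor
    · intro h; rw [← h, hf.1]
    · intro h; rw [← h, hf.1]
  · funext x
    by_cases hx : x ∈ boxF m
    · obtain ⟨i, rfl⟩ := exists_toGrid_eq hx
      rw [partnerMap_toGrid, if_pos (hmem i), hψ]
    · rw [partnerMap_of_notMem ψ hx, hfm x hx]

/-- The matching exchanges lower halves `A` and upper halves `B`, and the moved points are their
disjoint union. -/
lemma ncard_moved_partnerMap {m : Fin d → ℕ} {ψ : Box m → Color d} (hψ : ψ ∈ mdTilings m) :
    {x | partnerMap ψ x ≠ x}.ncard = 2 * dimerCount ψ := by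
  have hp : ∀ i, partnerMap ψ i.toGrid = step (ψ i) i.toGrid := fun i => by
    rw [partnerMap_toGrid, if_pos (noProtrusion_iff.1 hψ.2 i)]
  set A : Set (Box m) := {i | ∃ k, ψ i = some (Sum.inl k)} with hA
  set B : Set (Box m) := {i | ∃ k, ψ i = some (Sum.inr k)} with hB
  have h1 : {x | partnerMap ψ x ≠ x} = Box.toGrid '' (A ∪ B) := by
    ext x
    simp only [Set.mem_ofPred_eq, Set.mem_image]
    constructor
    · intro hx
      have hxm : x ∈ boxF m := by
        by_contra h
        exact hx (partnerMap_of_notMem ψ h)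
      obtain ⟨i, rfl⟩ := exists_toGrid_eq hxm
      refine ⟨i, ?_, rfl⟩
      rw [hp, Ne, step_eq_self_iff] at hx
      rcases hi : ψ i with _ | k | k
      · exact absurd hi hx
      · exact Or.inl ⟨k, hi⟩
      · exact Or.inr ⟨k, hi⟩
    · rintro ⟨i, hi, rfl⟩
      rw [hp, Ne, step_eq_self_iff]
      rcases hi with ⟨k, hk⟩ | ⟨k, hk⟩ <;> simp [hk]
  have h2 : Disjoint A B := by
    refine Set.disjoint_left.2 ?_
    rintro i ⟨k, hk⟩ ⟨l, hl⟩
    rw [hk] at hl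
    simp at hl
  have h3 : (Box.toGrid '' B) = partnerMap ψ '' (Box.toGrid '' A) := by
    ext x
    constructor
    · rintro ⟨i, ⟨k, hk⟩, rfl⟩
      obtain ⟨j, hj⟩ := (hψ.2 i k).2 hk
      refine ⟨_, ⟨j, ⟨k, (hψ.1 k j i hj).2 hk⟩, rfl⟩, ?_⟩
      rw [hp, (hψ.1 k j i hj).2 hk, hj]
      rfl
    · rintro ⟨_, ⟨i, ⟨k, hk⟩, rfl⟩, rfl⟩
      obtain ⟨j, hj⟩ := (hψ.2 i k).1 hk
      refine ⟨j, ⟨k, (hψ.1 k i j hj).1 hk⟩, ?_⟩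
      rw [hp, hk, hj]
      rfl
  have hinj : Function.Injective (partnerMap ψ) := fun x y h => by
    have := congrArg (partnerMap ψ) h
    rwa [(isMatching_partnerMap hψ.1).1, (isMatching_partnerMap hψ.1).1] at this
  have h4 : B.ncard = A.ncard := by
    rw [← Set.ncard_image_of_injective B Box.toGrid_injective, h3,
      Set.ncard_image_of_injective _ hinj, Set.ncard_image_of_injective _ Box.toGrid_injective]
  rw [h1, Set.ncard_image_of_injective _ Box.toGrid_injective, Set.ncard_union_eq h2, h4,
    dimerCount, two_mul]

lemma ncard_mdTilingsWith (m : Fin d → ℕ) (s : ℕ) :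
    (mdTilingsWith m s).ncard = numMatchings (boxF m) (2 * s) := by
  have h := bijOn_partnerMap m
  have h1 : matchings (boxF m) (2 * s) = partnerMap '' mdTilingsWith m s := by
    ext f
    constructor
    · rintro ⟨h1, h2, h3⟩
      obtain ⟨ψ, hψ, rfl⟩ := h.surjOn ⟨h1, h2⟩
      rw [ncard_moved_partnerMap hψ] at h3
      exact ⟨ψ, ⟨hψ, by omega⟩, rfl⟩
    · rintro ⟨ψ, ⟨hψ, hs⟩, rfl⟩
      have h2 := h.mapsTo hψ
      exact ⟨h2.1, h2.2, by rw [ncard_moved_partnerMap hψ, hs]⟩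
  rw [numMatchings, h1, Set.InjOn.ncard_image (h.injOn.mono fun ψ hψ => hψ.1)]

/-! ### Boundary points and covers with protruding dimers -/

open Classical in
/-- The boundary points of a box. -/
noncomputable def bdry (m : Fin d → ℕ) : Finset (Box m) :=
  {i | ∃ k, (i k : ℕ) = 0 ∨ (i k : ℕ) + 1 = m k}

lemma step_mem_of_notMem_bdry {m : Fin d → ℕ} {i : Box m} (hi : i ∉ bdry m) (c : Color d) :
    step c i.toGrid ∈ boxF m := by
  simp only [bdry, Finset.mem_filter, Finset.mem_univ, true_and, not_exists, not_or] at hi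
  rw [mem_boxF]
  intro j
  have h1 := hi j
  have h2 := (i j).2
  rcases c with _ | k | k
  · simp only [step, Box.toGrid]; omega
  · simp only [step, Box.toGrid, Pi.add_apply, unit_apply]; split_ifs <;> omega
  · simp only [step, Box.toGrid, Pi.sub_apply, unit_apply]; split_ifs <;> omega

lemma card_color : Fintype.card (Color d) = 2 * d + 1 := by
  simp [Color, DimerColor, two_mul]

lemma card_dimerColor : Fintype.card (DimerColor d) = 2 * d := by
  simp [DimerColor, two_mul]

/-- Away from the boundary no dimer can protrude, so the matching formed by the inner dimers
determines the colors there. The boundary colors supply the rest. -/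
lemma ncard_mdCovers_le (m : Fin d → ℕ) :
    (mdCovers m).ncard ≤ (2 * d + 1) ^ (bdry m).card * (mdTilings m).ncard := by
  have h := bijOn_partnerMap m
  have h1 : (mdTilings m).ncard =
      {f : (Fin d → ℤ) → (Fin d → ℤ) | IsMatching f ∧ ∀ x, x ∉ boxF m → f x = x}.ncard := by
    rw [← h.image_eq, Set.InjOn.ncard_image h.injOn]
  have h2 : (2 * d + 1) ^ (bdry m).card = (Set.univ : Set (bdry m → Color d)).ncard := by
    rw [Set.ncard_univ, Nat.card_eq_fintype_card, Fintype.card_fun, card_color,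
      Fintype.card_coe]
  rw [h1, h2, ← Set.ncard_prod]
  refine Set.ncard_le_ncard_of_injOn (fun ψ => (fun i => ψ i.1, partnerMap ψ)) ?_ ?_
    (Set.finite_univ.prod (finite_matchings_all _))
  · intro ψ hψ
    exact ⟨Set.mem_univ _, isMatching_partnerMap hψ, fun x => partnerMap_of_notMem ψ⟩
  · intro ψ _ ψ' _ he
    simp only [Prod.mk.injEq] at he
    funext i
    by_cases hi : i ∈ bdry m
    · exact congrFun he.1 ⟨i, hi⟩
    · exact eq_of_partnerMap_eq he.2 (step_mem_of_notMem_bdry hi _)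
        (step_mem_of_notMem_bdry hi _)

open Classical in
/-- The covers with a most frequent coloring of the boundary give many perfect matchings of a
set that contains the interior of the box. -/
lemma exists_ncard_dimerCovers_le (hd : 1 ≤ d) (m : Fin d → ℕ) : ∃ Ω ⊆ boxF m,
    (∀ x ∈ boxF m, x ∉ Ω → ∃ k, x k = 0 ∨ x k = (m k : ℤ) - 1) ∧
    (dimerCovers m).ncard ≤ numMatchings Ω Ω.card * (2 * d + 1) ^ (bdry m).card := by
  -- `Ω β` collects the points whose dimer stays in the box. Interior points always qualify, so it
  -- depends on the boundary coloring `β` alone.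
  set Ω : (bdry m → DimerColor d) → Finset (Fin d → ℤ) := fun β =>
    {x ∈ boxF m | ∀ i : bdry m, i.1.toGrid = x → step (some (β i)) x ∈ boxF m} with hΩ
  have : Nonempty (DimerColor d) := ⟨Sum.inl ⟨0, hd⟩⟩
  obtain ⟨β₀, hβ₀⟩ := Finite.exists_max fun β => numMatchings (Ω β) (Ω β).card
  have hmd : ∀ ψ ∈ dimerCovers m, (fun i => some (ψ i)) ∈ mdCovers m := fun ψ hψ => hψ
  have hmemΩ : ∀ (ψ : Box m → DimerColor d) (i : Box m),
      i.toGrid ∈ Ω (fun i => ψ i.1) ↔ step (some (ψ i)) i.toGrid ∈ boxF m := by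
    intro ψ i
    simp only [hΩ, Finset.mem_filter, i.toGrid_mem, true_and]
    constructor
    · intro h
      by_cases hi : i ∈ bdry m
      · exact h ⟨i, hi⟩ rfl
      · exact step_mem_of_notMem_bdry hi _
    · rintro h ⟨j, hj⟩ hji
      rw [Box.toGrid_injective hji]
      exact h
  refine ⟨Ω β₀, Finset.filter_subset _ _, ?_, ?_⟩
  · intro x hx hxΩ
    obtain ⟨i, rfl⟩ := exists_toGrid_eq hx
    simp only [hΩ, Finset.mem_filter, hx, true_and, not_forall] at hxΩ
    obtain ⟨j, hj, -⟩ := hxΩ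
    have h1 := j.2
    rw [Box.toGrid_injective hj] at h1
    simp only [bdry, Finset.mem_filter, Finset.mem_univ, true_and] at h1
    obtain ⟨k, hk⟩ := h1
    refine ⟨k, ?_⟩
    simp only [Box.toGrid]
    omega
  · have hfib : ∀ β : bdry m → DimerColor d,
        {ψ | ψ ∈ dimerCovers m ∧ (fun i : bdry m => ψ i.1) = β}.ncard ≤
          numMatchings (Ω β) (Ω β).card := by
      intro β
      refine Set.ncard_le_ncard_of_injOn (fun ψ => partnerMap fun i => some (ψ i)) ?_ ?_
        (finite_matchings _ _)
      · rintro ψ ⟨hψ, rfl⟩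
        -- Without monomers every point of `Ω` is moved, so the inner dimers form a perfect matching
        -- of it.
        have hmoved : ∀ x, partnerMap (fun i => some (ψ i)) x ≠ x ↔ x ∈ Ω fun i => ψ i.1 := by
          intro x
          by_cases hx : x ∈ boxF m
          · obtain ⟨i, rfl⟩ := exists_toGrid_eq hx
            rw [hmemΩ, partnerMap_toGrid]
            split_ifs with h
            · simp only [h, iff_true, Ne, step_eq_self_iff]
              simp
            · simp [h]
          · rw [partnerMap_of_notMem _ hx]
            simp [hΩ, hx]
        refine ⟨isMatching_partnerMap (hmd ψ hψ), fun x hx => ?_, ?_⟩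
        · by_contra h
          exact hx ((hmoved x).1 h)
        · rw [← Set.ncard_coe_finset]
          congr 1
          ext x
          exact hmoved x
      · rintro ψ ⟨hψ, h1⟩ ψ' ⟨hψ', h2⟩ he
        funext i
        by_cases hi : i ∈ bdry m
        · exact congrFun (h1.trans h2.symm) ⟨i, hi⟩
        · exact Option.some_injective _ (eq_of_partnerMap_eq he (step_mem_of_notMem_bdry hi _)
            (step_mem_of_notMem_bdry hi _))
    have h1 : (dimerCovers m).ncard ≤ numMatchings (Ω β₀) (Ω β₀).card *
        (Finset.univ : Finset (bdry m → DimerColor d)).card := by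
      rw [Set.ncard_eq_toFinset_card']
      refine Finset.card_le_mul_card_image_of_maps_to (f := fun ψ (i : bdry m) => ψ i.1)
        (fun _ _ => Finset.mem_univ _) _ fun β _ => ?_
      refine le_trans (le_of_eq ?_) ((hfib β).trans (hβ₀ β))
      rw [← Set.ncard_coe_finset]
      congr 1
      ext ψ
      simp
    refine h1.trans (Nat.mul_le_mul_left _ ?_)
    rw [Finset.card_univ, Fintype.card_fun, card_dimerColor, Fintype.card_coe]
    exact Nat.pow_le_pow_left (by omega) _

end Coloring

/-! ### Division of a box into blocks -/

section Blocks

variable {d : ℕ}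

/-- The point `y` of the block number `z`. -/
def blockPoint {b n : Fin d → ℕ} (z : Box fun k => n k / b k) (y : Box b) : Box n := fun k =>
  ⟨b k * z k + y k, by
    have h1 := (z k).2
    have h2 := (y k).2
    have h3 : b k * ((z k : ℕ) + 1) ≤ b k * (n k / b k) := Nat.mul_le_mul_left _ h1
    have h4 := Nat.mul_div_le (n k) (b k)
    rw [mul_add] at h3
    omega⟩

lemma blockPoint_injective {b n : Fin d → ℕ} : Function.Injective
    fun p : (Box fun k => n k / b k) × Box b => blockPoint p.1 p.2 := by
  rintro ⟨z, y⟩ ⟨z', y'⟩ h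
  have key : ∀ k, (z k : ℕ) = z' k ∧ (y k : ℕ) = y' k := by
    intro k
    have h1 : b k * (z k : ℕ) + y k = b k * (z' k : ℕ) + y' k := congrArg Fin.val (congrFun h k)
    have hb : 0 < b k := lt_of_le_of_lt (Nat.zero_le _) (y k).2
    have h2 := congrArg (· / b k) h1
    have h3 := congrArg (· % b k) h1
    simp only [Nat.mul_add_div hb, Nat.div_eq_of_lt (y k).2, Nat.div_eq_of_lt (y' k).2,
      add_zero] at h2
    simp only [Nat.mul_add_mod, Nat.mod_eq_of_lt (y k).2, Nat.mod_eq_of_lt (y' k).2] at h3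
    exact ⟨h2, h3⟩
  refine Prod.ext (funext fun k => Fin.ext (key k).1) (funext fun k => Fin.ext (key k).2)

lemma vol_div_mul_le (b n : Fin d → ℕ) : vol (fun k => n k / b k) * vol b ≤ vol n := by
  rw [← card_box, ← card_box, ← card_box n, ← Fintype.card_prod]
  exact Fintype.card_le_of_injective _ blockPoint_injective

open Classical in
-- The blocks are disjoint and the points outside them are colored freely.
lemma card_filter_blocks_le {α : Type} [Fintype α] {b n : Fin d → ℕ}
    (T : (Box fun k => n k / b k) → Finset (Box b → α)) :
    (Finset.univ.filter fun ψ : Box n → α => ∀ z, (fun y => ψ (blockPoint z y)) ∈ T z).card ≤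
      (∏ z, (T z).card) * Fintype.card α ^ (vol n - vol (fun k => n k / b k) * vol b) := by
  set U : Set (Box n) := Set.range
    fun p : (Box fun k => n k / b k) × Box b => blockPoint p.1 p.2 with hU
  have hUc : Fintype.card {x : Box n // x ∉ U} =
      vol n - vol (fun k => n k / b k) * vol b := by
    rw [Fintype.card_subtype_compl, card_box]
    congr 1
    rw [← card_box, ← card_box b, ← Fintype.card_prod]
    exact Set.card_range_of_injective blockPoint_injective
  rw [← Fintype.card_piFinset, ← hUc, ← Fintype.card_fun, ← Finset.card_univ, ← Finset.card_product]
  refine Finset.card_le_card_of_injOn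
    (fun ψ => (fun z y => ψ (blockPoint z y), fun x => ψ x.1)) ?_ ?_
  · intro ψ hψ
    simp only [Finset.coe_filter, Finset.mem_univ, true_and, Set.mem_ofPred_eq] at hψ
    simp only [Finset.coe_product, Set.mem_prod, Finset.mem_coe, Fintype.mem_piFinset,
      Finset.mem_univ, and_true]
    exact hψ
  · intro ψ _ ψ' _ h
    simp only [Prod.mk.injEq] at h
    funext x
    by_cases hx : x ∈ U
    · obtain ⟨⟨z, y⟩, rfl⟩ := hx
      exact congrFun (congrFun h.1 z) y
    · exact congrFun h.2 ⟨x, hx⟩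

open Classical in
/-- A bound for the number of colorings of a box most of whose blocks have a coloring in `K`. -/
lemma ncard_le_of_blocks {α : Type} [Fintype α] [Nonempty α] {b n : Fin d → ℕ}
    {K : Set (Box b → α)} (hK : K.Nonempty) {X : Set (Box n → α)} {r : ℕ}
    (h : ∀ ψ ∈ X, {z : Box fun k => n k / b k | (fun y => ψ (blockPoint z y)) ∉ K}.ncard ≤ r) :
    X.ncard ≤ 2 ^ vol (fun k => n k / b k) * (K.ncard ^ vol (fun k => n k / b k) *
      Fintype.card α ^ (vol b * r)) *
      Fintype.card α ^ (vol n - vol (fun k => n k / b k) * vol b) := by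
  set Q : Fin d → ℕ := fun k => n k / b k with hQ
  set K' : Finset (Box b → α) := K.toFinset with hK'
  have hKc : K.ncard = K'.card := Set.ncard_eq_toFinset_card' K
  have hK1 : 1 ≤ K'.card := by
    rw [← hKc]
    exact (Set.ncard_pos (Set.toFinite K)).2 hK
  have hC : 1 ≤ Fintype.card α := Fintype.card_pos
  -- `S` is the set of blocks with a coloring outside `K`; these are left unrestricted. Summing over
  -- all `S` costs the factor `2 ^ vol Q`.
  set T : Finset (Box Q) → Box Q → Finset (Box b → α) :=
    fun S z => if z ∈ S then Finset.univ else K' with hT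
  set Y : Finset (Box Q) → Finset (Box n → α) := fun S =>
    Finset.univ.filter fun ψ : Box n → α => ∀ z, (fun y => ψ (blockPoint z y)) ∈ T S z with hY
  set I : Finset (Finset (Box Q)) := Finset.univ.powerset.filter fun S => S.card ≤ r with hI
  have h1 : X.toFinset ⊆ I.biUnion Y := by
    intro ψ hψ
    rw [Set.mem_toFinset] at hψ
    have h2 := h ψ hψ
    rw [Set.ncard_eq_toFinset_card'] at h2
    refine Finset.mem_biUnion.2
      ⟨_, Finset.mem_filter.2 ⟨Finset.mem_powerset.2 (Finset.subset_univ _), h2⟩, ?_⟩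
    simp only [hY, Finset.mem_filter, Finset.mem_univ, true_and, hT]
    intro z
    by_cases hz : (fun y => ψ (blockPoint z y)) ∈ K
    · simp [hz, hK']
    · simp [hz]
  have h3 : ∀ S ∈ I, (Y S).card ≤ K'.card ^ vol Q * Fintype.card α ^ (vol b * r) *
      Fintype.card α ^ (vol n - vol Q * vol b) := by
    intro S hS
    refine (card_filter_blocks_le (T S)).trans (Nat.mul_le_mul_right _ ?_)
    have h4 : ∏ z, (T S z).card = ∏ z, if z ∈ S then Fintype.card α ^ vol b else K'.card := by
      refine Finset.prod_congr rfl fun z _ => ?_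
      simp only [hT]
      split_ifs
      · rw [Finset.card_univ, Fintype.card_fun, card_box]
      · rfl
    rw [h4, Finset.prod_ite, Finset.prod_const, Finset.prod_const, ← pow_mul, mul_comm]
    refine Nat.mul_le_mul (Nat.pow_le_pow_right hK1 ?_) (Nat.pow_le_pow_right hC ?_)
    · refine (Finset.card_le_univ _).trans_eq (card_box Q)
    · refine Nat.mul_le_mul_left _ ?_
      have h5 := (Finset.mem_filter.1 hS).2
      simpa using h5
  rw [Set.ncard_eq_toFinset_card', hKc, mul_assoc]
  calc X.toFinset.card ≤ (I.biUnion Y).card := Finset.card_le_card h1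
    _ ≤ I.card * _ := Finset.card_biUnion_le_card_mul _ _ _ h3
    _ ≤ _ := Nat.mul_le_mul_right _ (by
      refine (Finset.card_le_card (Finset.filter_subset _ _)).trans ?_
      rw [Finset.card_powerset, Finset.card_univ, card_box])

lemma log_ncard_le_of_blocks {α : Type} [Fintype α] [Nonempty α] {b n : Fin d → ℕ}
    {K : Set (Box b → α)} (hK : K.Nonempty) {X : Set (Box n → α)} {r : ℕ}
    (h : ∀ ψ ∈ X, {z : Box fun k => n k / b k | (fun y => ψ (blockPoint z y)) ∉ K}.ncard ≤ r) :
    Real.log X.ncard ≤ vol (fun k => n k / b k) * (Real.log 2 + Real.log K.ncard) +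
      (vol b * r + (vol n - vol (fun k => n k / b k) * vol b)) *
        Real.log (Fintype.card α) := by
  have h1 := ncard_le_of_blocks hK h
  have hK1 : 1 ≤ K.ncard := (Set.ncard_pos (Set.toFinite K)).2 hK
  have hC : 1 ≤ Fintype.card α := Fintype.card_pos
  have hv := vol_div_mul_le b n
  set Q := vol fun k => n k / b k
  -- If `X` is empty the left side is 0 by the convention for the logarithm, and the right side is
  -- nonnegative.
  rcases Nat.eq_zero_or_pos X.ncard with h0 | h0
  · rw [h0, Nat.cast_zero, Real.log_zero]
    have hv' : (Q * vol b : ℝ) ≤ vol n := by exact_mod_cast hv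
    have := Real.log_natCast_nonneg K.ncard
    have := Real.log_natCast_nonneg (Fintype.card α)
    have := Real.log_nonneg one_le_two
    have : 0 ≤ (vol b * r + (vol n - Q * vol b) : ℝ) := by
      have : (0 : ℝ) ≤ vol b * r := by positivity
      linarith
    positivity
  · have hK0 : (K.ncard : ℝ) ≠ 0 := by positivity
    have hC0 : (Fintype.card α : ℝ) ≠ 0 := by positivity
    have h2 : (X.ncard : ℝ) ≤ 2 ^ Q * (K.ncard ^ Q * (Fintype.card α) ^ (vol b * r)) *
        (Fintype.card α) ^ (vol n - Q * vol b) := by exact_mod_cast h1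
    have h3 := Real.log_le_log (by exact_mod_cast h0) h2
    rw [Real.log_mul (by positivity) (by positivity), Real.log_mul (by positivity) (by positivity),
      Real.log_mul (by positivity) (by positivity), Real.log_pow, Real.log_pow, Real.log_pow,
      Real.log_pow, Nat.cast_sub hv] at h3
    push_cast at h3
    linarith

/-! ### Lower bounds from filling a box with blocks -/

lemma matchings_mono {A B : Finset (Fin d → ℤ)} (h : A ⊆ B) (t : ℕ) :
    matchings A t ⊆ matchings B t :=
  fun _ hf => ⟨hf.1, fun x hx => hf.2.1 x fun h' => hx (h h'), hf.2.2⟩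

lemma numMatchings_mono {A B : Finset (Fin d → ℤ)} (h : A ⊆ B) (t : ℕ) :
    numMatchings A t ≤ numMatchings B t :=
  Set.ncard_le_ncard (matchings_mono h t) (finite_matchings B t)

/-- The block number `z` in the grid. -/
noncomputable def blockF (b : Fin d → ℕ) (z : Fin d → ℤ) : Finset (Fin d → ℤ) :=
  (boxF b).map (signedShift (fun k => b k * z k) fun _ => 1).toEmbedding

lemma mem_blockF {b : Fin d → ℕ} (hb : ∀ k, 0 < b k) {z x : Fin d → ℤ} :
    x ∈ blockF b z ↔ (fun k => x k / b k) = z := by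
  have hb' : ∀ k, (0 : ℤ) < b k := fun k => by exact_mod_cast hb k
  rw [funext_iff]
  simp only [Int.ediv_eq_iff_of_pos (hb' _), blockF, Finset.mem_map, Equiv.coe_toEmbedding,
    mem_boxF]
  constructor
  · rintro ⟨y, hy, rfl⟩ k
    have := hy k
    simp only [signedShift_apply, Units.val_one, one_mul]
    constructor <;> linarith
  · intro h
    refine ⟨fun k => x k - b k * z k, fun k => ?_, by funext k; simp⟩
    have := h k
    constructor <;> linarith

lemma disjoint_blockF {b : Fin d → ℕ} (hb : ∀ k, 0 < b k) {z w : Fin d → ℤ} (h : z ≠ w) :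
    Disjoint (blockF b z) (blockF b w) :=
  Finset.disjoint_left.2 fun _ h1 h2 => h (((mem_blockF hb).1 h1).symm.trans ((mem_blockF hb).1 h2))

open Classical in
lemma pow_le_numMatchings_blocks {b : Fin d → ℕ} (hb : ∀ k, 0 < b k) (J : Finset (Fin d → ℤ))
    (t : ℕ) : numMatchings (boxF b) t ^ J.card ≤
      numMatchings (J.biUnion (blockF b)) (J.card * t) :=
  numMatchings_biUnion J _ (fun _ _ _ _ h => disjoint_blockF hb h) fun _ _ =>
    numMatchings_map (fun _ _ => gridAdj_signedShift _ _) _ _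

open Classical in
lemma card_biUnion_blockF {b : Fin d → ℕ} (hb : ∀ k, 0 < b k) (J : Finset (Fin d → ℤ)) :
    (J.biUnion (blockF b)).card = J.card * vol b := by
  rw [Finset.card_biUnion fun _ _ _ _ h => disjoint_blockF hb h,
    Finset.sum_congr rfl fun z _ => show (blockF b z).card = vol b by
      rw [blockF, Finset.card_map, card_boxF], Finset.sum_const, smul_eq_mul]

open Classical in
lemma biUnion_blockF_subset {b n q : Fin d → ℕ} (hb : ∀ k, 0 < b k) (hq : ∀ k, q k * b k ≤ n k)
    {J : Finset (Fin d → ℤ)} (hJ : J ⊆ boxF q) : J.biUnion (blockF b) ⊆ boxF n := by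
  intro x hx
  obtain ⟨z, hz, hx⟩ := Finset.mem_biUnion.1 hx
  rw [mem_blockF hb] at hx
  rw [mem_boxF]
  intro k
  have hb' : (0 : ℤ) < b k := by exact_mod_cast hb k
  have h1 := (Int.ediv_eq_iff_of_pos hb').1 (congrFun hx k)
  have h2 := mem_boxF.1 (hJ hz) k
  have h3 : (q k * b k : ℤ) ≤ n k := by exact_mod_cast hq k
  constructor <;> nlinarith

/-- Doubling the sides makes them even, as required for blocks, without changing the density of
dimers. -/
lemma pow_le_numMatchings_double {b : Fin d → ℕ} (hb : ∀ k, 0 < b k) (t : ℕ) :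
    numMatchings (boxF b) t ^ 2 ^ d ≤ numMatchings (boxF fun k => 2 * b k) (2 ^ d * t) := by
  classical
  have h1 := pow_le_numMatchings_blocks hb (boxF fun _ => 2) t
  have h2 : (boxF fun _ : Fin d => 2).card = 2 ^ d := by rw [card_boxF]; simp [vol]
  rw [h2] at h1
  exact h1.trans (numMatchings_mono
    (biUnion_blockF_subset hb (q := fun _ => 2) (fun k => le_rfl) (Finset.Subset.refl _)) _)

lemma toggle_ediv (k j : Fin d) (x : Fin d → ℤ) {c : ℤ} (hc : 0 < c) (hc' : Even c) :
    toggle k x j / c = x j / c := by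
  rw [Int.ediv_eq_iff_of_pos hc]
  have h := (Int.ediv_eq_iff_of_pos (x := x j) (y := x j / c) hc).1 rfl
  refine ⟨?_, ?_⟩
  · rw [le_toggle_iff k j x (hc'.mul_left _)]; exact h.1
  · rw [toggle_lt_iff k j x ((hc'.mul_left _).add hc')]; exact h.2

open Classical in
/-- A box is filled with `i` blocks that have matchings with `t` dimers each, and enough of the
other dimers of an almost perfect matching of the rest. -/
lemma pow_le_numMatchings_box (hd : 1 ≤ d) {b n : Fin d → ℕ} (hb : ∀ k, 0 < b k)
    (hb' : ∀ k, Even (b k)) {i s t : ℕ} (hi : i ≤ vol fun k => n k / b k) (hit : i * t ≤ s)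
    (his : 2 * s + i * vol b ≤ vol n + 2 * (i * t)) :
    numMatchings (boxF b) (2 * t) ^ i ≤ numMatchings (boxF n) (2 * s) := by
  rw [← card_boxF] at hi
  obtain ⟨J, hJ, rfl⟩ := Finset.exists_subset_card_eq hi
  set U := J.biUnion (blockF b) with hU
  have hUn : U ⊆ boxF n := biUnion_blockF_subset hb (fun k => Nat.div_mul_le_self _ _) hJ
  have hUmem : ∀ x, x ∈ U ↔ (fun k => x k / b k) ∈ J := by
    intro x
    simp only [hU, Finset.mem_biUnion, mem_blockF hb]
    constructor
    · rintro ⟨z, hz, h⟩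
      rw [h]; exact hz
    · intro h
      exact ⟨_, h, rfl⟩
  -- The largest even numbers not above the sides. Every point of the box with some coordinate below
  -- `e` can be toggled in such a direction, so outside the blocks at most the point `e` is lost.
  set e : Fin d → ℤ := fun k => 2 * (n k / 2 : ℕ) with he
  have hee : ∀ k, Even (e k) := fun k => even_two_mul _
  have hen : ∀ k, e k ≤ n k ∧ (n k : ℤ) ≤ e k + 1 := fun k => by simp only [he]; omega
  set R : Finset (Fin d → ℤ) := {x ∈ boxF n | x ∉ U ∧ ∃ k, x k < e k} with hR
  have hRtile : Tileable (R : Set (Fin d → ℤ)) := by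
    have : Nonempty (Fin d) := ⟨⟨0, hd⟩⟩
    -- The choice depends only on the predicate `x k < e k`, which toggling preserves, so both ends
    -- of a pair choose the same direction.
    set κ : (Fin d → ℤ) → Fin d := fun x => Classical.epsilon fun k => x k < e k with hκ
    refine tileable_of_toggle κ fun x hx => ?_
    simp only [hR, Finset.coe_filter, Set.mem_ofPred_eq] at hx ⊢
    obtain ⟨hxn, hxU, hxe⟩ := hx
    have h1 : x (κ x) < e (κ x) := Classical.epsilon_spec hxe
    have h2 : ∀ j, toggle (κ x) x j < e j ↔ x j < e j := fun j => toggle_lt_iff _ j x (hee j)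
    refine ⟨⟨mem_boxF.2 fun j => ?_, ?_, κ x, (h2 _).2 h1⟩, ?_⟩
    · have h3 := mem_boxF.1 hxn j
      refine ⟨(le_toggle_iff _ j x Even.zero).2 h3.1, ?_⟩
      by_cases hj : j = κ x
      · have := (h2 j).2 (by rw [hj]; exact h1)
        have := hen j
        omega
      · rw [toggle_of_ne hj]; exact h3.2
    · rw [hUmem] at hxU ⊢
      have : (fun k => toggle (κ x) x k / (b k : ℤ)) = fun k => x k / b k := funext fun k =>
        toggle_ediv _ k x (by exact_mod_cast hb k) (by exact_mod_cast hb' k)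
      rwa [this]
    · simp only [hκ] at h2 ⊢
      simp only [h2]
  have hdis : Disjoint U R := Finset.disjoint_left.2 fun x h1 h2 => (Finset.mem_filter.1 h2).2.1 h1
  have hURn : U ∪ R ⊆ boxF n := Finset.union_subset hUn (Finset.filter_subset _ _)
  have hUc : U.card = J.card * vol b := card_biUnion_blockF hb J
  have hcard : vol n ≤ U.card + R.card + 1 := by
    rw [← Finset.card_union_of_disjoint hdis, ← card_boxF, ← Finset.card_sdiff_add_card_eq_card hURn]
    have : (boxF n \ (U ∪ R)).card ≤ 1 := by
      refine Finset.card_le_one.2 fun x hx y hy => ?_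
      have key : ∀ w ∈ boxF n \ (U ∪ R), ∀ k, w k = e k := by
        intro w hw k
        simp only [hR, Finset.mem_sdiff, Finset.mem_union, Finset.mem_filter, not_or, not_and,
          not_exists, not_lt] at hw
        have h1 := hw.2.2 hw.1 hw.2.1 k
        have h2 := mem_boxF.1 hw.1 k
        have h3 := hen k
        omega
      funext k
      rw [key x hx k, key y hy k]
    omega
  obtain ⟨c, hc⟩ := hRtile.even_card
  calc numMatchings (boxF b) (2 * t) ^ J.card
      ≤ numMatchings U (J.card * (2 * t)) * 1 := by
        rw [mul_one]; exact pow_le_numMatchings_blocks hb J _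
    _ ≤ numMatchings U (J.card * (2 * t)) * numMatchings R (2 * (s - J.card * t)) :=
        -- The counts give `2 * (s - J.card * t) ≤ R.card + 1`; the lost point does no harm because
        -- `R.card` is even.
        Nat.mul_le_mul_left _ (hRtile.one_le_numMatchings (by omega))
    _ ≤ numMatchings (U ∪ R) (J.card * (2 * t) + 2 * (s - J.card * t)) := numMatchings_union hdis _ _
    _ = numMatchings (U ∪ R) (2 * s) := by
        congr 1
        rw [mul_left_comm]
        omega
    _ ≤ numMatchings (boxF n) (2 * s) := numMatchings_mono hURn _

end Blocks

/-! ### Dimer covers, periodic covers and tilings -/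

section Covers

variable {d : ℕ}

lemma ncard_ne_none {m : Fin d → ℕ} {ψ : Box m → Color d} (hψ : ψ ∈ mdTilings m) :
    {i | ψ i ≠ none}.ncard = 2 * dimerCount ψ := by
  rw [← ncard_moved_partnerMap hψ, ← Set.ncard_image_of_injective _ Box.toGrid_injective]
  congr 1
  ext x
  constructor
  · rintro ⟨i, hi, rfl⟩
    rw [Set.mem_ofPred_eq, partnerMap_toGrid, if_pos (noProtrusion_iff.1 hψ.2 i), Ne,
      step_eq_self_iff]
    exact hi
  · intro hx
    by_cases hxm : x ∈ boxF m
    · obtain ⟨i, rfl⟩ := exists_toGrid_eq hxm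
      rw [Set.mem_ofPred_eq, partnerMap_toGrid, if_pos (noProtrusion_iff.1 hψ.2 i), Ne,
        step_eq_self_iff] at hx
      exact ⟨i, hx, rfl⟩
    · exact absurd (partnerMap_of_notMem ψ hxm) hx

lemma ncard_eq_none {m : Fin d → ℕ} {ψ : Box m → Color d} (hψ : ψ ∈ mdTilings m) :
    {i | ψ i = none}.ncard + 2 * dimerCount ψ = vol m := by
  rw [← ncard_ne_none hψ, ← card_box, ← Nat.card_eq_fintype_card,
    ← Set.ncard_add_ncard_compl {i | ψ i = none}]
  rfl

lemma two_mul_dimerCount_le {m : Fin d → ℕ} {ψ : Box m → Color d} (hψ : ψ ∈ mdTilings m) :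
    2 * dimerCount ψ ≤ vol m := by
  have := ncard_eq_none hψ
  omega

lemma mdTilingsWith_subset (m : Fin d → ℕ) (s : ℕ) : mdTilingsWith m s ⊆ mdCovers m :=
  fun _ h => h.1.1

open Classical in
-- At most `vol m + 1` dimer counts are possible; this polynomial factor does not affect entropy.
lemma ncard_mdTilings_le {m : Fin d → ℕ} {n : ℕ}
    (h : ∀ s, 2 * s ≤ vol m → (mdTilingsWith m s).ncard ≤ n) :
    (mdTilings m).ncard ≤ (vol m + 1) * n := by
  have h1 : (mdTilings m).toFinset ⊆ ((Finset.range (vol m + 1)).filter fun s => 2 * s ≤ vol m).biUnion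
      fun s => (mdTilingsWith m s).toFinset := by
    intro ψ hψ
    rw [Set.mem_toFinset] at hψ
    have h2 := two_mul_dimerCount_le hψ
    simp only [Finset.mem_biUnion, Finset.mem_filter, Finset.mem_range, Set.mem_toFinset]
    exact ⟨dimerCount ψ, ⟨by omega, h2⟩, hψ, rfl⟩
  rw [Set.ncard_eq_toFinset_card']
  refine (Finset.card_le_card h1).trans
    ((Finset.card_biUnion_le_card_mul _ _ n fun s hs => ?_).trans (Nat.mul_le_mul_right _ ?_))
  · rw [← Set.ncard_eq_toFinset_card']
    exact h s (Finset.mem_filter.1 hs).2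
  · refine (Finset.card_filter_le _ _).trans ?_
    simp

lemma mdCovers_nonempty (m : Fin d → ℕ) : (mdCovers m).Nonempty :=
  ⟨fun _ => none, fun k i j _ => by simp [monomerDimerDigraph]⟩

/-- Dimers in a single direction, with lower halves at even coordinates, cover any box when they may
protrude. -/
lemma dimerCovers_nonempty (hd : 1 ≤ d) (m : Fin d → ℕ) : (dimerCovers m).Nonempty := by
  set k₀ : Fin d := ⟨0, hd⟩
  refine ⟨fun i => if Even (i.toGrid k₀) then Sum.inl k₀ else Sum.inr k₀, fun k i j hij => ?_⟩
  unfold dimerDigraph monomerDimerDigraph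
  by_cases hk : k = k₀
  · have h1 : Even (j.toGrid k₀) ↔ ¬ Even (i.toGrid k₀) := by
      rw [hij, hk, Pi.add_apply, unit_same, Int.even_add_one]
    rw [hk]
    by_cases h2 : Even (i.toGrid k₀)
    · simp [h1, h2]
    · simp [h1, h2]
  · have hk' := Ne.symm hk
    dsimp only
    constructor <;> intro h <;> split_ifs at h <;> simp [hk'] at h

lemma dimerTilings_image {m : Fin d → ℕ} (hm : Even (vol m)) :
    (fun (ψ : Box m → DimerColor d) i => some (ψ i)) '' dimerTilings m =
      mdTilingsWith m (vol m / 2) := by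
  ext ψ
  constructor
  · rintro ⟨φ, ⟨h1, h2⟩, rfl⟩
    have h3 : (fun i => some (φ i)) ∈ mdTilings m := ⟨h1, h2⟩
    refine ⟨h3, ?_⟩
    have := ncard_eq_none h3
    have h4 : {i : Box m | some (φ i) = none} = ∅ := by simp
    rw [h4, Set.ncard_empty] at this
    dsimp only
    omega
  · rintro ⟨h1, h2⟩
    have h3 := ncard_eq_none h1
    rw [h2, Nat.two_mul_div_two_of_even hm] at h3
    have h4 : {i | ψ i = none} = ∅ := by
      rw [← Set.ncard_eq_zero (Set.toFinite _)]
      omega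
    have h5 : ∀ i, ∃ c, ψ i = some c := by
      intro i
      rw [← Option.ne_none_iff_exists']
      intro h
      have : i ∈ {i | ψ i = none} := h
      rw [h4] at this
      exact this
    choose φ hφ using h5
    have h6 : (fun i => some (φ i)) = ψ := funext fun i => (hφ i).symm
    exact ⟨φ, ⟨by rw [← h6] at h1; exact h1.1, by rw [h6]; exact h1.2⟩, h6⟩

lemma ncard_dimerTilings {m : Fin d → ℕ} (hm : Even (vol m)) :
    (dimerTilings m).ncard = (mdTilingsWith m (vol m / 2)).ncard := by
  rw [← dimerTilings_image hm, Set.ncard_image_of_injective]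
  intro ψ ψ' h
  funext i
  exact Option.some_injective _ (congrFun h i)

/-! ### Periodic covers between tilings and covers -/

lemma dimerPeriodicCovers_subset (m : Fin d → ℕ) : dimerPeriodicCovers m ⊆ dimerCovers m := by
  rintro ψ ⟨φ, hφ, -, h⟩ k i j hij
  rw [← h i, ← h j, hij]
  exact hφ k i.toGrid

/-- Translates of a tiling fit together, since no dimer crosses the boundary of a copy. -/
lemma dimerTilings_subset_periodic {m : Fin d → ℕ} (hm : ∀ k, 0 < m k) :
    dimerTilings m ⊆ dimerPeriodicCovers m := by
  rintro ψ ⟨hψ, hψ'⟩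
  have hm' : ∀ k, (0 : ℤ) < m k := fun k => by exact_mod_cast hm k
  set red : (Fin d → ℤ) → Box m := fun x k =>
    ⟨(x k % m k).toNat, by
      have h1 := Int.emod_nonneg (x k) (hm' k).ne'
      have h2 := Int.emod_lt_of_pos (x k) (hm' k)
      omega⟩ with hred
  have hredk : ∀ x k, (red x).toGrid k = x k % m k := by
    intro x k
    have h1 := Int.emod_nonneg (x k) (hm' k).ne'
    simp only [Box.toGrid, hred]
    omega
  refine ⟨fun x => ψ (red x), fun k x => ?_, fun k x => ?_, fun i => ?_⟩
  · have hne : ∀ j, j ≠ k → (red (x + unit k)).toGrid j = (red x).toGrid j := by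
      intro j hj
      rw [hredk, hredk]
      simp [unit_of_ne hj]
    have hmem1 := mem_boxF.1 (red x).toGrid_mem k
    rcases lt_or_ge (x k % m k + 1) (m k) with h | h
    · refine hψ k _ _ ?_
      funext j
      by_cases hj : j = k
      · subst hj
        rw [Pi.add_apply, hredk, hredk, Pi.add_apply, unit_same, ← Int.emod_add_emod,
          Int.emod_eq_of_lt (by have := Int.emod_nonneg (x j) (hm' j).ne'; omega) h]
      · rw [hne j hj, Pi.add_apply, unit_of_ne hj, add_zero]
    · have h1 := Int.emod_lt_of_pos (x k) (hm' k)
      have h2 : (red x).toGrid k = m k - 1 := by rw [hredk]; omega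
      have h3 : (red (x + unit k)).toGrid k = 0 := by
        rw [hredk, Pi.add_apply, unit_same, ← Int.emod_add_emod]
        have : x k % m k + 1 = m k := by omega
        rw [this, Int.emod_self]
      -- At the seam between two copies either color would mean a protruding dimer, so both sides of
      -- the equivalence are false.
      unfold dimerDigraph monomerDimerDigraph
      constructor
      · intro h4
        obtain ⟨j, hj⟩ := (hψ' (red x) k).1 h4
        have h5 := mem_boxF.1 j.toGrid_mem k
        rw [hj, Pi.add_apply, unit_same, h2] at h5
        omega
      · intro h4
        obtain ⟨j, hj⟩ := (hψ' (red (x + unit k)) k).2 h4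
        have h5 := mem_boxF.1 j.toGrid_mem k
        have h6 := congrFun hj k
        rw [Pi.add_apply, unit_same, h3] at h6
        omega
  · dsimp only
    congr 1
    refine Box.toGrid_injective (funext fun j => ?_)
    rw [hredk, hredk]
    by_cases hj : j = k
    · subst hj; simp
    · simp [unit_of_ne hj]
  · dsimp only
    congr 1
    refine Box.toGrid_injective (funext fun j => ?_)
    rw [hredk]
    have := mem_boxF.1 i.toGrid_mem j
    exact Int.emod_eq_of_lt this.1 this.2

/-- On a line the two colors must alternate, so the first one determines the cover. -/
lemma ncard_dimerCovers_one_le (m : Fin 1 → ℕ) : (dimerCovers m).ncard ≤ 2 := by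
  rcases Nat.eq_zero_or_pos (m 0) with h0 | h0
  · have : IsEmpty (Fin (m 0)) := by rw [h0]; infer_instance
    have : IsEmpty (Box m) := ⟨fun i => this.false (i 0)⟩
    exact (Set.ncard_le_one_of_subsingleton _).trans one_le_two
  · set pt : ∀ j : ℕ, j < m 0 → Box m := fun j hj k => ⟨j, by rwa [Subsingleton.elim k 0]⟩
    have hcard : (Set.univ : Set (DimerColor 1)).ncard = 2 := by
      rw [Set.ncard_univ, Nat.card_eq_fintype_card, card_dimerColor]
    rw [← hcard]
    refine Set.ncard_le_ncard_of_injOn (fun ψ => ψ (pt 0 h0)) (fun _ _ => Set.mem_univ _) ?_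
    intro ψ hψ ψ' hψ' h
    have key : ∀ j (hj : j < m 0), ψ (pt j hj) = ψ' (pt j hj) := by
      intro j
      induction j with
      | zero => exact fun _ => h
      | succ j ih =>
        intro hj
        have h1 := ih (by omega)
        have h2 : (pt (j + 1) hj).toGrid = (pt j (by omega)).toGrid + unit 0 := by
          funext k
          rw [Subsingleton.elim k 0]
          simp [Box.toGrid, pt]
        have h3 := hψ 0 _ _ h2
        have h4 := hψ' 0 _ _ h2
        unfold dimerDigraph monomerDimerDigraph at h3 h4
        rw [h1] at h3
        have h5 := h3.symm.trans h4
        rcases ha : ψ (pt (j + 1) hj) with a | a <;> rcases hb : ψ' (pt (j + 1) hj) with b | b <;>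
          rw [ha, hb] at h5 <;> simp [Subsingleton.elim a 0, Subsingleton.elim b 0] at h5 ⊢
    funext i
    have : i = pt (i 0) (i 0).2 := by
      funext k
      obtain rfl := Subsingleton.elim k 0
      rfl
    rw [this]
    exact key _ (i 0).2

/-- Blocks are disjoint, so choosing in each bad block a point of `B` is injective. -/
lemma ncard_bad_blocks_le {α : Type} {b n : Fin d → ℕ} {K : Set (Box b → α)} {ψ : Box n → α}
    {B : Set (Box n)}
    (h : ∀ z : Box fun k => n k / b k, (fun y => ψ (blockPoint z y)) ∉ K →
      ∃ y, blockPoint z y ∈ B) :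
    {z : Box fun k => n k / b k | (fun y => ψ (blockPoint z y)) ∉ K}.ncard ≤ B.ncard := by
  rcases Set.eq_empty_or_nonempty
    {z : Box fun k => n k / b k | (fun y => ψ (blockPoint z y)) ∉ K} with h0 | ⟨z₀, hz₀⟩
  · rw [h0, Set.ncard_empty]; exact Nat.zero_le _
  obtain ⟨y₀, -⟩ := h z₀ hz₀
  have : ∀ z : Box fun k => n k / b k, ∃ y, (fun y => ψ (blockPoint z y)) ∉ K →
      blockPoint z y ∈ B := by
    intro z
    by_cases hz : (fun y => ψ (blockPoint z y)) ∉ K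
    · obtain ⟨y, hy⟩ := h z hz
      exact ⟨y, fun _ => hy⟩
    · exact ⟨y₀, fun h => absurd h hz⟩
  choose y hy using this
  refine Set.ncard_le_ncard_of_injOn (fun z => blockPoint z (y z)) (fun z hz => hy z hz) ?_
    (Set.toFinite B)
  intro z _ w _ hzw
  exact congrArg Prod.fst (@blockPoint_injective _ b n (z, y z) (w, y w) hzw)

end Covers

/-! ### Asymptotics of volumes and boundaries -/

section Asymptotics

variable {d : ℕ}

lemma tendsto_apply_atTop (k : Fin d) : Tendsto (fun m : Fin d → ℕ => m k) atTop atTop :=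
  tendsto_atTop.2 fun b => (eventually_ge_atTop fun _ => b).mono fun _ h => h k

lemma eventually_le_all (c : ℕ) : ∀ᶠ m : Fin d → ℕ in atTop, ∀ k, c ≤ m k :=
  eventually_ge_atTop fun _ => c

lemma vol_pos {m : Fin d → ℕ} (hm : ∀ k, 0 < m k) : 0 < vol m :=
  Finset.prod_pos fun k _ => hm k

lemma eventually_vol_pos : ∀ᶠ m : Fin d → ℕ in atTop, 0 < vol m :=
  (eventually_le_all 1).mono fun _ h => vol_pos h

lemma tendsto_vol (hd : 1 ≤ d) : Tendsto (vol : (Fin d → ℕ) → ℕ) atTop atTop := by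
  refine tendsto_atTop_mono' _ ?_ (tendsto_apply_atTop ⟨0, hd⟩)
  filter_upwards [eventually_le_all 1] with m hm
  exact Finset.single_le_prod' (f := m) (fun k _ => hm k) (Finset.mem_univ _)

lemma tendsto_vol_real (hd : 1 ≤ d) :
    Tendsto (fun m : Fin d → ℕ => (vol m : ℝ)) atTop atTop :=
  tendsto_natCast_atTop_atTop.comp (tendsto_vol hd)

lemma tendsto_const_div_vol (hd : 1 ≤ d) (c : ℝ) :
    Tendsto (fun m : Fin d → ℕ => c / vol m) atTop (𝓝 0) :=
  (tendsto_vol_real hd).const_div_atTop c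

lemma tendsto_vol_div (b : Fin d → ℕ) (hb : ∀ k, 0 < b k) :
    Tendsto (fun n : Fin d → ℕ => (vol (fun k => n k / b k) * vol b : ℝ) / vol n) atTop (𝓝 1) := by
  have h1 : ∀ k, Tendsto (fun n : ℕ => ((n / b k : ℕ) * b k : ℝ) / n) atTop (𝓝 1) := by
    intro k
    have hb0 : (0 : ℝ) < b k := by exact_mod_cast hb k
    have h2 : Tendsto (fun n : ℕ => 1 - (b k : ℝ) / n) atTop (𝓝 1) := by
      simpa using (tendsto_const_nhds (x := (1 : ℝ))).sub
        (tendsto_natCast_atTop_atTop.const_div_atTop (b k : ℝ))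
    refine tendsto_of_tendsto_of_tendsto_of_le_of_le' h2 tendsto_const_nhds ?_ ?_
    · filter_upwards [eventually_gt_atTop 0] with n hn
      have hn0 : (0 : ℝ) < n := by exact_mod_cast hn
      rw [le_div_iff₀ hn0, sub_mul, div_mul_cancel₀ _ hn0.ne', one_mul]
      have h3 : n ≤ n / b k * b k + b k := by
        have h4 := Nat.div_add_mod n (b k)
        have h5 := Nat.mod_lt n (hb k)
        rw [mul_comm] at h4
        omega
      have : (n : ℝ) ≤ (n / b k : ℕ) * b k + b k := by exact_mod_cast h3
      linarith
    · filter_upwards [eventually_gt_atTop 0] with n hn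
      have hn0 : (0 : ℝ) < n := by exact_mod_cast hn
      rw [div_le_one hn0]
      exact_mod_cast Nat.div_mul_le_self n (b k)
  have h2 := tendsto_finsetProd (Finset.univ : Finset (Fin d)) fun k _ =>
    (h1 k).comp (tendsto_apply_atTop k)
  simp only [Finset.prod_const_one] at h2
  refine h2.congr fun n => ?_
  simp only [Function.comp_apply, vol, Finset.prod_div_distrib, Finset.prod_mul_distrib,
    Nat.cast_prod]

open Classical in
-- The complement of the boundary is a product of sets with at least `m k - 2` elements.
lemma tendsto_bdry : Tendsto (fun m : Fin d → ℕ => ((bdry m).card : ℝ) / vol m) atTop (𝓝 0) := by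
  have h1 : ∀ m : Fin d → ℕ, (∀ k, 2 ≤ m k) → (vol m : ℝ) - ∏ k, ((m k : ℝ) - 2) ≥ (bdry m).card := by
    intro m hm
    set I : (k : Fin d) → Finset (Fin (m k)) := fun k =>
      Finset.univ.filter fun j => ¬ ((j : ℕ) = 0 ∨ (j : ℕ) + 1 = m k) with hI
    have h2 : bdry m = (Fintype.piFinset I)ᶜ := by
      ext i
      simp only [bdry, hI, Finset.mem_filter, Finset.mem_univ, true_and, Finset.mem_compl,
        Fintype.mem_piFinset, not_forall, not_not]
    have h3 : ∀ k, m k ≤ (I k).card + 2 := by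
      intro k
      have h4 := Finset.card_filter_add_card_filter_not (s := (Finset.univ : Finset (Fin (m k))))
        fun j : Fin (m k) => (j : ℕ) = 0 ∨ (j : ℕ) + 1 = m k
      rw [Finset.card_univ, Fintype.card_fin, Finset.filter_or] at h4
      have h5 := Finset.card_union_le
        ((Finset.univ : Finset (Fin (m k))).filter fun j : Fin (m k) => (j : ℕ) = 0)
        ((Finset.univ : Finset (Fin (m k))).filter fun j : Fin (m k) => (j : ℕ) + 1 = m k)
      have h6 : ((Finset.univ : Finset (Fin (m k))).filter fun j : Fin (m k) => (j : ℕ) = 0).card ≤ 1 :=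
        Finset.card_le_one.2 fun a ha b hb => by
          simp only [Finset.mem_filter] at ha hb
          exact Fin.ext (by omega)
      have h7 : ((Finset.univ : Finset (Fin (m k))).filter fun j : Fin (m k) => (j : ℕ) + 1 = m k).card ≤ 1 :=
        Finset.card_le_one.2 fun a ha b hb => by
          simp only [Finset.mem_filter] at ha hb
          exact Fin.ext (by omega)
      simp only [hI]
      omega
    have h4 : (bdry m).card + ∏ k, (I k).card = vol m := by
      rw [h2, ← Fintype.card_piFinset, Finset.card_compl_add_card, card_box]
    have h5 : ∏ k, ((m k : ℝ) - 2) ≤ ∏ k, ((I k).card : ℝ) :=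
      Finset.prod_le_prod (fun k _ => by have := hm k; simpa using this) fun k _ => by
        have : (m k : ℝ) ≤ (I k).card + 2 := by exact_mod_cast h3 k
        linarith
    have h6 : ((bdry m).card : ℝ) + ∏ k, ((I k).card : ℝ) = vol m := by exact_mod_cast h4
    linarith
  have h2 : Tendsto (fun m : Fin d → ℕ => 1 - ∏ k, (1 - (2 : ℝ) / m k)) atTop (𝓝 0) := by
    have h3 := tendsto_finsetProd (Finset.univ : Finset (Fin d)) fun k _ =>
      (tendsto_const_nhds (x := (1 : ℝ))).sub
        ((tendsto_natCast_atTop_atTop.comp (tendsto_apply_atTop k)).const_div_atTop (2 : ℝ))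
    simp only [sub_zero, Finset.prod_const_one] at h3
    simpa using (tendsto_const_nhds (x := (1 : ℝ))).sub h3
  refine tendsto_of_tendsto_of_tendsto_of_le_of_le' tendsto_const_nhds h2
    (Eventually.of_forall fun m => by positivity) ?_
  filter_upwards [eventually_le_all 2] with m hm
  have hv : (0 : ℝ) < vol m := by
    exact_mod_cast vol_pos fun k => lt_of_lt_of_le two_pos (hm k)
  have h3 : ∏ k, (1 - (2 : ℝ) / m k) = (∏ k, ((m k : ℝ) - 2)) / vol m := by
    simp only [vol, Nat.cast_prod, ← Finset.prod_div_distrib]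
    refine Finset.prod_congr rfl fun k _ => ?_
    have : (m k : ℝ) ≠ 0 := by have := hm k; positivity
    field_simp
  rw [h3, div_le_iff₀ hv, sub_mul, one_mul, div_mul_cancel₀ _ hv.ne']
  exact h1 m hm

/-! ### Existence of limits -/

lemma normLog_nonneg (m : Fin d → ℕ) (n : ℕ) : 0 ≤ normLog m n :=
  div_nonneg (Real.log_natCast_nonneg n) (Nat.cast_nonneg _)

lemma normLog_mono (m : Fin d → ℕ) {n n' : ℕ} (h0 : 0 < n) (h : n ≤ n') :
    normLog m n ≤ normLog m n' :=
  div_le_div_of_nonneg_right (Real.log_le_log (by exact_mod_cast h0) (by exact_mod_cast h))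
    (Nat.cast_nonneg _)

lemma normLog_mono' (m : Fin d → ℕ) {n n' : ℕ} (h : n ≤ n') : normLog m n ≤ normLog m n' := by
  rcases Nat.eq_zero_or_pos n with rfl | h0
  · simpa [normLog] using normLog_nonneg m n'
  · exact normLog_mono m h0 h

lemma normLog_le_log_card {α : Type} [Fintype α] [Nonempty α] {m : Fin d → ℕ}
    (X : Set (Box m → α)) : normLog m X.ncard ≤ Real.log (Fintype.card α) := by
  classical
  have h1 : X.ncard ≤ Fintype.card α ^ vol m := by
    rw [Set.ncard_eq_toFinset_card', ← card_box, ← Fintype.card_fun]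
    exact Finset.card_le_univ _
  refine (normLog_mono' m h1).trans ?_
  unfold normLog
  push_cast
  rw [Real.log_pow]
  have hC := Real.log_natCast_nonneg (Fintype.card α)
  rcases Nat.eq_zero_or_pos (vol m) with h0 | h0
  · simpa [h0] using hC
  · have : (vol m : ℝ) ≠ 0 := by positivity
    rw [mul_div_cancel_left₀ _ this]

lemma normLog_le_of_blocks {α : Type} [Fintype α] [Nonempty α] {b n : Fin d → ℕ}
    (hb : 0 < vol b) (hn : 0 < vol n)
    {K : Set (Box b → α)} (hK : K.Nonempty) {X : Set (Box n → α)} {r : ℕ}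
    (h : ∀ ψ ∈ X, {z : Box fun k => n k / b k | (fun y => ψ (blockPoint z y)) ∉ K}.ncard ≤ r) :
    normLog n X.ncard ≤ normLog b K.ncard + Real.log 2 / vol b +
      (vol b * (r / vol n) + (1 - vol (fun k => n k / b k) * vol b / vol n)) *
        Real.log (Fintype.card α) := by
  have h1 := log_ncard_le_of_blocks hK h
  have hv := vol_div_mul_le b n
  set Q := vol fun k => n k / b k
  have hb' : (0 : ℝ) < vol b := by exact_mod_cast hb
  have hn' : (0 : ℝ) < vol n := by exact_mod_cast hn
  have hv' : (Q * vol b : ℝ) ≤ vol n := by exact_mod_cast hv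
  have h2 : 0 ≤ Real.log 2 + Real.log K.ncard :=
    add_nonneg (Real.log_nonneg one_le_two) (Real.log_natCast_nonneg _)
  have h3 : (Q : ℝ) ≤ vol n / vol b := (le_div_iff₀ hb').2 hv'
  have h4 := mul_le_mul_of_nonneg_right h3 h2
  unfold normLog
  rw [div_le_iff₀ hn']
  refine (h1.trans (add_le_add_left h4 _)).trans (le_of_eq ?_)
  field_simp
  ring

/-- With `b` fixed, both o(|n|) bad blocks and the points outside all complete blocks contribute a
vanishing amount. -/
lemma eventually_normLog_le_of_blocks {α : Type} [Fintype α] [Nonempty α] {b : Fin d → ℕ}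
    (hb : ∀ k, 0 < b k) {K : Set (Box b → α)} (hK : K.Nonempty) {ι : Type*} {l : Filter ι}
    {n : ι → Fin d → ℕ} (hn : Tendsto n l atTop) {X : (a : ι) → Set (Box (n a) → α)} {r : ι → ℕ}
    (hr : Tendsto (fun a => (r a : ℝ) / vol (n a)) l (𝓝 0))
    (h : ∀ᶠ a in l, ∀ ψ ∈ X a,
      {z : Box fun k => n a k / b k | (fun y => ψ (blockPoint z y)) ∉ K}.ncard ≤ r a)
    {ε : ℝ} (hε : 0 < ε) :
    ∀ᶠ a in l, normLog (n a) (X a).ncard ≤ normLog b K.ncard + Real.log 2 / vol b + ε := by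
  have h1 : Tendsto (fun a => ((vol b : ℝ) * (r a / vol (n a)) +
      (1 - vol (fun k => n a k / b k) * vol b / vol (n a))) * Real.log (Fintype.card α)) l
      (𝓝 ((vol b * 0 + (1 - 1)) * Real.log (Fintype.card α))) :=
    ((hr.const_mul _).add (tendsto_const_nhds.sub ((tendsto_vol_div b hb).comp hn))).mul_const _
  simp only [mul_zero, sub_self, add_zero, zero_mul] at h1
  filter_upwards [h, h1.eventually (gt_mem_nhds hε), hn.eventually eventually_vol_pos]
    with a h2 h3 h4
  have := normLog_le_of_blocks (vol_pos hb) h4 hK h2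
  linarith

/-- A Fekete argument: take a box `b` with value near the liminf and so large that `c / vol b` is
negligible. The hypothesis then bounds all later values by nearly the liminf. -/
lemma exists_tendsto_of_blocks (hd : 1 ≤ d) {f : (Fin d → ℕ) → ℝ} {c C : ℝ}
    (h0 : ∀ n, 0 ≤ f n) (hC : ∀ n, f n ≤ C)
    (h : ∀ b : Fin d → ℕ, (∀ k, 0 < b k) → ∀ ε > 0,
      ∀ᶠ n in atTop, f n ≤ f b + c / vol b + ε) :
    ∃ L, Tendsto f atTop (𝓝 L) := by
  have hb1 : IsBoundedUnder (· ≥ ·) atTop f := isBoundedUnder_of ⟨0, h0⟩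
  have hb2 : IsBoundedUnder (· ≤ ·) atTop f := isBoundedUnder_of ⟨C, hC⟩
  refine ⟨liminf f atTop, ?_⟩
  rw [Metric.tendsto_nhds]
  intro ε hε
  have h1 : ∃ᶠ n in atTop, f n < liminf f atTop + ε / 3 :=
    frequently_lt_of_liminf_lt hb2.isCoboundedUnder_ge (by linarith)
  have h2 : ∀ᶠ n in atTop, liminf f atTop - ε < f n :=
    eventually_lt_of_lt_liminf (by linarith) hb1
  have h3 : ∀ᶠ n : Fin d → ℕ in atTop, c / vol n < ε / 3 :=
    (tendsto_const_div_vol hd c).eventually (gt_mem_nhds (by linarith))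
  obtain ⟨b, hb, hb3, hb4⟩ := (h1.and_eventually (h3.and (eventually_le_all 1))).exists
  filter_upwards [h2, h b hb4 (ε / 3) (by linarith)] with n h5 h6
  rw [Real.dist_eq, abs_lt]
  constructor <;> linarith

lemma restrict_mem_boxCovers {α : Type} {Γ : Fin d → α → α → Prop} {b n : Fin d → ℕ}
    {ψ : Box n → α} (hψ : ψ ∈ boxCovers Γ n) (z : Box fun k => n k / b k) :
    (fun y => ψ (blockPoint z y)) ∈ boxCovers Γ b := by
  intro k i j hij
  refine hψ k _ _ ?_
  funext l
  have h1 := congrFun hij l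
  simp only [Box.toGrid, blockPoint, Pi.add_apply] at h1 ⊢
  push_cast
  linarith

lemma exists_tendsto_boxCovers (hd : 1 ≤ d) {α : Type} [Fintype α] [Nonempty α]
    (Γ : Fin d → α → α → Prop) (hne : ∀ m, (boxCovers Γ m).Nonempty) :
    ∃ L, Tendsto (fun m => normLog m (boxCovers Γ m).ncard) atTop (𝓝 L) := by
  refine exists_tendsto_of_blocks (c := Real.log 2) hd (fun n => normLog_nonneg _ _)
    (fun n => normLog_le_log_card _) fun b hb ε hε => ?_
  refine eventually_normLog_le_of_blocks hb (hne b) tendsto_id (r := fun _ => 0) (by simp)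
    (Eventually.of_forall fun n ψ hψ => ?_) hε
  have : {z : Box fun k => n k / b k | (fun y => ψ (blockPoint z y)) ∉ boxCovers Γ b} = ∅ :=
    Set.eq_empty_of_forall_notMem fun z hz => hz (restrict_mem_boxCovers hψ z)
  exact (congrArg Set.ncard this).trans_le (by simp)

lemma tendsto_mdEntropy (hd : 1 ≤ d) :
    Tendsto (fun m : Fin d → ℕ => normLog m (mdCovers m).ncard) atTop (𝓝 (mdEntropy d)) :=
  tendsto_nhds_limUnder (exists_tendsto_boxCovers hd _ mdCovers_nonempty)

lemma tendsto_dimerEntropy (hd : 1 ≤ d) :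
    Tendsto (fun m : Fin d → ℕ => normLog m (dimerCovers m).ncard) atTop
      (𝓝 (dimerEntropy d)) :=
  have : Nonempty (DimerColor d) := ⟨Sum.inl ⟨0, hd⟩⟩
  tendsto_nhds_limUnder (exists_tendsto_boxCovers hd _ (dimerCovers_nonempty hd))

end Asymptotics

/-! ### The entropy with given dimer density -/

section Density

variable {d : ℕ}

lemma tendsto_densityFilter {ι : Type*} {l : Filter ι} {p : ℝ} {m : ι → Fin d → ℕ} {s : ι → ℕ}
    (hs : ∀ᶠ a in l, 2 * s a ≤ vol (m a)) (hm : Tendsto m l atTop)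
    (hp : Tendsto (fun a => 2 * (s a : ℝ) / (vol (m a) : ℝ)) l (𝓝 p)) :
    Tendsto (fun a => (m a, s a)) l (densityFilter d p) := by
  refine tendsto_inf.2 ⟨tendsto_inf.2 ⟨tendsto_comap_iff.2 hm, ?_⟩, tendsto_comap_iff.2 hp⟩
  exact tendsto_principal.2 hs

lemma tendsto_fst_densityFilter (p : ℝ) :
    Tendsto (Prod.fst : (Fin d → ℕ) × ℕ → Fin d → ℕ) (densityFilter d p) atTop :=
  tendsto_comap.mono_left (inf_le_left.trans inf_le_left)

lemma eventually_le_densityFilter (p : ℝ) :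
    ∀ᶠ x in densityFilter d p, 2 * x.2 ≤ vol x.1 :=
  Filter.Eventually.filter_mono (inf_le_left.trans inf_le_right)
    (eventually_principal.2 fun _ h => h)

lemma tendsto_density_densityFilter (p : ℝ) :
    Tendsto (fun x : (Fin d → ℕ) × ℕ => 2 * (x.2 : ℝ) / (vol x.1 : ℝ)) (densityFilter d p) (𝓝 p) :=
  tendsto_comap.mono_left inf_le_right

lemma tendsto_const_atTop_pi : Tendsto (fun (q : ℕ) (_ : Fin d) => q) atTop atTop :=
  tendsto_atTop.2 fun b => (eventually_ge_atTop (∑ k, b k)).mono fun _ hq k =>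
    (Finset.single_le_sum (f := b) (fun _ _ => Nat.zero_le _) (Finset.mem_univ k)).trans hq

/-- Cubes with the integer part of `p / 2 * vol` as dimer count. Nontriviality of the filter makes
its limits unique. -/
lemma densityFilter_neBot (hd : 1 ≤ d) {p : ℝ} (hp : p ∈ Set.Icc (0 : ℝ) 1) :
    (densityFilter d p).NeBot := by
  set m : ℕ → Fin d → ℕ := fun q _ => q
  set s : ℕ → ℕ := fun q => ⌊p / 2 * vol (m q)⌋₊
  have hnn : ∀ q, 0 ≤ p / 2 * vol (m q) := fun q =>
    mul_nonneg (div_nonneg hp.1 two_pos.le) (Nat.cast_nonneg _)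
  refine (tendsto_densityFilter (m := m) (s := s) (l := atTop) ?_ tendsto_const_atTop_pi ?_).neBot
  · refine Eventually.of_forall fun q => ?_
    have h1 := Nat.floor_le (hnn q)
    have h2 : (0 : ℝ) ≤ vol (m q) := Nat.cast_nonneg _
    have h3 : (2 * s q : ℝ) ≤ vol (m q) := by nlinarith [hp.2]
    exact_mod_cast h3
  · have h1 := (tendsto_const_div_vol hd (2 : ℝ)).comp (tendsto_const_atTop_pi (d := d))
    have h2 : Tendsto (fun q => p - (2 : ℝ) / vol (m q)) atTop (𝓝 p) := by
      simpa using (tendsto_const_nhds (x := p)).sub h1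
    refine tendsto_of_tendsto_of_tendsto_of_le_of_le' h2 tendsto_const_nhds ?_ ?_
    all_goals
      filter_upwards [(tendsto_const_atTop_pi (d := d)).eventually eventually_vol_pos] with q hq
      have hv : (0 : ℝ) < vol (m q) := by exact_mod_cast hq
      have h3 := Nat.floor_le (hnn q)
      have h4 := Nat.lt_floor_add_one (p / 2 * vol (m q))
    · rw [le_div_iff₀ hv, sub_mul, div_mul_cancel₀ _ hv.ne']
      linarith
    · rw [div_le_iff₀ hv]
      linarith

/-- The normalized logarithm of the number of tilings with a given number of dimers. -/
noncomputable def tilingRate (x : (Fin d → ℕ) × ℕ) : ℝ :=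
  normLog x.1 (mdTilingsWith x.1 x.2).ncard

/-- Blocks with `t` dimers fill a proportion `θ` of a large box. The hypothesis `hp` says that they
use fewer dimers than prescribed, `hp'` that they leave fewer uncovered points than allowed, or none
at all. -/
lemma eventually_le_tilingRate (hd : 1 ≤ d) {b : Fin d → ℕ} (hb : ∀ k, 0 < b k)
    (hb' : ∀ k, Even (b k)) {t : ℕ} (ht : 2 * t ≤ vol b) {θ p : ℝ} (h0 : 0 ≤ θ) (h1 : θ < 1)
    (hp : θ * (2 * t / vol b) < p) (hp' : 2 * t = vol b ∨ θ * (1 - 2 * t / vol b) < 1 - p)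
    {ε : ℝ} (hε : 0 < ε) :
    ∀ᶠ x in densityFilter d p,
      θ * normLog b (numMatchings (boxF b) (2 * t)) - ε < tilingRate x := by
  set N := numMatchings (boxF b) (2 * t) with hN
  have hvb : (0 : ℝ) < vol b := by exact_mod_cast vol_pos hb
  have e1 := ((tendsto_vol_div b hb).comp (tendsto_fst_densityFilter (d := d) p)).eventually
    (lt_mem_nhds h1)
  have e2 := (tendsto_density_densityFilter (d := d) p).eventually (lt_mem_nhds hp)
  have e3 : ∀ᶠ x in densityFilter d p,
      2 * t = vol b ∨ θ * (1 - 2 * t / vol b) < 1 - 2 * (x.2 : ℝ) / vol x.1 := by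
    rcases hp' with h | h
    · exact Eventually.of_forall fun _ => Or.inl h
    · exact (((tendsto_const_nhds (x := (1 : ℝ))).sub
        (tendsto_density_densityFilter (d := d) p)).eventually (lt_mem_nhds h)).mono
          fun _ h => Or.inr h
  have e4 := ((tendsto_const_div_vol hd (Real.log N)).comp
    (tendsto_fst_densityFilter (d := d) p)).eventually (gt_mem_nhds hε)
  have e5 := (tendsto_fst_densityFilter (d := d) p).eventually eventually_vol_pos
  filter_upwards [e1, e2, e3, e4, e5, eventually_le_densityFilter p] with ⟨n, s⟩ f1 f2 f3 f4 f5 f6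
  simp only [Function.comp_apply] at f1 f2 f3 f4 f5 f6
  have hvn : (0 : ℝ) < vol n := by exact_mod_cast f5
  rw [lt_div_iff₀ hvn] at f1 f2
  -- The number of blocks needed to fill the proportion `θ`.
  set i := ⌊θ * vol n / vol b⌋₊ with hi
  have hi0 : (i : ℝ) ≤ θ * vol n / vol b := Nat.floor_le (by positivity)
  have hi1 : θ * vol n / vol b < i + 1 := Nat.lt_floor_add_one _
  have hiv : (i : ℝ) * vol b ≤ θ * vol n := (le_div_iff₀ hvb).1 hi0
  have g1 : i ≤ vol fun k => n k / b k := by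
    have : (i : ℝ) * vol b ≤ (vol fun k => n k / b k : ℕ) * vol b := hiv.trans f1.le
    exact_mod_cast le_of_mul_le_mul_right this hvb
  have g2 : i * t ≤ s := by
    have h2 : (i : ℝ) * (2 * t) ≤ 2 * s := by
      have h3 : (i : ℝ) * (2 * t) ≤ θ * vol n / vol b * (2 * t) :=
        mul_le_mul_of_nonneg_right hi0 (by positivity)
      have h4 : θ * vol n / vol b * (2 * t) = θ * (2 * t / vol b) * vol n := by ring
      linarith
    have h3 : (i * t : ℝ) ≤ s := by linarith
    exact_mod_cast h3
  have g3 : 2 * s + i * vol b ≤ vol n + 2 * (i * t) := by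
    rcases f3 with f3 | f3
    · rw [← f3]
      have : i * (2 * t) = 2 * (i * t) := by ring
      omega
    · have h2 : θ * (1 - 2 * t / vol b) * vol n < vol n - 2 * s := by
        have := mul_lt_mul_of_pos_right f3 hvn
        rwa [sub_mul (1 : ℝ), div_mul_cancel₀ _ hvn.ne', one_mul] at this
      have h3 : (2 * t : ℝ) ≤ vol b := by exact_mod_cast ht
      have h4 : (i : ℝ) * (vol b - 2 * t) ≤ θ * vol n / vol b * (vol b - 2 * t) :=
        mul_le_mul_of_nonneg_right hi0 (by linarith)
      have h5 : θ * vol n / vol b * (vol b - 2 * t) = θ * (1 - 2 * t / vol b) * vol n := by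
        field_simp
      have h6 : (2 * s + i * vol b : ℝ) ≤ vol n + 2 * (i * t) := by linarith
      exact_mod_cast h6
  have g4 := normLog_mono' n (pow_le_numMatchings_box hd hb hb' g1 g2 g3)
  rw [← ncard_mdTilingsWith n s] at g4
  refine lt_of_lt_of_le ?_ g4
  unfold normLog
  push_cast
  rw [Real.log_pow, lt_div_iff₀ hvn, sub_mul]
  rw [div_lt_iff₀ hvn] at f4
  have hN0 : 0 ≤ Real.log N := Real.log_natCast_nonneg _
  have h7 := mul_le_mul_of_nonneg_right hi1.le hN0
  have h8 : θ * (Real.log N / vol b) * vol n = θ * vol n / vol b * Real.log N := by ring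
  rw [h8]
  linarith

lemma normLog_double {b : Fin d → ℕ} (hb : ∀ k, 0 < b k) (t : ℕ) :
    vol (fun k => 2 * b k) = 2 ^ d * vol b ∧
      normLog b (numMatchings (boxF b) (2 * t)) ≤
        normLog (fun k => 2 * b k) (numMatchings (boxF fun k => 2 * b k) (2 * (2 ^ d * t))) := by
  have hv : vol (fun k => 2 * b k) = 2 ^ d * vol b := by
    simp [vol, Finset.prod_mul_distrib]
  refine ⟨hv, ?_⟩
  have h1 := normLog_mono' (fun k => 2 * b k) (pow_le_numMatchings_double hb (2 * t))
  rw [mul_left_comm] at h1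
  refine le_trans (le_of_eq ?_) h1
  have hvb : (vol b : ℝ) ≠ 0 := by exact_mod_cast (vol_pos hb).ne'
  unfold normLog
  rw [hv]
  push_cast
  rw [Real.log_pow]
  push_cast
  field_simp

lemma tilingRate_nonneg (x : (Fin d → ℕ) × ℕ) : 0 ≤ tilingRate x := normLog_nonneg _ _

lemma tilingRate_le (x : (Fin d → ℕ) × ℕ) : tilingRate x ≤ Real.log (Fintype.card (Color d)) :=
  normLog_le_log_card _

/-- A box with rate near the limsup and density near `p`, doubled to have even sides, serves as
block for every later box. -/
lemma exists_tendsto_tilingRate_of_mem_Ioo (hd : 1 ≤ d) {p : ℝ} (hp : p ∈ Set.Ioo (0 : ℝ) 1) :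
    ∃ L, Tendsto tilingRate (densityFilter d p) (𝓝 L) := by
  have := densityFilter_neBot hd (Set.Ioo_subset_Icc_self hp)
  set F := densityFilter d p
  have hb1 : IsBoundedUnder (· ≥ ·) F (tilingRate (d := d)) := isBoundedUnder_of ⟨0, tilingRate_nonneg⟩
  have hb2 : IsBoundedUnder (· ≤ ·) F (tilingRate (d := d)) := isBoundedUnder_of ⟨_, tilingRate_le⟩
  set Λ := limsup tilingRate F with hΛ
  set C := Real.log (Fintype.card (Color d)) with hC
  have hC0 : 0 ≤ C := Real.log_natCast_nonneg _
  refine ⟨Λ, ?_⟩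
  rw [Metric.tendsto_nhds]
  intro ε hε
  have h1 : ∀ᶠ x in F, tilingRate x < Λ + ε := eventually_lt_of_limsup_lt (by linarith) hb2
  have h2 : ∃ᶠ x in F, Λ - ε / 3 < tilingRate x :=
    frequently_lt_of_lt_limsup hb1.isCoboundedUnder_le (by linarith)
  -- Filling only the proportion `1 - δ` leaves room to correct the density in either direction, as
  -- `0 < p < 1`, and costs at most `δ * C` in rate.
  obtain ⟨δ, hδ0, hδ1, hδC⟩ : ∃ δ : ℝ, 0 < δ ∧ δ ≤ 1 ∧ δ * C ≤ ε / 3 := by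
    refine ⟨min 1 (ε / (3 * (C + 1))), by positivity, min_le_left _ _, ?_⟩
    calc min 1 (ε / (3 * (C + 1))) * C ≤ ε / (3 * (C + 1)) * (C + 1) :=
          mul_le_mul (min_le_right _ _) (by linarith) hC0 (by positivity)
      _ = ε / 3 := by field_simp
  have ht := tendsto_density_densityFilter (d := d) p
  have h3 : ∀ᶠ x in F, (1 - δ) * (2 * (x.2 : ℝ) / vol x.1) < p := by
    refine (ht.const_mul (1 - δ)).eventually (gt_mem_nhds ?_)
    nlinarith [hp.1]
  have h4 : ∀ᶠ x in F, (1 - δ) * (1 - 2 * (x.2 : ℝ) / vol x.1) < 1 - p := by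
    refine ((tendsto_const_nhds.sub ht).const_mul (1 - δ)).eventually (gt_mem_nhds ?_)
    nlinarith [hp.2]
  have h5 := (tendsto_fst_densityFilter (d := d) p).eventually (eventually_le_all 1)
  obtain ⟨⟨b, t⟩, k2, k3, k4, k5, k6⟩ := (h2.and_eventually
    (h3.and (h4.and (h5.and (eventually_le_densityFilter p))))).exists
  dsimp only at k2 k3 k4 k5 k6
  obtain ⟨hv, hlog⟩ := normLog_double k5 t
  have hvb : (vol b : ℝ) ≠ 0 := by exact_mod_cast (vol_pos k5).ne'
  have hratio : 2 * ((2 ^ d * t : ℕ) : ℝ) / (vol fun k => 2 * b k : ℕ) = 2 * t / vol b := by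
    rw [hv]; push_cast; field_simp
  have h6 := eventually_le_tilingRate hd (b := fun k => 2 * b k) (t := 2 ^ d * t) (p := p)
    (fun k => by have := k5 k; omega) (fun k => even_two_mul _)
    (by rw [hv, mul_left_comm]; exact Nat.mul_le_mul_left _ k6) (θ := 1 - δ) (by linarith)
    (by linarith) (by rw [hratio]; exact k3) (Or.inr (by rw [hratio]; exact k4))
    (ε := ε / 3) (by linarith)
  filter_upwards [h1, h6] with x f1 f2
  rw [Real.dist_eq, abs_lt]
  have f3 : normLog b (numMatchings (boxF b) (2 * t)) = tilingRate (b, t) := by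
    rw [tilingRate, ncard_mdTilingsWith]
  have f4 := tilingRate_le (b, t)
  rw [f3] at hlog
  have f5 := mul_le_mul_of_nonneg_left hlog (by linarith : 0 ≤ 1 - δ)
  have f6 := mul_le_mul_of_nonneg_left f4 hδ0.le
  constructor <;> linarith

/-! ### The densities 0 and 1 -/

/-- Every block that is not purely monomers contains one of the `2 * s` covered points, and these
are o(|n|) in number. -/
lemma tendsto_tilingRate_zero (hd : 1 ≤ d) :
    Tendsto tilingRate (densityFilter d 0) (𝓝 0) := by
  rw [Metric.tendsto_nhds]
  intro ε hε
  obtain ⟨b, hb, hb1⟩ := (((tendsto_const_div_vol hd (Real.log 2)).eventually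
    (gt_mem_nhds (by linarith : 0 < ε / 2))).and (eventually_le_all 1)).exists
  have h1 := eventually_normLog_le_of_blocks hb1 (K := {fun _ => (none : Color d)})
    (Set.singleton_nonempty _) (tendsto_fst_densityFilter (d := d) 0)
    (X := fun x => mdTilingsWith x.1 x.2) (r := fun x => 2 * x.2)
    (by push_cast; exact tendsto_density_densityFilter (d := d) 0)
    (Eventually.of_forall fun x ψ hψ => by
      rw [← hψ.2, ← ncard_ne_none hψ.1]
      refine ncard_bad_blocks_le fun z hz => ?_
      by_contra! h
      refine hz (funext fun y => ?_)
      by_contra h'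
      exact h y h') (ε := ε / 2) (by linarith)
  filter_upwards [h1] with x f1
  have f2 : normLog b ({fun _ => (none : Color d)} : Set (Box b → Color d)).ncard = 0 := by
    simp [normLog]
  have f3 := tilingRate_nonneg x
  have f4 : tilingRate x ≤ _ := f1
  rw [Real.dist_eq, sub_zero, abs_of_nonneg f3]
  linarith

open Classical in
/-- Some even box has almost as many perfect matchings as the dimer entropy predicts. -/
lemma exists_box_dimerEntropy_lt (hd : 1 ≤ d) {ε : ℝ} (hε : 0 < ε) :
    ∃ b : Fin d → ℕ, (∀ k, 0 < b k) ∧ (∀ k, Even (b k)) ∧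
      dimerEntropy d - ε < normLog b (numMatchings (boxF b) (vol b)) := by
  have hlim := tendsto_dimerEntropy hd
  -- In dimension one the entropy is at most 0, so any even box will do; reflection within a face
  -- needs a second direction.
  rcases Nat.lt_or_ge d 2 with hd2 | hd2
  · obtain rfl : d = 1 := by omega
    have h1 : dimerEntropy 1 ≤ 0 := by
      refine le_of_tendsto_of_tendsto hlim (tendsto_const_div_vol hd (Real.log 2))
        (Eventually.of_forall fun m => ?_)
      simpa [normLog] using normLog_mono' m (ncard_dimerCovers_one_le m)
    refine ⟨fun _ => 2, fun _ => two_pos, fun _ => even_two, ?_⟩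
    have := normLog_nonneg (fun _ : Fin 1 => 2)
      (numMatchings (boxF fun _ : Fin 1 => 2) (vol fun _ : Fin 1 => 2))
    linarith
  set C := Real.log (2 * d + 1 : ℕ) with hC
  have h1 := hlim.eventually (lt_mem_nhds (by linarith : dimerEntropy d - ε / 2 < dimerEntropy d))
  have h2 : ∀ᶠ m : Fin d → ℕ in atTop, ((bdry m).card : ℝ) / vol m * C < ε / 2 := by
    have := (tendsto_bdry (d := d)).mul_const C
    rw [zero_mul] at this
    exact this.eventually (gt_mem_nhds (by linarith))
  obtain ⟨m, hm1, hm2, hm⟩ := (h1.and (h2.and (eventually_le_all 2))).exists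
  have hm0 : ∀ k, 0 < m k := fun k => lt_of_lt_of_le two_pos (hm k)
  have hvm : (0 : ℝ) < vol m := by exact_mod_cast vol_pos hm0
  obtain ⟨Ω, hΩ, hD, hcount⟩ := exists_ncard_dimerCovers_le hd m
  have hpos : 0 < (dimerCovers m).ncard :=
    (Set.ncard_pos (Set.toFinite _)).2 (dimerCovers_nonempty hd m)
  set N := numMatchings Ω Ω.card with hN
  have hN0 : 0 < N := by
    rcases Nat.eq_zero_or_pos N with h | h
    · rw [h, zero_mul] at hcount; omega
    · exact h
  have hy : dimerEntropy d - ε < Real.log N / vol m := by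
    have h3 : Real.log (dimerCovers m).ncard ≤ Real.log N + (bdry m).card * C := by
      have h4 : ((dimerCovers m).ncard : ℝ) ≤ N * ((2 * d + 1 : ℕ) : ℝ) ^ (bdry m).card := by
        exact_mod_cast hcount
      have h5 := Real.log_le_log (by exact_mod_cast hpos) h4
      rwa [Real.log_mul (by positivity) (by positivity), Real.log_pow] at h5
    have h6 := div_le_div_of_nonneg_right h3 hvm.le
    rw [add_div, mul_div_right_comm] at h6
    unfold normLog at hm1
    linarith
  obtain ⟨L, hL⟩ := exists_pow_le_numMatchings hd2 hm hΩ hD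
  set n : ℕ → Fin d → ℕ := fun q k => 2 * m k * q + 2 * L k with hn
  -- The copies of the box of sides `m` exhaust the unfolded box up to the collar, whose share
  -- vanishes as `q` grows.
  have hratio : Tendsto (fun q : ℕ => (vol (fun _ : Fin d => 2 * q) * vol m : ℝ) / vol (n q))
      atTop (𝓝 1) := by
    have h3 : ∀ k, Tendsto (fun q : ℕ => ((2 * q : ℕ) * m k : ℝ) / n q k) atTop (𝓝 1) := by
      intro k
      have hmk : (0 : ℝ) < m k := by exact_mod_cast hm0 k
      have h4 : Tendsto (fun q : ℕ => 1 / (1 + (L k / m k : ℝ) / q)) atTop (𝓝 (1 / (1 + 0))) :=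
        tendsto_const_nhds.div (tendsto_const_nhds.add
          (tendsto_natCast_atTop_atTop.const_div_atTop _)) (by norm_num)
      rw [add_zero, div_one] at h4
      refine h4.congr' ?_
      filter_upwards [eventually_gt_atTop 0] with q hq
      have hq' : (0 : ℝ) < q := by exact_mod_cast hq
      simp only [hn]
      push_cast
      field_simp
    have h5 := tendsto_finsetProd (Finset.univ : Finset (Fin d)) fun k _ => h3 k
    simp only [Finset.prod_const_one] at h5
    refine h5.congr fun q => ?_
    rw [Finset.prod_div_distrib, Finset.prod_mul_distrib]
    unfold vol
    rw [Nat.cast_prod, Nat.cast_prod, Nat.cast_prod]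
  have h3 := hratio.mul_const (Real.log N / vol m)
  rw [one_mul] at h3
  obtain ⟨q, hq1, hq2⟩ := ((h3.eventually (lt_mem_nhds hy)).and (eventually_ge_atTop 1)).exists
  have hn0 : ∀ k, 0 < n q k := fun k => by
    have := Nat.mul_pos (Nat.mul_pos two_pos (hm0 k)) hq2
    simp only [hn]; omega
  refine ⟨n q, hn0, fun k => ?_, hq1.trans_le ?_⟩
  · simp only [hn, mul_assoc]
    exact (even_two_mul _).add (even_two_mul _)
  · refine le_trans (le_of_eq ?_) (normLog_mono' (n q) (hL q hq2))
    unfold normLog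
    rw [Nat.cast_pow, Real.log_pow, ← hN]
    field_simp

lemma tendsto_tilingRate_one (hd : 1 ≤ d) :
    Tendsto tilingRate (densityFilter d 1) (𝓝 (dimerEntropy d)) := by
  rw [Metric.tendsto_nhds]
  intro ε hε
  -- Blocks without a monomer are dimer covers of `b`, and the number of monomers is o(|n|).
  have upper : ∀ᶠ x in densityFilter d 1, tilingRate x < dimerEntropy d + ε := by
    obtain ⟨b, hb1, hb2, hb⟩ := (((tendsto_dimerEntropy hd).eventually
      (gt_mem_nhds (by linarith : dimerEntropy d < dimerEntropy d + ε / 3))).and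
      (((tendsto_const_div_vol hd (Real.log 2)).eventually
      (gt_mem_nhds (by linarith : 0 < ε / 3))).and (eventually_le_all 1))).exists
    have hinj : Function.Injective fun (ψ : Box b → DimerColor d) i => (some (ψ i) : Color d) := by
      intro ψ ψ' h
      funext i
      exact Option.some_injective _ (congrFun h i)
    have hr : Tendsto (fun x : (Fin d → ℕ) × ℕ => ((vol x.1 - 2 * x.2 : ℕ) : ℝ) / vol x.1)
        (densityFilter d 1) (𝓝 0) := by
      have h1 := (tendsto_const_nhds (x := (1 : ℝ))).sub (tendsto_density_densityFilter (d := d) 1)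
      rw [sub_self] at h1
      refine h1.congr' ?_
      filter_upwards [eventually_le_densityFilter 1,
        (tendsto_fst_densityFilter (d := d) 1).eventually eventually_vol_pos] with x h2 h3
      have h4 : (vol x.1 : ℝ) ≠ 0 := by exact_mod_cast h3.ne'
      rw [Nat.cast_sub h2, sub_div, div_self h4]
      push_cast
      rfl
    have h1 := eventually_normLog_le_of_blocks hb
      (K := (fun (ψ : Box b → DimerColor d) i => (some (ψ i) : Color d)) '' dimerCovers b)
      ((dimerCovers_nonempty hd b).image _) (tendsto_fst_densityFilter (d := d) 1)
      (X := fun x => mdTilingsWith x.1 x.2) (r := fun x => vol x.1 - 2 * x.2) hr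
      (Eventually.of_forall fun x ψ hψ => by
        have h2 := ncard_eq_none hψ.1
        rw [hψ.2] at h2
        have h3 : vol x.1 - 2 * x.2 = {i | ψ i = none}.ncard := by omega
        rw [h3]
        refine ncard_bad_blocks_le fun z hz => ?_
        by_contra! h
        have h4 : ∀ y, ∃ c, ψ (blockPoint z y) = some c := fun y =>
          Option.ne_none_iff_exists'.1 (h y)
        choose φ hφ using h4
        have h5 : (fun y => (some (φ y) : Color d)) = fun y => ψ (blockPoint z y) :=
          funext fun y => (hφ y).symm
        refine hz ⟨φ, ?_, h5⟩
        have h6 := restrict_mem_boxCovers hψ.1.1 z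
        rw [← h5] at h6
        exact h6) (ε := ε / 3) (by linarith)
    rw [Set.ncard_image_of_injective _ hinj] at h1
    filter_upwards [h1] with x f1
    have f2 : tilingRate x ≤ _ := f1
    linarith
  -- Perfectly matched blocks leave no uncovered points, so the second alternative of the density
  -- condition is not needed at `p = 1`.
  have lower : ∀ᶠ x in densityFilter d 1, dimerEntropy d - ε < tilingRate x := by
    obtain ⟨b, hb, hb', hlt⟩ := exists_box_dimerEntropy_lt hd (by linarith : 0 < ε / 3)
    have hev : Even (vol b) := by
      unfold vol
      rw [← Finset.mul_prod_erase _ _ (Finset.mem_univ (⟨0, hd⟩ : Fin d))]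
      exact (hb' _).mul_right _
    have hvb : (vol b : ℝ) ≠ 0 := by exact_mod_cast (vol_pos hb).ne'
    have h2 : 2 * (vol b / 2) = vol b := Nat.two_mul_div_two_of_even hev
    have h2' : 2 * ((vol b / 2 : ℕ) : ℝ) / vol b = 1 := by
      have : 2 * ((vol b / 2 : ℕ) : ℝ) = vol b := by exact_mod_cast h2
      rw [this, div_self hvb]
    set y := normLog b (numMatchings (boxF b) (vol b)) with hy
    have hy0 : 0 ≤ y := normLog_nonneg _ _
    obtain ⟨δ, hδ0, hδ1, hδC⟩ : ∃ δ : ℝ, 0 < δ ∧ δ ≤ 1 ∧ δ * y ≤ ε / 3 := by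
      refine ⟨min 1 (ε / (3 * (y + 1))), by positivity, min_le_left _ _, ?_⟩
      calc min 1 (ε / (3 * (y + 1))) * y ≤ ε / (3 * (y + 1)) * (y + 1) :=
            mul_le_mul (min_le_right _ _) (by linarith) hy0 (by positivity)
        _ = ε / 3 := by field_simp
    have h3 := eventually_le_tilingRate hd hb hb' (t := vol b / 2) (p := 1) h2.le
      (θ := 1 - δ) (by linarith) (by linarith) (by rw [h2']; linarith) (Or.inl h2)
      (ε := ε / 3) (by linarith)
    rw [h2, ← hy] at h3
    filter_upwards [h3] with x f1
    linarith
  filter_upwards [upper, lower] with x f1 f2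
  rw [Real.dist_eq, abs_lt]
  constructor <;> linarith

lemma tendsto_tilingRate (hd : 1 ≤ d) {p : ℝ} (hp : p ∈ Set.Icc (0 : ℝ) 1) :
    Tendsto tilingRate (densityFilter d p) (𝓝 (densityEntropy d p)) := by
  refine tendsto_nhds_limUnder ?_
  rcases eq_or_lt_of_le hp.1 with h0 | h0
  · rw [← h0]
    exact ⟨_, tendsto_tilingRate_zero hd⟩
  rcases eq_or_lt_of_le hp.2 with h1 | h1
  · rw [h1]
    exact ⟨_, tendsto_tilingRate_one hd⟩
  exact exists_tendsto_tilingRate_of_mem_Ioo hd ⟨h0, h1⟩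

lemma tendsto_normLog_mdTilingsWith (hd : 1 ≤ d) {p : ℝ} (hp : p ∈ Set.Icc (0 : ℝ) 1)
    {m : ℕ → Fin d → ℕ} {s : ℕ → ℕ} (hs : ∀ q, 2 * s q ≤ vol (m q)) (hm : Tendsto m atTop atTop)
    (hlim : Tendsto (fun q => 2 * (s q : ℝ) / (vol (m q) : ℝ)) atTop (𝓝 p)) :
    Tendsto (fun q => normLog (m q) (mdTilingsWith (m q) (s q)).ncard) atTop
      (𝓝 (densityEntropy d p)) := by
  have h1 := tendsto_densityFilter (Eventually.of_forall hs) hm hlim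
  have h2 := (tendsto_tilingRate hd hp).comp h1
  simp only [tilingRate, Function.comp_def] at h2
  exact h2

/-! ### Values at the ends, the maximum, and boxes of even volume -/

lemma densityEntropy_zero (hd : 1 ≤ d) : densityEntropy d 0 = 0 :=
  have := densityFilter_neBot hd (p := 0) (by simp)
  tendsto_nhds_unique (tendsto_tilingRate hd (by simp)) (tendsto_tilingRate_zero hd)

lemma densityEntropy_one (hd : 1 ≤ d) : densityEntropy d 1 = dimerEntropy d :=
  have := densityFilter_neBot hd (p := 1) (by simp)
  tendsto_nhds_unique (tendsto_tilingRate hd (by simp)) (tendsto_tilingRate_one hd)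

lemma densityEntropy_le (hd : 1 ≤ d) {p : ℝ} (hp : p ∈ Set.Icc (0 : ℝ) 1) :
    densityEntropy d p ≤ mdEntropy d := by
  have := densityFilter_neBot hd hp
  exact le_of_tendsto_of_tendsto (tendsto_tilingRate hd hp)
    ((tendsto_mdEntropy hd).comp (tendsto_fst_densityFilter p))
    (Eventually.of_forall fun x => normLog_mono' _
      (Set.ncard_le_ncard (mdTilingsWith_subset _ _) (Set.toFinite _)))

/-- On cubes, take a dimer count with the most tilings, and by compactness a subsequence along which
its density converges to some `p`. Passing from covers to these tilings loses only the boundary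
factor and the number of possible counts. -/
lemma exists_mdEntropy_le (hd : 1 ≤ d) :
    ∃ p ∈ Set.Icc (0 : ℝ) 1, mdEntropy d ≤ densityEntropy d p := by
  set n : ℕ → Fin d → ℕ := fun q _ => q with hn
  have hn_lim : Tendsto n atTop atTop := tendsto_const_atTop_pi
  have hmax : ∀ q, ∃ s, 2 * s ≤ vol (n q) ∧ ∀ s', 2 * s' ≤ vol (n q) →
      (mdTilingsWith (n q) s').ncard ≤ (mdTilingsWith (n q) s).ncard := by
    intro q
    obtain ⟨s, hs, hmax⟩ := Finset.exists_max_image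
      ((Finset.range (vol (n q) + 1)).filter fun s => 2 * s ≤ vol (n q))
      (fun s => (mdTilingsWith (n q) s).ncard) ⟨0, by simp⟩
    refine ⟨s, (Finset.mem_filter.1 hs).2, fun s' hs' => hmax s' ?_⟩
    rw [Finset.mem_filter, Finset.mem_range]
    exact ⟨by omega, hs'⟩
  choose s hs hsmax using hmax
  have hmem : ∀ q, 2 * (s q : ℝ) / vol (n q) ∈ Set.Icc (0 : ℝ) 1 := by
    intro q
    refine ⟨by positivity, div_le_one_of_le₀ ?_ (Nat.cast_nonneg _)⟩
    exact_mod_cast hs q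
  obtain ⟨p, hp, φ, hφ, hlim⟩ := isCompact_Icc.tendsto_subseq hmem
  refine ⟨p, hp, ?_⟩
  have hnφ : Tendsto (fun q => n (φ q)) atTop atTop := hn_lim.comp hφ.tendsto_atTop
  have h1 := (tendsto_tilingRate hd hp).comp
    (tendsto_densityFilter (Eventually.of_forall fun q => hs (φ q)) hnφ hlim)
  set C := Real.log (2 * d + 1 : ℕ) with hC
  have h2 : Tendsto (fun m : Fin d → ℕ => normLog m (mdCovers m).ncard -
      ((bdry m).card : ℝ) / vol m * C - Real.log (vol m + 1 : ℕ) / vol m) atTop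
      (𝓝 (mdEntropy d)) := by
    have h3 : Tendsto (fun m : Fin d → ℕ => Real.log (vol m + 1 : ℕ) / vol m) atTop (𝓝 0) := by
      -- At x = `vol m + 1` the denominator 1 * x + (-1) equals `vol m`.
      have h4 := (Real.tendsto_pow_log_div_mul_add_atTop 1 (-1) 1 one_ne_zero).comp
        (tendsto_atTop_add_const_right _ (1 : ℝ) (tendsto_vol_real hd))
      refine h4.congr fun m => ?_
      simp
    simpa using ((tendsto_mdEntropy hd).sub ((tendsto_bdry (d := d)).mul_const C)).sub h3
  refine le_of_tendsto_of_tendsto (h2.comp hnφ) h1 ?_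
  filter_upwards [hnφ.eventually eventually_vol_pos] with q hq
  simp only [Function.comp_apply, tilingRate]
  set m := n (φ q)
  set T := (mdTilingsWith m (s (φ q))).ncard
  have hv : (0 : ℝ) < vol m := by exact_mod_cast hq
  have h5 : (mdCovers m).ncard ≤ (2 * d + 1) ^ (bdry m).card * ((vol m + 1) * T) :=
    (ncard_mdCovers_le m).trans (Nat.mul_le_mul_left _ (ncard_mdTilings_le (hsmax (φ q))))
  have h6 : 0 < (mdCovers m).ncard := (Set.ncard_pos (Set.toFinite _)).2 (mdCovers_nonempty m)
  have hT : 0 < T := by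
    rcases Nat.eq_zero_or_pos T with h | h
    · rw [h, mul_zero, mul_zero] at h5; omega
    · exact h
  have h7 : Real.log (mdCovers m).ncard ≤
      (bdry m).card * C + (Real.log (vol m + 1 : ℕ) + Real.log T) := by
    have h8 : ((mdCovers m).ncard : ℝ) ≤
        ((2 * d + 1 : ℕ) : ℝ) ^ (bdry m).card * ((vol m + 1 : ℕ) * T) := by exact_mod_cast h5
    have h9 := Real.log_le_log (by exact_mod_cast h6) h8
    rwa [Real.log_mul (by positivity) (by positivity), Real.log_mul (by positivity) (by positivity),
      Real.log_pow] at h9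
  have h8 := div_le_div_of_nonneg_right h7 hv.le
  rw [add_div, add_div, mul_div_right_comm] at h8
  unfold normLog
  linarith

/-- For even volume a dimer tiling is a monomer-dimer tiling with `vol m / 2` dimers, so this is the
case of density 1. -/
lemma tendsto_dimerTilings (hd : 1 ≤ d) :
    Tendsto (fun m : Fin d → ℕ => normLog m (dimerTilings m).ncard) (evenVolume d)
      (𝓝 (dimerEntropy d)) := by
  have hle : evenVolume d ≤ atTop := inf_le_left
  have hev : ∀ᶠ m in evenVolume d, Even (vol m) :=
    Filter.Eventually.filter_mono inf_le_right (eventually_principal.2 fun _ h => h)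
  have h1 : Tendsto (fun m : Fin d → ℕ => (m, vol m / 2)) (evenVolume d) (densityFilter d 1) := by
    refine tendsto_densityFilter (Eventually.of_forall fun m => Nat.mul_div_le _ _) hle ?_
    refine tendsto_const_nhds.congr' ?_
    filter_upwards [hev, hle eventually_vol_pos] with m h1 h2
    have h3 : 2 * ((vol m / 2 : ℕ) : ℝ) = vol m := by
      exact_mod_cast Nat.two_mul_div_two_of_even h1
    have h4 : (vol m : ℝ) ≠ 0 := by exact_mod_cast h2.ne'
    rw [h3, div_self h4]
  refine ((tendsto_tilingRate_one hd).comp h1).congr' ?_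
  filter_upwards [hev] with m h2
  rw [Function.comp_apply, tilingRate, ncard_dimerTilings h2]

lemma tendsto_dimerPeriodicCovers (hd : 1 ≤ d) :
    Tendsto (fun m : Fin d → ℕ => normLog m (dimerPeriodicCovers m).ncard) (evenVolume d)
      (𝓝 (dimerEntropy d)) := by
  have hle : evenVolume d ≤ atTop := inf_le_left
  refine tendsto_of_tendsto_of_tendsto_of_le_of_le' (tendsto_dimerTilings hd)
    ((tendsto_dimerEntropy hd).mono_left hle) ?_ (Eventually.of_forall fun m => normLog_mono' m
      (Set.ncard_le_ncard (dimerPeriodicCovers_subset m) (Set.toFinite _)))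
  filter_upwards [hle (eventually_le_all 1)] with m hm
  exact normLog_mono' m (Set.ncard_le_ncard (dimerTilings_subset_periodic hm) (Set.toFinite _))

lemma isGreatest_mdEntropy (hd : 1 ≤ d) :
    IsGreatest (densityEntropy d '' Set.Icc (0 : ℝ) 1) (mdEntropy d) := by
  obtain ⟨p, hp, h⟩ := exists_mdEntropy_le hd
  refine ⟨⟨p, hp, le_antisymm (densityEntropy_le hd hp) h⟩, ?_⟩
  rintro _ ⟨p, hp, rfl⟩
  exact densityEntropy_le hd hp

end Density

end MonomerDimer

theorem theorem4p1 (d : ℕ) (hd : 1 ≤ d) :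
    -- the limit that defines the monomer-dimer entropy exists
    Tendsto (fun m : Fin d → ℕ => MonomerDimer.normLog m (MonomerDimer.mdCovers m).ncard)
      atTop (𝓝 (MonomerDimer.mdEntropy d)) ∧
    -- the limit that defines the dimer entropy exists, and it is also the limit for periodic
    -- covers and for tilings of boxes of even volume
    Tendsto (fun m : Fin d → ℕ => MonomerDimer.normLog m (MonomerDimer.dimerCovers m).ncard)
      atTop (𝓝 (MonomerDimer.dimerEntropy d)) ∧
    Tendsto
      (fun m : Fin d → ℕ => MonomerDimer.normLog m (MonomerDimer.dimerPeriodicCovers m).ncard)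
      (MonomerDimer.evenVolume d) (𝓝 (MonomerDimer.dimerEntropy d)) ∧
    Tendsto (fun m : Fin d → ℕ => MonomerDimer.normLog m (MonomerDimer.dimerTilings m).ncard)
      (MonomerDimer.evenVolume d) (𝓝 (MonomerDimer.dimerEntropy d)) ∧
    -- the limits that define the entropy with dimer density `p` exist along all sequences
    (∀ p ∈ Set.Icc (0 : ℝ) 1, ∀ (m : ℕ → Fin d → ℕ) (s : ℕ → ℕ),
      (∀ q, 2 * s q ≤ MonomerDimer.vol (m q)) →
      Tendsto m atTop atTop →
      Tendsto (fun q => 2 * (s q : ℝ) / (MonomerDimer.vol (m q) : ℝ)) atTop (𝓝 p) →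
      Tendsto
        (fun q => MonomerDimer.normLog (m q) (MonomerDimer.mdTilingsWith (m q) (s q)).ncard)
        atTop (𝓝 (MonomerDimer.densityEntropy d p))) ∧
    MonomerDimer.densityEntropy d 0 = 0 ∧
    MonomerDimer.densityEntropy d 1 = MonomerDimer.dimerEntropy d ∧
    IsGreatest (MonomerDimer.densityEntropy d '' Set.Icc (0 : ℝ) 1)
      (MonomerDimer.mdEntropy d) :=
  ⟨MonomerDimer.tendsto_mdEntropy hd, MonomerDimer.tendsto_dimerEntropy hd,
    MonomerDimer.tendsto_dimerPeriodicCovers hd, MonomerDimer.tendsto_dimerTilings hd,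
    fun _ hp _ _ hs hm hlim => MonomerDimer.tendsto_normLog_mdTilingsWith hd hp hs hm hlim,
    MonomerDimer.densityEntropy_zero hd, MonomerDimer.densityEntropy_one hd,
    MonomerDimer.isGreatest_mdEntropy hd⟩
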